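/- Let $K$ be a field and let $\mathcal A$ be a $K$-linear abelian symmetric monoidal category (a tensor category) with $K$-bilinear product $\diamond$, unit object $\mathbf 1$ and symmetry $\gamma$. Assume that $\mathcal A$ is * autonomous: every object $A$ has a chosen object $A^*$ with morphisms $\Lambda_A:\mathbf 1\to A^*\diamond A$ (coform) and $\lambda_A:A\diamond A^*\to\mathbf 1$ (form) for which the two zigzag composites $A\to A$ and $A^*\to A^*$ are identities; * stable: $A^{**}=A$, and the canonical isomorphism $w_A:A^{**}\to A$, determined by $\gamma_{A^*,A}\circ\Lambda_A=(w_A\diamond \mathrm{id})\circ\Lambda_{A^*}$, is the identity; * semisimple: there is a finite set $\Sigma$ of objects, containing $\mathbf 1$, such that $\mathrm{Hom}(a,b)=0$ for $a\ne b$ in $\Sigma$, $\mathrm{Hom}(a,a)\cong K$ for $a\in\Sigma$, and every object is isomorphic to a finite direct sum of objects of $\Sigma$. Identify $\mathrm{Hom}(\mathbf 1,\mathbf 1)$ with $K$ by $c\cdot\mathrm{id}_{\mathbf 1}\leftrightarrow c$. The rank of an object $b$ is $r(b)=\lambda_{b^*}\circ\Lambda_b\in K$. For $l\in\mathbb Z$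 put $b^l=b\diamond\cdots\diamond b$ ($l$ factors) if $l\ge 0$ and $b^l=(b^*)^{|l|}$ if $l<0$. For $l\ge0$ let $f(b,l):b\diamond b^l\to b^l\diamond b$ be the identity of $b^{l+1}$ (up to bracketing), whose in-end is the first factor of the source and whose out-end is the last factor of the target. For $l<0$ let $f(b,l):b\diamond b^l\to b^l\diamond b$ be the reverse of $f(b^*,|l|)$: the in-end and the out-end $b^*$ of $f(b^*,|l|)$ are turned, by the coform and the form of $b$, into an out-end and an in-end $b$. For a word $R=x_{i_1}^{l_1}\cdots x_{i_k}^{l_k}$ in $x_1,\dots,x_n$ (not necessarily reduced, possibly empty) and an object $b$, let $R(b)=b^{l_1}\diamond\cdots\diamond b^{l_k}$, and let $[R,b]:R(b)\to R(b)$ be $r(b)$ times the morphism obtained from $f(b,l_1),\dots,f(b,l_k)$ by connecting the out-end of each to the in-end of the next, and closing up by connecting the last out-end to the first in-end (with the form $\lambda_{b^*}$ and the coform $\Lambda_b$); for the empty word this is $r(b)^2\,\mathrm{id}_{\mathbf 1}$. Let $g_k(R,b)$ be the product, in order, of those factors $b^{l_s}$ of $R(b)$ with $i_s=k$. Let $P=\langle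 x_1,\dots,x_n\mid R_1,\dots,R_m\rangle$ be a finite group presentation whose relators are spelled by words. For $\underline b=(b_1,\dots,b_m)\in\Sigma^m$ let $[P,\underline b]=[R_1,b_1]\diamond\cdots\diamond[R_m,b_m]$, let $G_k(\underline b)=g_k(R_1,b_1)\diamond\cdots\diamond g_k(R_m,b_m)$, and let $\xi(P):R_1(b_1)\diamond\cdots\diamond R_m(b_m)\to G_1(\underline b)\diamond\cdots\diamond G_n(\underline b)$ be the permutation of factors, composed of the structural isomorphisms of $\mathcal A$. Define $$Q(P)=\sum_{\underline b\in\Sigma^m}\mathrm{Tr}_{\{G_k(\underline b)\to\mathbf 1\}_k}\bigl(\xi(P)\circ[P,\underline b]\circ\xi(P)^{-1}\bigr)\in K .$$ Here, for an endomorphism $\phi$ of $A_1\diamond\cdots\diamond A_n$ and bases $\{\epsilon^k_i\}_i$ of $\mathrm{Hom}(\mathbf 1,A_k)$ with dual bases $\{\epsilon^{k*}_i\}_i$ of $\mathrm{Hom}(A_k,\mathbf 1)$, i.e. $\epsilon^{k*}_i\circ\epsilon^k_j=\delta_{ij}\,\mathrm{id}_{\mathbf 1}$, the partial trace is $$\mathrm{Tr}_{\{A_k\to\mathbf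 1\}_k}(\phi)=\sum_{i_1,\dots,i_n}(\epsilon^{1*}_{i_1}\diamond\cdots\diamond\epsilon^{n*}_{i_n})\circ\phi\circ(\epsilon^1_{i_1}\diamond\cdots\diamond\epsilon^n_{i_n})\in\mathrm{End}(\mathbf 1\diamond\cdots\diamond\mathbf 1)\cong K .$$ **Theorem.** $Q(P)$ is unchanged by each of the Andrews–Curtis moves: (i) two relators are interchanged; (ii) a relator $R$ is replaced with $gRg^{-1}$, for any element $g$ of the free group on the generators; (iii) a relator $R$ is replaced with $R^{-1}$; (iv) a relator $R_i$ is replaced with $R_iR_s$, $s\neq i$; (v) a new generator $y$ and the new relator $y$ are added; (vi) the reverse of (v). That is, if the presentations $P$ and $P'$, whose relators are regarded as elements of the free group and may be spelled by any words, are related by one of these moves, then $Q(P')=Q(P)$. -/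

import Mathlib

open CategoryTheory MonoidalCategory

universe v u w

noncomputable section

namespace QuinnInvariant

/-! ## Words, group presentations and the Andrews–Curtis moves -/

/-- A word `x_{i₁}^{l₁} x_{i₂}^{l₂} ⋯ x_{iₖ}^{lₖ}` in the generators `x₀, …, x_{n-1}`, written as
the list of its factors `(i, l)`. No reducedness is required. -/
abbrev Word (n : ℕ) : Type := List (Fin n × ℤ)

/-- The element of the free group that a word spells. -/
def Word.value {n : ℕ} (R : Word n) : FreeGroup (Fin n) :=
  (R.map fun s => FreeGroup.of s.1 ^ s.2).prod

/-- A finite group presentation: finitely many generators, and a finite sequence of relators, which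
are elements of the free group on the generators. -/
structure Presentation where
  numGens : ℕ
  numRels : ℕ
  rel : Fin numRels → FreeGroup (Fin numGens)

/-- A finite group presentation in which every relator is given as an explicit word. -/
structure WordPresentation where
  numGens : ℕ
  numRels : ℕ
  rel : Fin numRels → Word numGens

/-- The group presentation that a word presentation spells. -/
def WordPresentation.toPresentation (P : WordPresentation) : Presentation where
  numGens := P.numGens
  numRels := P.numRels
  rel j := (P.rel j).value

/-- `ACMove P P'`: the presentation `P'` is obtained from `P` by one Andrews–Curtis move. -/
inductive ACMove : Presentation → Presentation → Prop
  /-- (i) Two relators are interchanged. -/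
  | interchange {n m : ℕ} (R : Fin m → FreeGroup (Fin n)) (i s : Fin m) :
      ACMove ⟨n, m, R⟩ ⟨n, m, fun j => R (Equiv.swap i s j)⟩
  /-- (ii) A relator `R` is replaced with `g R g⁻¹`, for any element `g` of the free group. -/
  | conjugate {n m : ℕ} (R : Fin m → FreeGroup (Fin n)) (i : Fin m) (g : FreeGroup (Fin n)) :
      ACMove ⟨n, m, R⟩ ⟨n, m, Function.update R i (g * R i * g⁻¹)⟩
  /-- (iii) A relator is replaced with its inverse. -/
  | invert {n m : ℕ} (R : Fin m → FreeGroup (Fin n)) (i : Fin m) :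
      ACMove ⟨n, m, R⟩ ⟨n, m, Function.update R i (R i)⁻¹⟩
  /-- (iv) A relator is multiplied on the right by a different relator. -/
  | multiply {n m : ℕ} (R : Fin m → FreeGroup (Fin n)) (i s : Fin m) (his : i ≠ s) :
      ACMove ⟨n, m, R⟩ ⟨n, m, Function.update R i (R i * R s)⟩
  /-- (v) A new generator `y` and the new relator `y` are added. -/
  | stabilize {n m : ℕ} (R : Fin m → FreeGroup (Fin n)) :
      ACMove ⟨n, m, R⟩
        ⟨n + 1, m + 1, Fin.snoc (α := fun _ => FreeGroup (Fin (n + 1)))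
          (fun j => FreeGroup.map Fin.castSucc (R j)) (FreeGroup.of (Fin.last n))⟩
  /-- (vi) The reverse of (v). -/
  | destabilize {n m : ℕ} (R : Fin m → FreeGroup (Fin n)) :
      ACMove
        ⟨n + 1, m + 1, Fin.snoc (α := fun _ => FreeGroup (Fin (n + 1)))
          (fun j => FreeGroup.map Fin.castSucc (R j)) (FreeGroup.of (Fin.last n))⟩
        ⟨n, m, R⟩

/-! ## Stable autonomous tensor categories

A tensor category is a symmetric monoidal category. It is autonomous if every object `A` comes with
an object `A* = ᘁA`, a coform `𝟙 ⟶ A* ⊗ A` and a form `A ⊗ A* ⟶ 𝟙` for which the two zigzag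
composites are identities: these are the data of Mathlib's `LeftRigidCategory`. -/

section Autonomous

variable {C : Type u} [Category.{v} C] [MonoidalCategory C] [LeftRigidCategory C]

/-- The coform `Λ_A : 𝟙 ⟶ A* ⊗ A`. -/
def coform (A : C) : 𝟙_ C ⟶ (ᘁA) ⊗ A := η_ (ᘁA) A

/-- The form `λ_A : A ⊗ A* ⟶ 𝟙`. -/
def form (A : C) : A ⊗ (ᘁA) ⟶ 𝟙_ C := ε_ (ᘁA) A

variable (C) in
/-- An autonomous tensor category is stable if `A** = A` and the canonical isomorphism
`w_A : A** ⟶ A`, which is determined by `γ ∘ Λ_A = (w_A ⊗ id) ∘ Λ_{A*}`, is the identity. -/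
class Stable [SymmetricCategory C] : Prop where
  dual_dual : ∀ A : C, (ᘁ(ᘁA)) = A
  canonical_eq_id : ∀ A : C,
    coform A ≫ (β_ (ᘁA) A).hom = coform (ᘁA) ≫ (eqToHom (dual_dual A) ▷ (ᘁA))

/-- The form `λ_{A*} : A* ⊗ A ⟶ 𝟙`, where `A` is identified with `A**`. -/
def dualForm [SymmetricCategory C] [Stable C] (A : C) : (ᘁA) ⊗ A ⟶ 𝟙_ C :=
  ((ᘁA) ◁ eqToHom (Stable.dual_dual A).symm) ≫ form (ᘁA)

end Autonomous

/-! ## Semisimplicity, dual bases and scalars -/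

section Semisimple

variable (K : Type w) [Field K] (C : Type u) [Category.{v} C] [Abelian C] [Linear K C]

attribute [local instance] Abelian.hasFiniteBiproducts

/-- A semisimple tensor category over `K`: there is a finite set `simples` of objects with
`Hom(a, b) = 0` for `a ≠ b` and `Hom(a, a) ≃ K`, such that every object is isomorphic to a finite
direct sum of objects from this set. The unit object is one of the chosen simple objects. -/
structure Semisimple [MonoidalCategory C] where
  simples : Finset C
  unit_mem : 𝟙_ C ∈ simples
  hom_eq_zero : ∀ a ∈ simples, ∀ b ∈ simples, a ≠ b → ∀ f : a ⟶ b, f = 0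
  hom_self : ∀ a ∈ simples, Nonempty ((a ⟶ a) ≃ₗ[K] K)
  decomposition : ∀ A : C, ∃ (n : ℕ) (f : Fin n → C), (∀ i, f i ∈ simples) ∧ Nonempty (A ≅ ⨁ f)

variable {C}

/-- A basis `ε_i` of `Hom(a, A)` together with a basis `ε_i*` of `Hom(A, a)` which is dual to it, in
the sense that `ε_i* ∘ ε_j = δ_{ij} id_a`. -/
structure DualBases (a A : C) where
  size : ℕ
  basis : Module.Basis (Fin size) K (a ⟶ A)
  dual : Module.Basis (Fin size) K (A ⟶ a)
  comp_eq : ∀ i j, basis j ≫ dual i = if i = j then 𝟙 a else 0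

variable {K}

namespace Semisimple

variable [MonoidalCategory C] (S : Semisimple K C)

theorem id_ne_zero {a : C} (ha : a ∈ S.simples) : 𝟙 a ≠ 0 := by
  intro h
  obtain ⟨e⟩ := S.hom_self a ha
  have h1 : ∀ f : a ⟶ a, f = 0 := fun f => by rw [← Category.comp_id f, h, Limits.comp_zero]
  have h2 : e.symm 1 = 0 := h1 _
  simp at h2

theorem existsUnique_scalar {a : C} (ha : a ∈ S.simples) (f : a ⟶ a) : ∃! c : K, f = c • 𝟙 a := by
  obtain ⟨e⟩ := S.hom_self a ha
  have h0 : e (𝟙 a) ≠ 0 := fun h => S.id_ne_zero ha (by simpa using h)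
  refine ⟨e f / e (𝟙 a), e.injective (by simp [h0]), fun c hc => ?_⟩
  simp [hc, h0]

/-- The standard isomorphism `Hom(𝟙, 𝟙) ≃ K`: the morphism `f = c • id` goes to `c`. -/
def scalar (f : 𝟙_ C ⟶ 𝟙_ C) : K := (S.existsUnique_scalar S.unit_mem f).choose

theorem scalar_spec (f : 𝟙_ C ⟶ 𝟙_ C) : f = S.scalar f • 𝟙 (𝟙_ C) :=
  (S.existsUnique_scalar S.unit_mem f).choose_spec.1

theorem nonempty_dualBases {a : C} (ha : a ∈ S.simples) (A : C) : Nonempty (DualBases K a A) := by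
  classical
  obtain ⟨n, f, hf, ⟨e⟩⟩ := S.decomposition A
  let σ := Fintype.equivFin {i : Fin n // f i = a}
  let up : {i : Fin n // f i = a} → (a ⟶ A) := fun i =>
    eqToHom i.2.symm ≫ Limits.biproduct.ι f i ≫ e.inv
  let down : {i : Fin n // f i = a} → (A ⟶ a) := fun i =>
    e.hom ≫ Limits.biproduct.π f i ≫ eqToHom i.2
  have key : ∀ i j, up j ≫ down i = if i = j then 𝟙 a else 0 := by
    rintro ⟨i, hi⟩ ⟨j, hj⟩
    by_cases h : i = j
    · subst h; simp [up, down]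
    · have h' : j ≠ i := fun h'' => h h''.symm
      simp [up, down, h, Limits.biproduct.ι_π_ne_assoc f h']
  have sum_id : 𝟙 A = ∑ i, e.hom ≫ Limits.biproduct.π f i ≫ Limits.biproduct.ι f i ≫ e.inv := by
    have h := congrArg (fun g => e.hom ≫ g ≫ e.inv) (Limits.biproduct.total (f := f))
    simp only [Preadditive.sum_comp, Preadditive.comp_sum, Category.id_comp, Category.assoc,
      Iso.hom_inv_id] at h
    exact h.symm
  have smul_zero_iff : ∀ c : K, c • 𝟙 a = 0 → c = 0 := fun c hc =>
    (smul_eq_zero.1 hc).resolve_right (S.id_ne_zero ha)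
  have liUp : LinearIndependent K up := by
    rw [Fintype.linearIndependent_iff]
    intro g hg i
    have h := congrArg (fun x => x ≫ down i) hg
    simp only [Preadditive.sum_comp, Linear.smul_comp, key, Limits.zero_comp, smul_ite,
      smul_zero, Finset.sum_ite_eq, Finset.mem_univ, if_true] at h
    exact smul_zero_iff _ h
  have liDown : LinearIndependent K down := by
    rw [Fintype.linearIndependent_iff]
    intro g hg i
    have h := congrArg (fun x => up i ≫ x) hg
    simp only [Preadditive.comp_sum, Linear.comp_smul, key, Limits.comp_zero, smul_ite,
      smul_zero, Finset.sum_ite_eq', Finset.mem_univ, if_true] at h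
    exact smul_zero_iff _ h
  have spanUp : ⊤ ≤ Submodule.span K (Set.range up) := by
    rintro φ -
    rw [← Category.comp_id φ, sum_id, Preadditive.comp_sum]
    refine Submodule.sum_mem _ fun i _ => ?_
    by_cases h : f i = a
    · obtain ⟨c, hc, -⟩ := S.existsUnique_scalar ha (φ ≫ down ⟨i, h⟩)
      have h1 : φ ≫ e.hom ≫ Limits.biproduct.π f i ≫ Limits.biproduct.ι f i ≫ e.inv =
          c • up ⟨i, h⟩ := by
        have h2 := congrArg (fun x => x ≫ up ⟨i, h⟩) hc
        simpa [up, down] using h2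
      rw [h1]
      exact Submodule.smul_mem _ _ (Submodule.subset_span ⟨_, rfl⟩)
    · have h1 := S.hom_eq_zero a ha (f i) (hf i) (fun h' => h h'.symm)
        (φ ≫ e.hom ≫ Limits.biproduct.π f i)
      have h2 : φ ≫ e.hom ≫ Limits.biproduct.π f i ≫ Limits.biproduct.ι f i ≫ e.inv = 0 := by
        simpa using congrArg (fun x => x ≫ Limits.biproduct.ι f i ≫ e.inv) h1
      rw [h2]
      exact Submodule.zero_mem _
  have spanDown : ⊤ ≤ Submodule.span K (Set.range down) := by
    rintro φ -
    rw [← Category.id_comp φ, sum_id, Preadditive.sum_comp]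
    refine Submodule.sum_mem _ fun i _ => ?_
    by_cases h : f i = a
    · obtain ⟨c, hc, -⟩ := S.existsUnique_scalar ha (up ⟨i, h⟩ ≫ φ)
      have h1 : (e.hom ≫ Limits.biproduct.π f i ≫ Limits.biproduct.ι f i ≫ e.inv) ≫ φ =
          c • down ⟨i, h⟩ := by
        have h2 := congrArg (fun x => down ⟨i, h⟩ ≫ x) hc
        simpa [up, down] using h2
      rw [h1]
      exact Submodule.smul_mem _ _ (Submodule.subset_span ⟨_, rfl⟩)
    · have h1 := S.hom_eq_zero (f i) (hf i) a ha h (Limits.biproduct.ι f i ≫ e.inv ≫ φ)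
      have h2 : (e.hom ≫ Limits.biproduct.π f i ≫ Limits.biproduct.ι f i ≫ e.inv) ≫ φ = 0 := by
        simpa using congrArg (fun x => e.hom ≫ Limits.biproduct.π f i ≫ x) h1
      rw [h2]
      exact Submodule.zero_mem _
  exact ⟨{
    size := _
    basis := (Module.Basis.mk liUp spanUp).reindex σ
    dual := (Module.Basis.mk liDown spanDown).reindex σ
    comp_eq := fun i j => by simp [key] }⟩

/-- A chosen pair of dual bases of `Hom(a, A)` and `Hom(A, a)`. -/
def dualBases {a : C} (ha : a ∈ S.simples) (A : C) : DualBases K a A :=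
  (S.nonempty_dualBases ha A).some

end Semisimple

end Semisimple

/-! ## Iterated tensor products and the permutations of their factors -/

section Tensor

variable {C : Type u} [Category.{v} C] [MonoidalCategory C]

/-- The tensor product `X₀ ⊗ (X₁ ⊗ (⋯ ⊗ 𝟙))` of a finite family. -/
def bigTensor : {n : ℕ} → (Fin n → C) → C
  | 0, _ => 𝟙_ C
  | _ + 1, X => X 0 ⊗ bigTensor fun k => X k.succ

/-- The tensor product of a finite family of morphisms. -/
def bigTensorMap : {n : ℕ} → {X Y : Fin n → C} → (∀ k, X k ⟶ Y k) → (bigTensor X ⟶ bigTensor Y)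
  | 0, _, _, _ => 𝟙 (𝟙_ C)
  | _ + 1, _, _, f => f 0 ⊗ₘ bigTensorMap fun k => f k.succ

/-- The tensor product of a finite family of isomorphisms. -/
def bigTensorIso : {n : ℕ} → {X Y : Fin n → C} → (∀ k, X k ≅ Y k) → (bigTensor X ≅ bigTensor Y)
  | 0, _, _, _ => Iso.refl (𝟙_ C)
  | _ + 1, _, _, f => f 0 ⊗ᵢ bigTensorIso fun k => f k.succ

/-- The canonical isomorphism `𝟙 ≅ 𝟙 ⊗ (𝟙 ⊗ (⋯ ⊗ 𝟙))`. -/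
def unitIso : (n : ℕ) → (𝟙_ C ≅ bigTensor fun _ : Fin n => 𝟙_ C)
  | 0 => Iso.refl (𝟙_ C)
  | n + 1 => unitIso n ≪≫ (λ_ _).symm

/-- The family with the object `A` in place `i` and the unit object in all other places. -/
def place (A : C) : {n : ℕ} → Fin n → Fin n → C
  | _ + 1, ⟨0, _⟩ => Fin.cons A fun _ => 𝟙_ C
  | _ + 1, ⟨i + 1, h⟩ => Fin.cons (𝟙_ C) (place A ⟨i, Nat.lt_of_succ_lt_succ h⟩)

theorem place_apply (A : C) {n : ℕ} (i k : Fin n) :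
    place A i k = if k = i then A else 𝟙_ C := by
  induction n with
  | zero => exact i.elim0
  | succ n ih =>
    refine Fin.cases ?_ (fun i => ?_) i <;> refine Fin.cases ?_ (fun k => ?_) k
    · rfl
    · simp only [Fin.succ_ne_zero, if_false]; rfl
    · simp only [(Fin.succ_ne_zero i).symm, if_false]; rfl
    · simp only [Fin.succ_inj]
      exact ih i k

/-- The canonical isomorphism `A ≅ 𝟙 ⊗ ⋯ ⊗ A ⊗ ⋯ ⊗ 𝟙`. -/
def placeIso (A : C) : {n : ℕ} → (i : Fin n) → (A ≅ bigTensor (place A i))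
  | n + 1, ⟨0, _⟩ => (ρ_ A).symm ≪≫ (Iso.refl A ⊗ᵢ unitIso n)
  | _ + 1, ⟨i + 1, h⟩ => placeIso A ⟨i, Nat.lt_of_succ_lt_succ h⟩ ≪≫ (λ_ _).symm

variable [SymmetricCategory C]

/-- The permutation of factors `(A ⊗ B) ⊗ (A' ⊗ B') ≅ (A ⊗ A') ⊗ (B ⊗ B')`. -/
def middleIso (A B A' B' : C) : (A ⊗ B) ⊗ (A' ⊗ B') ≅ (A ⊗ A') ⊗ (B ⊗ B') where
  hom := tensorμ A B A' B'
  inv := tensorδ A B A' B'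
  hom_inv_id := tensorμ_tensorδ _ _ _ _
  inv_hom_id := tensorδ_tensorμ _ _ _ _

/-- The permutation of factors `(⨂ₖ Xₖ) ⊗ (⨂ₖ Yₖ) ≅ ⨂ₖ (Xₖ ⊗ Yₖ)`. -/
def mulIso : {n : ℕ} → (X Y : Fin n → C) →
    (bigTensor X ⊗ bigTensor Y ≅ bigTensor fun k => X k ⊗ Y k)
  | 0, _, _ => λ_ (𝟙_ C)
  | _ + 1, X, Y => middleIso _ _ _ _ ≪≫
      (Iso.refl _ ⊗ᵢ mulIso (fun k => X k.succ) fun k => Y k.succ)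

/-- The permutation of factors `⨂ⱼ ⨂ₖ Xⱼₖ ≅ ⨂ₖ ⨂ⱼ Xⱼₖ`. -/
def transposeIso : {m n : ℕ} → (X : Fin m → Fin n → C) →
    ((bigTensor fun j => bigTensor (X j)) ≅ bigTensor fun k => bigTensor fun j => X j k)
  | 0, n, _ => unitIso n
  | _ + 1, _, X => (Iso.refl _ ⊗ᵢ transposeIso fun j => X j.succ) ≪≫ mulIso (X 0) _

end Tensor

/-! ## Partial traces -/

section PartialTrace

variable {K : Type w} [Field K] {C : Type u} [Category.{v} C] [Abelian C] [Linear K C]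
  [MonoidalCategory C]

/-- The partial trace of an endomorphism `φ` of `⨂ₖ Aₖ` as every `Aₖ` goes to `aₖ`, an endomorphism
of `⨂ₖ aₖ`: with dual bases `ε` of `Hom(aₖ, Aₖ)` and `ε*` of `Hom(Aₖ, aₖ)` for every `k` it is the
sum of `(⨂ₖ ε*_{i(k)}) ∘ φ ∘ (⨂ₖ ε_{i(k)})` over all choices of one index `i(k)` for every `k`.
This is the composite of the partial traces in the single factors. -/
def partialTrace {n : ℕ} {a A : Fin n → C} (d : ∀ k, DualBases K (a k) (A k))
    (φ : bigTensor A ⟶ bigTensor A) : bigTensor a ⟶ bigTensor a :=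
  ∑ i : (∀ k, Fin (d k).size),
    bigTensorMap (fun k => (d k).basis (i k)) ≫ φ ≫ bigTensorMap (fun k => (d k).dual (i k))

end PartialTrace

/-! ## The morphism `[P, b]` -/

section Morphism

variable {C : Type u} [Category.{v} C] [MonoidalCategory C]

/-- The tensor power `b ⊗ b ⊗ ⋯ ⊗ b` with `l` factors. -/
def power (b : C) : ℕ → C
  | 0 => 𝟙_ C
  | l + 1 => power b l ⊗ b

/-- For `l ≥ 0`, the morphism `f(b, l) : b ⊗ b^l ⟶ b^l ⊗ b` is the identity of `b^{l+1}` up to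
bracketing. It is an open morphism, with the first factor `b` of the source as its in-end and the
last factor `b` of the target as its out-end. -/
def powerOpen (b : C) : (l : ℕ) → (b ⊗ power b l ⟶ power b l ⊗ b)
  | 0 => (ρ_ b).hom ≫ (λ_ b).inv
  | l + 1 => (α_ b (power b l) b).inv ≫ (powerOpen b l ▷ b)

variable [LeftRigidCategory C]

/-- `b^l` for `l : ℤ`, with `(b*)^{|l|}` for negative `l`. -/
def zpower (b : C) : ℤ → C
  | Int.ofNat l => power b l
  | Int.negSucc l => power (ᘁb) (l + 1)

variable [SymmetricCategory C]

/-- The reverse of an open morphism `g : b* ⊗ X ⟶ Y ⊗ b*`, whose in-end is the factor `b*` of the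
source and whose out-end is the factor `b*` of the target. The new in-end `b` is joined to the old
out-end by the form, and the old in-end is joined to the new out-end `b` by the coform. -/
def reverse (b : C) {X Y : C} (g : (ᘁb) ⊗ X ⟶ Y ⊗ (ᘁb)) : b ⊗ X ⟶ Y ⊗ b :=
  (λ_ _).inv ≫ (coform b ▷ (b ⊗ X)) ≫
    -- `(b* ⊗ b) ⊗ (b ⊗ X)` is permuted to `(b* ⊗ X) ⊗ (b ⊗ b)`, the old `b` staying in front
    (((ᘁb) ⊗ b) ◁ (β_ b X).hom) ≫ tensorμ (ᘁb) b X b ≫ (((ᘁb) ⊗ X) ◁ (β_ b b).hom) ≫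
    (g ▷ (b ⊗ b)) ≫
    -- `(Y ⊗ b*) ⊗ (b ⊗ b)` is rebracketed, and the new in-end `b` is evaluated against `b*`
    (α_ Y (ᘁb) (b ⊗ b)).hom ≫ (Y ◁ (α_ (ᘁb) b b).inv) ≫
    (Y ◁ (((β_ (ᘁb) b).hom ≫ form b) ▷ b)) ≫ (Y ◁ (λ_ b).hom)

/-- The open morphism `f(b, l) : b ⊗ b^l ⟶ b^l ⊗ b` for `l : ℤ`; for negative `l` it is the reverse
of `f(b*, |l|)`. -/
def syllableOpen (b : C) : (l : ℤ) → (b ⊗ zpower b l ⟶ zpower b l ⊗ b)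
  | Int.ofNat l => powerOpen b l
  | Int.negSucc l => reverse b (powerOpen (ᘁb) (l + 1))

/-- The object `R(b) = b^{l₁} ⊗ b^{l₂} ⊗ ⋯ ⊗ b^{lₖ}`. -/
def wordObj {n : ℕ} (b : C) : Word n → C
  | [] => 𝟙_ C
  | s :: R => zpower b s.2 ⊗ wordObj b R

/-- The open morphism `[R, b]ᵒ` without the rank factor: the morphisms `f(b, l₁)`, …, `f(b, lₖ)`,
with the out-end of each one connected to the in-end of the next one. -/
def wordOpen {n : ℕ} (b : C) : (R : Word n) → (b ⊗ wordObj b R ⟶ wordObj b R ⊗ b)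
  | [] => (ρ_ b).hom ≫ (λ_ b).inv
  | s :: R => (α_ _ _ _).inv ≫ (syllableOpen b s.2 ▷ wordObj b R) ≫ (α_ _ _ _).hom ≫
      (zpower b s.2 ◁ wordOpen b R) ≫ (α_ _ _ _).inv

variable [Stable C]

/-- The closure of an open morphism `g : b ⊗ X ⟶ X ⊗ b`: its out-end is connected to its in-end. -/
def closeUp (b : C) {X : C} (g : b ⊗ X ⟶ X ⊗ b) : X ⟶ X :=
  (λ_ X).inv ≫ (coform b ▷ X) ≫ (α_ _ _ _).hom ≫ ((ᘁb) ◁ g) ≫ ((ᘁb) ◁ (β_ X b).hom) ≫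
    (α_ _ _ _).inv ≫ (dualForm b ▷ X) ≫ (λ_ X).hom

/-- The rank `r(φ) = λ_{A*} ∘ (id_{A*} ⊗ φ) ∘ Λ_A` of an endomorphism `φ` of `A`. -/
def rank {A : C} (φ : A ⟶ A) : 𝟙_ C ⟶ 𝟙_ C := coform A ≫ ((ᘁA) ◁ φ) ≫ dualForm A

end Morphism

/-! ## The invariant -/

section Factors

variable {C : Type u} [Category.{v} C] [MonoidalCategory C] [SymmetricCategory C]
  [LeftRigidCategory C]

/-- The object `g_k(R, b)`: the product of the factors `b^l` of `R(b)` that correspond to the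
generator `x_k`; the other factors are replaced by the unit object. -/
def genObj {n : ℕ} (b : C) : Word n → Fin n → C
  | [], _ => 𝟙_ C
  | s :: R, k => place (zpower b s.2) s.1 k ⊗ genObj b R k

/-- The permutation of factors `κ(R) : R(b) ≅ ⨂ₖ g_k(R, b)`. -/
def wordIso {n : ℕ} (b : C) : (R : Word n) → (wordObj b R ≅ bigTensor fun k => genObj b R k)
  | [] => unitIso n
  | s :: R => (placeIso (zpower b s.2) s.1 ⊗ᵢ wordIso b R) ≪≫ mulIso _ _

variable (P : WordPresentation) (b : Fin P.numRels → C)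

/-- The object `Rel(b) = ⨂ⱼ Rⱼ(bⱼ)`. -/
def relObj : C := bigTensor fun j => wordObj (b j) (P.rel j)

/-- The object `G_k(b) = ⨂ⱼ g_k(Rⱼ, bⱼ)`. -/
def genTotal (k : Fin P.numGens) : C := bigTensor fun j => genObj (b j) (P.rel j) k

/-- The permutation of factors `ξ(P) : Rel(b) ≅ ⨂ₖ G_k(b)`, which groups the factors according to
the generators to which they correspond. -/
def sortIso : relObj P b ≅ bigTensor fun k => genTotal P b k :=
  bigTensorIso (fun j => wordIso (b j) (P.rel j)) ≪≫
    transposeIso fun j k => genObj (b j) (P.rel j) k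

end Factors

section Invariant

variable {K : Type w} [Field K] {C : Type u} [Category.{v} C] [Abelian C] [Linear K C]
  [MonoidalCategory C] [SymmetricCategory C] [LeftRigidCategory C] [Stable C] (S : Semisimple K C)

/-- The morphism `[R, b] : R(b) ⟶ R(b)`: the closure of `[R, b]ᵒ`, multiplied by the rank of `b`. -/
def wordMorphism {n : ℕ} (b : C) (R : Word n) : wordObj b R ⟶ wordObj b R :=
  S.scalar (rank (𝟙 b)) • closeUp b (wordOpen b R)

/-- The morphism `[P, b] = ⨂ⱼ [Rⱼ, bⱼ] : Rel(b) ⟶ Rel(b)`. -/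
def relMorphism (P : WordPresentation) (b : Fin P.numRels → C) : relObj P b ⟶ relObj P b :=
  bigTensorMap fun j => wordMorphism S (b j) (P.rel j)

/-- The invariant `Q(P)`: the sum over all labelings `b` of the relators by simple objects of the
partial traces, as every `G_k(b)` goes to the unit object, of `ξ(P) ∘ [P, b] ∘ ξ(P)⁻¹`. -/
def Q (P : WordPresentation) : K :=
  ∑ b : Fin P.numRels → S.simples,
    S.scalar ((unitIso P.numGens).hom ≫
      partialTrace (fun k => S.dualBases S.unit_mem (genTotal P (fun j => (b j : C)) k))
        ((sortIso P fun j => (b j : C)).inv ≫ relMorphism S P (fun j => (b j : C)) ≫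
          (sortIso P fun j => (b j : C)).hom) ≫
      (unitIso P.numGens).inv)

end Invariant

end QuinnInvariant

end

/-!
For a finite group `G`, the sum `∑_b dim(b) χ_b(g)` over the irreducible characters is `|G|`
times the delta function of the identity. If the objects of the category `C` are regarded as the
representations of `G`, and the generators of a presentation as elements of `G`, then each relator
contributes such a sum to the invariant, and the partial trace averages over all assignments of
group elements to the generators. So the invariant counts the solutions of the equations `Rⱼ = 1`,
up to the factor `|G|^(m - n)`, which the moves preserve. The proof carries this picture over to
categories `C` in which there is no group.

The role of the functions on `Gⁿ` is played by the endomorphisms of *framed* objects, that is,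
objects that are identified with a tensor product of `n` objects, one for each generator. The full
partial trace is a linear functional of such endomorphisms, which is *balanced*: it is cyclic with
respect to tensor products of `n` morphisms (`fullTrace_comm`). `Functionals K n T` is the space of
all balanced functionals, on morphisms `A ⟶ A ⊗ T` with coefficients in an object `T`.

An open morphism `X ⊗ A ⟶ A ⊗ Y` acts on balanced functionals, from coefficients `Y ⊗ Z` to
coefficients `X ⊗ Z` (`op`). For the generators this action is natural in `X` and compatible with
tensor products (`gen_isPoint`), which makes it a `C`-analogue of a group element: it is invertible,
with the transpose on the dual object as its inverse. Hence there is a homomorphism `point` from the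
free group to such families of operators, and the open morphism of a word acts as the point of the
group element that the word spells (`op_word`). Closing an open morphism means taking the trace of
its action (`opTrace_word`). So a relator `g` contributes the operator
`relOp g = ∑_b rank(b) tr_b(point g)`, and the invariant is the value at the unit object of the
product of these operators, applied to the full partial trace (`Q_eq`).

The operators of relators commute, and traces are conjugation invariant. The main point is the
sliding lemma `sum_opTrace_swap_apply`, which rests on the fusion identity `sum_dim_smul_rot`: the
identity of an object is a sum, weighted by ranks, of composites through simple objects. With
trivial coefficients the sliding lemma says that `relOp g⁻¹ = relOp g`. Therefore, in general, it
says that `relOp g` absorbs the action of `g` on the coefficients (`relOp_point_self`), as a delta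
function does, and this implies `relOp (g * h) * relOp h = relOp g * relOp h`. These are the
invariance under inversion and under multiplication of relators. For a new generator `y` with the
relator `y`, balanced functionals are restricted to framed objects with the unit object in the last
place, and the new operator takes the trace functional to the trace functional, because only the
trivial simple object has morphisms from the unit object (`restrict_relOp_last`).

Equations between composites of structural isomorphisms and given morphisms are checked by a
coherence theorem: string diagrams with the same boxes denote the same morphism (`Diagram.unique`).
-/

noncomputable section

set_option linter.unusedSectionVars false

namespace QuinnInvariant

/-! ### String diagrams and coherence in symmetric monoidal categories -/

/-- A bracketed tensor product of numbered wires and units. -/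
inductive WireExpr : Type
  | unit : WireExpr
  | wire (i : ℕ) : WireExpr
  | tens (a b : WireExpr) : WireExpr

namespace WireExpr

/-- The wires of an expression, from left to right. -/
def wires : WireExpr → List ℕ
  | unit => []
  | wire i => [i]
  | tens a b => a.wires ++ b.wires

variable {C : Type u} [Category.{v} C] [MonoidalCategory C]

/-- The object that an expression denotes when the wire `i` carries the object `X i`. -/
@[reducible]
def ev (X : ℕ → C) : WireExpr → C
  | unit => 𝟙_ C
  | wire i => X i
  | tens a b => a.ev X ⊗ b.ev X

end WireExpr

open WireExpr

section Coherence

variable {C : Type u} [Category.{v} C] [MonoidalCategory C] {X : ℕ → C}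

variable (X) in
/-- `Trivial X e m`: the expression `e` contains no wires, and `m` is its canonical isomorphism with
the unit. -/
inductive Trivial : (e : WireExpr) → (e.ev X ⟶ 𝟙_ C) → Prop
  | unit : Trivial unit (𝟙 _)
  | tens {a b m m'} : Trivial a m → Trivial b m' →
      Trivial (tens a b) (m ▷ _ ≫ (λ_ _).hom ≫ m')

theorem exists_trivial {e : WireExpr} (h : e.wires = []) : ∃ m, Trivial X e m := by
  induction e with
  | unit => exact ⟨_, .unit⟩
  | wire i => simp [wires] at h
  | tens a b ih₁ ih₂ =>
    obtain ⟨h₁, h₂⟩ := List.append_eq_nil_iff.1 h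
    obtain ⟨_, k₁⟩ := ih₁ h₁
    obtain ⟨_, k₂⟩ := ih₂ h₂
    exact ⟨_, .tens k₁ k₂⟩

theorem Trivial.unique {e : WireExpr} {m m'} (h : Trivial X e m) (h' : Trivial X e m') :
    m = m' := by
  induction h with
  | unit => cases h'; rfl
  | tens _ _ ih₁ ih₂ =>
    cases h' with
    | tens k₁ k₂ => rw [ih₁ k₁, ih₂ k₂]

variable [SymmetricCategory C] (X)

/-- The morphisms that are composed of structural isomorphisms. -/
inductive Structural : (e e' : WireExpr) → (e.ev X ⟶ e'.ev X) → Prop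
  | id (e) : Structural e e (𝟙 _)
  | comp {e e' e'' f g} : Structural e e' f → Structural e' e'' g → Structural e e'' (f ≫ g)
  | whiskerLeft (z) {e e' f} : Structural e e' f →
      Structural (tens z e) (tens z e') (z.ev X ◁ f)
  | whiskerRight {e e' f} (z) : Structural e e' f →
      Structural (tens e z) (tens e' z) (f ▷ z.ev X)
  | assoc (a b c) : Structural (tens (tens a b) c) (tens a (tens b c)) (α_ _ _ _).hom
  | assocInv (a b c) : Structural (tens a (tens b c)) (tens (tens a b) c) (α_ _ _ _).inv
  | leftUnitor (a) : Structural (tens unit a) a (λ_ _).hom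
  | leftUnitorInv (a) : Structural a (tens unit a) (λ_ _).inv
  | rightUnitor (a) : Structural (tens a unit) a (ρ_ _).hom
  | rightUnitorInv (a) : Structural a (tens a unit) (ρ_ _).inv
  | braid (a b) : Structural (tens a b) (tens b a) (β_ _ _).hom

variable {X}

theorem Structural.exists_inv {e e' : WireExpr} {f : e.ev X ⟶ e'.ev X} (h : Structural X e e' f) :
    ∃ g, Structural X e' e g ∧ f ≫ g = 𝟙 _ ∧ g ≫ f = 𝟙 _ := by
  induction h with
  | id e => exact ⟨_, .id e, by simp, by simp⟩
  | comp _ _ ih₁ ih₂ =>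
    obtain ⟨g₁, h₁, h₂, h₃⟩ := ih₁
    obtain ⟨g₂, k₁, k₂, k₃⟩ := ih₂
    refine ⟨_, .comp k₁ h₁, ?_, ?_⟩
    · rw [Category.assoc, reassoc_of% k₂, h₂]
    · rw [Category.assoc, reassoc_of% h₃, k₃]
  | whiskerLeft z _ ih =>
    obtain ⟨g₁, h₁, h₂, h₃⟩ := ih
    refine ⟨_, .whiskerLeft z h₁, ?_, ?_⟩
    · rw [← MonoidalCategory.whiskerLeft_comp, h₂, MonoidalCategory.whiskerLeft_id]
    · rw [← MonoidalCategory.whiskerLeft_comp, h₃, MonoidalCategory.whiskerLeft_id]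
  | whiskerRight z _ ih =>
    obtain ⟨g₁, h₁, h₂, h₃⟩ := ih
    refine ⟨_, .whiskerRight z h₁, ?_, ?_⟩
    · rw [← MonoidalCategory.comp_whiskerRight, h₂, MonoidalCategory.id_whiskerRight]
    · rw [← MonoidalCategory.comp_whiskerRight, h₃, MonoidalCategory.id_whiskerRight]
  | assoc a b c => exact ⟨_, .assocInv a b c, Iso.hom_inv_id _, Iso.inv_hom_id _⟩
  | assocInv a b c => exact ⟨_, .assoc a b c, Iso.inv_hom_id _, Iso.hom_inv_id _⟩
  | leftUnitor a => exact ⟨_, .leftUnitorInv a, Iso.hom_inv_id _, Iso.inv_hom_id _⟩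
  | leftUnitorInv a => exact ⟨_, .leftUnitor a, Iso.inv_hom_id _, Iso.hom_inv_id _⟩
  | rightUnitor a => exact ⟨_, .rightUnitorInv a, Iso.hom_inv_id _, Iso.inv_hom_id _⟩
  | rightUnitorInv a => exact ⟨_, .rightUnitor a, Iso.inv_hom_id _, Iso.hom_inv_id _⟩
  | braid a b =>
    exact ⟨_, .braid b a, SymmetricCategory.symmetry _ _, SymmetricCategory.symmetry _ _⟩

theorem Structural.perm {e e' : WireExpr} {f : e.ev X ⟶ e'.ev X} (h : Structural X e e' f) :
    e.wires.Perm e'.wires := by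
  induction h with
  | id e => exact .refl _
  | comp _ _ ih₁ ih₂ => exact ih₁.trans ih₂
  | whiskerLeft z _ ih => exact ih.append_left _
  | whiskerRight z _ ih => exact ih.append_right _
  | braid a b => exact List.perm_append_comm
  | _ => simp [wires]

theorem Structural.isIso {e e' : WireExpr} {f : e.ev X ⟶ e'.ev X} (h : Structural X e e' f) :
    IsIso f := by
  obtain ⟨g, -, h₁, h₂⟩ := h.exists_inv
  exact ⟨g, h₁, h₂⟩

variable (X) in
/-- `Pull X a e e₀ m`: the morphism `m` moves one occurrence of the wire `a` in `e` to the front,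
and `e₀` is `e` with this occurrence replaced by the unit. -/
inductive Pull (a : ℕ) : (e e₀ : WireExpr) → (e.ev X ⟶ X a ⊗ e₀.ev X) → Prop
  | here : Pull a (wire a) unit (ρ_ (X a)).inv
  | left {e e₀ m} (r : WireExpr) : Pull a e e₀ m →
      Pull a (tens e r) (tens e₀ r) (m ▷ r.ev X ≫ (α_ _ _ _).hom)
  | right {e e₀ m} (r : WireExpr) : Pull a e e₀ m →
      Pull a (tens r e) (tens r e₀)
        (r.ev X ◁ m ≫ (α_ _ _ _).inv ≫ (β_ _ _).hom ▷ _ ≫ (α_ _ _ _).hom)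

theorem Pull.structural {a : ℕ} {e e₀ : WireExpr} {m} (h : Pull X a e e₀ m) :
    Structural X e (tens (wire a) e₀) m := by
  induction h with
  | here => exact .rightUnitorInv (wire a)
  | left r _ ih => exact .comp (.whiskerRight r ih) (.assoc (wire a) _ r)
  | right r _ ih =>
    exact .comp (.whiskerLeft r ih) (.comp (.assocInv r (wire a) _)
      (.comp (.whiskerRight _ (.braid r (wire a))) (.assoc (wire a) r _)))

theorem Pull.perm {a : ℕ} {e e₀ : WireExpr} {m} (h : Pull X a e e₀ m) :
    e.wires.Perm (a :: e₀.wires) := by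
  induction h with
  | here => exact List.Perm.refl _
  | left r _ ih => exact ih.append_right _
  | right r _ ih => exact (ih.append_left _).trans List.perm_middle

theorem exists_pull {a : ℕ} {e : WireExpr} (h : a ∈ e.wires) : ∃ e₀ m, Pull X a e e₀ m := by
  induction e with
  | unit => simp [wires] at h
  | wire i =>
    obtain rfl : a = i := by simpa [wires] using h
    exact ⟨_, _, .here⟩
  | tens e r ih₁ ih₂ =>
    rcases List.mem_append.1 h with h | h
    · obtain ⟨_, _, h'⟩ := ih₁ h
      exact ⟨_, _, .left _ h'⟩
    · obtain ⟨_, _, h'⟩ := ih₂ h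
      exact ⟨_, _, .right _ h'⟩

theorem Pull.unique {a : ℕ} {e e₀ e₁ : WireExpr} {m m'} (hn : e.wires.Nodup) (h : Pull X a e e₀ m)
    (h' : Pull X a e e₁ m') : e₀ = e₁ ∧ HEq m m' := by
  induction h generalizing e₁ with
  | here => cases h'; exact ⟨rfl, HEq.rfl⟩
  | left r h ih =>
    have hn' := List.nodup_append.1 hn
    cases h' with
    | left _ h' =>
      obtain ⟨rfl, h₂⟩ := ih hn'.1 h'
      cases h₂
      exact ⟨rfl, HEq.rfl⟩
    | right _ h' =>
      exact absurd rfl (hn'.2.2 a (h.perm.mem_iff.2 (by simp)) a (h'.perm.mem_iff.2 (by simp)))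
  | right r h ih =>
    have hn' := List.nodup_append.1 hn
    cases h' with
    | right _ h' =>
      obtain ⟨rfl, h₂⟩ := ih hn'.2.1 h'
      cases h₂
      exact ⟨rfl, HEq.rfl⟩
    | left _ h' =>
      exact absurd rfl (hn'.2.2 a (h'.perm.mem_iff.2 (by simp)) a (h.perm.mem_iff.2 (by simp)))

/-- Structural morphisms are compatible with moving a wire to the front. -/
theorem Structural.pull {e e' : WireExpr} {f : e.ev X ⟶ e'.ev X} (hf : Structural X e e' f)
    {a : ℕ} {e₀ m} (h : Pull X a e e₀ m) :
    ∃ e₀' m' f', Pull X a e' e₀' m' ∧ Structural X e₀ e₀' f' ∧ f ≫ m' = m ≫ X a ◁ f' := by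
  induction hf generalizing e₀ with
  | id e => exact ⟨_, _, _, h, .id _, by simp⟩
  | comp _ _ ih₁ ih₂ =>
    obtain ⟨_, _, _, h₁, k₁, l₁⟩ := ih₁ h
    obtain ⟨_, _, _, h₂, k₂, l₂⟩ := ih₂ h₁
    exact ⟨_, _, _, h₂, .comp k₁ k₂, by simp [l₂, reassoc_of% l₁]⟩
  | @whiskerLeft z e e' f hf ih =>
    cases h with
    | left _ h =>
      refine ⟨_, _, _, .left _ h, .whiskerLeft _ hf, ?_⟩
      simp only [ev, Category.assoc]
      rw [whisker_exchange_assoc]; simp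
    | right _ h =>
      obtain ⟨_, _, _, h₁, k₁, l₁⟩ := ih h
      refine ⟨_, _, _, .right _ h₁, .whiskerLeft _ k₁, ?_⟩
      simp only [ev, Category.assoc]
      rw [← whiskerLeft_comp_assoc, l₁, MonoidalCategory.whiskerLeft_comp_assoc,
        associator_inv_naturality_right_assoc, whisker_exchange_assoc,
        associator_naturality_right]
  | @whiskerRight e e' f z hf ih =>
    cases h with
    | right _ h =>
      refine ⟨_, _, _, .right _ h, .whiskerRight _ hf, ?_⟩
      simp only [ev, Category.assoc]
      rw [← whisker_exchange_assoc, associator_inv_naturality_left_assoc,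
        ← comp_whiskerRight_assoc, BraidedCategory.braiding_naturality_left]
      simp
    | left _ h =>
      obtain ⟨_, _, _, h₁, k₁, l₁⟩ := ih h
      refine ⟨_, _, _, .left _ h₁, .whiskerRight _ k₁, ?_⟩
      simp only [ev, Category.assoc]
      rw [← comp_whiskerRight_assoc, l₁]
      simp
  | assoc a b c =>
    cases h with
    | left _ h =>
      cases h with
      | left _ h => exact ⟨_, _, _, .left _ h, .assoc _ _ _, by simp [ev]⟩
      | right _ h =>
        refine ⟨_, _, _, .right _ (.left _ h), .assoc _ _ _, ?_⟩
        simp only [ev, Category.assoc]; monoidal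
    | right _ h =>
      refine ⟨_, _, _, .right _ (.right _ h), .assoc _ _ _, ?_⟩
      simp only [ev, BraidedCategory.braiding_tensor_left_hom]; monoidal
  | assocInv a b c =>
    cases h with
    | left _ h =>
      refine ⟨_, _, _, .left _ (.left _ h), .assocInv _ _ _, ?_⟩
      simp only [ev]; monoidal
    | right _ h =>
      cases h with
      | left _ h =>
        refine ⟨_, _, _, .left _ (.right _ h), .assocInv _ _ _, ?_⟩
        simp only [ev, Category.assoc]; monoidal
      | right _ h =>
        refine ⟨_, _, _, .right _ h, .assocInv _ _ _, ?_⟩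
        simp only [ev, BraidedCategory.braiding_tensor_left_hom]; monoidal
  | leftUnitor a =>
    cases h with
    | left _ h => cases h
    | right _ h =>
      refine ⟨_, _, _, h, .leftUnitor _, ?_⟩
      simp only [ev, braiding_tensorUnit_left]; monoidal
  | leftUnitorInv a =>
    refine ⟨_, _, _, .right _ h, .leftUnitorInv _, ?_⟩
    simp only [ev, braiding_tensorUnit_left]; monoidal
  | rightUnitor a =>
    cases h with
    | right _ h => cases h
    | left _ h => exact ⟨_, _, _, h, .rightUnitor _, by simp only [ev]; monoidal⟩
  | rightUnitorInv a => exact ⟨_, _, _, .left _ h, .rightUnitorInv _, by simp only [ev]; monoidal⟩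
  | braid a b =>
    cases h with
    | left _ h =>
      refine ⟨_, _, _, .right _ h, .braid _ _, ?_⟩
      simp only [ev, Category.assoc]
      rw [← BraidedCategory.braiding_naturality_left_assoc,
        BraidedCategory.braiding_tensor_left_hom]
      simp [← comp_whiskerRight_assoc]
    | right _ h =>
      refine ⟨_, _, _, .left _ h, .braid _ _, ?_⟩
      simp only [ev, Category.assoc]
      rw [← BraidedCategory.braiding_naturality_right_assoc,
        BraidedCategory.braiding_tensor_right_hom]
      simp

theorem Trivial.structural {e : WireExpr} {m} (h : Trivial X e m) : Structural X e .unit m := by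
  induction h with
  | unit => exact .id _
  | tens _ _ ih₁ ih₂ => exact .comp (.whiskerRight _ ih₁) (.comp (.leftUnitor _) ih₂)

/-- Structural morphisms are compatible with the canonical isomorphisms of expressions without wires
with the unit. -/
theorem Structural.trivial {e e' : WireExpr} {f : e.ev X ⟶ e'.ev X} (hf : Structural X e e' f)
    {m} (h : Trivial X e m) : ∃ m', Trivial X e' m' ∧ f ≫ m' = m := by
  induction hf with
  | id e => exact ⟨_, h, by simp⟩
  | comp _ _ ih₁ ih₂ =>
    obtain ⟨_, h₁, k₁⟩ := ih₁ h
    obtain ⟨_, h₂, k₂⟩ := ih₂ h₁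
    exact ⟨_, h₂, by simp [k₂, k₁]⟩
  | whiskerLeft z _ ih =>
    cases h with
    | tens h₁ h₂ =>
      obtain ⟨_, h₃, rfl⟩ := ih h₂
      refine ⟨_, .tens h₁ h₃, ?_⟩
      simp only [ev]; rw [whisker_exchange_assoc]; simp
  | whiskerRight z _ ih =>
    cases h with
    | tens h₁ h₂ =>
      obtain ⟨_, h₃, rfl⟩ := ih h₁
      exact ⟨_, .tens h₃ h₂, by simp [ev]⟩
  | assoc a b c =>
    cases h with
    | tens h₁ h₂ =>
      cases h₁ with
      | tens h₁ h₃ => exact ⟨_, .tens h₁ (.tens h₃ h₂), by simp only [ev]; monoidal⟩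
  | assocInv a b c =>
    cases h with
    | tens h₁ h₂ =>
      cases h₂ with
      | tens h₂ h₃ => exact ⟨_, .tens (.tens h₁ h₂) h₃, by simp only [ev]; monoidal⟩
  | leftUnitor a =>
    cases h with
    | tens h₁ h₂ => cases h₁; exact ⟨_, h₂, by simp [ev]⟩
  | leftUnitorInv a => exact ⟨_, .tens .unit h, by simp [ev]⟩
  | rightUnitor a =>
    cases h with
    | tens h₁ h₂ => cases h₂; exact ⟨_, h₁, by simp only [ev]; monoidal⟩
  | rightUnitorInv a => exact ⟨_, .tens h .unit, by simp only [ev]; monoidal⟩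
  | braid a b =>
    cases h with
    | @tens _ _ m m' h₁ h₂ =>
      refine ⟨_, .tens h₂ h₁, ?_⟩
      simp only [ev]
      rw [← BraidedCategory.braiding_naturality_right_assoc, braiding_tensorUnit_right,
        Category.assoc, Iso.inv_hom_id_assoc, ← rightUnitor_naturality, ← unitors_equal,
        whisker_exchange_assoc, leftUnitor_naturality]

/-- Coherence: a structural morphism is determined by its source and target, if no wire occurs
twice. The wires are removed one at a time. -/
theorem Structural.unique {e e' : WireExpr} {f g : e.ev X ⟶ e'.ev X} (hn : e.wires.Nodup)
    (hn' : e'.wires.Nodup) (hf : Structural X e e' f) (hg : Structural X e e' g) : f = g := by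
  induction hl : e.wires.length generalizing e e' with
  | zero =>
    rw [List.length_eq_zero_iff] at hl
    obtain ⟨m, hm⟩ := exists_trivial (X := X) hl
    obtain ⟨m₁, h₁, k₁⟩ := hf.trivial hm
    obtain ⟨m₂, h₂, k₂⟩ := hg.trivial hm
    obtain rfl := h₁.unique h₂
    have := h₁.structural.isIso
    exact (cancel_mono m₁).1 (k₁.trans k₂.symm)
  | succ k ih =>
    obtain ⟨a, ha⟩ := List.exists_mem_of_length_eq_add_one hl
    obtain ⟨e₀, m, hm⟩ := exists_pull (X := X) ha
    obtain ⟨e₁, m₁, f₁, h₁, s₁, k₁⟩ := hf.pull hm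
    obtain ⟨e₂, m₂, f₂, h₂, s₂, k₂⟩ := hg.pull hm
    obtain ⟨rfl, hm'⟩ := h₁.unique hn' h₂
    obtain rfl := eq_of_heq hm'
    have hn₁ := (List.nodup_cons.1 (h₁.perm.nodup_iff.1 hn')).2
    have hn₀ := (List.nodup_cons.1 (hm.perm.nodup_iff.1 hn)).2
    have hp := hm.perm.length_eq
    rw [hl, List.length_cons, Nat.add_right_cancel_iff] at hp
    obtain rfl := ih hn₀ hn₁ s₁ s₂ hp.symm
    have := h₁.structural.isIso
    exact (cancel_mono m₁).1 (k₁.trans k₂.symm)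

/-- Every permutation of wires is realized by a structural morphism. -/
theorem exists_structural {e e' : WireExpr} (h : e.wires.Perm e'.wires) :
    ∃ f, Structural X e e' f := by
  induction hl : e.wires.length generalizing e e' with
  | zero =>
    rw [List.length_eq_zero_iff] at hl
    obtain ⟨m, hm⟩ := exists_trivial (X := X) hl
    obtain ⟨m', hm'⟩ := exists_trivial (X := X) (List.nil_perm.1 (hl ▸ h))
    obtain ⟨g, hg, -⟩ := hm'.structural.exists_inv
    exact ⟨_, hm.structural.comp hg⟩
  | succ k ih =>
    obtain ⟨a, ha⟩ := List.exists_mem_of_length_eq_add_one hl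
    obtain ⟨e₀, m, hm⟩ := exists_pull (X := X) ha
    obtain ⟨e₁, m', hm'⟩ := exists_pull (X := X) (h.mem_iff.1 ha)
    have hp := hm.perm.length_eq
    rw [hl, List.length_cons, Nat.add_right_cancel_iff] at hp
    obtain ⟨f, hf⟩ := ih (((hm.perm.symm.trans h).trans hm'.perm).cons_inv) hp.symm
    obtain ⟨g, hg, -⟩ := hm'.structural.exists_inv
    exact ⟨_, hm.structural.comp ((hf.whiskerLeft (wire a)).comp hg)⟩

variable (X) in
/-- A box of a string diagram: a morphism whose source and target are tensor products of wires. -/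
structure Box where
  dom : WireExpr
  cod : WireExpr
  hom : dom.ev X ⟶ cod.ev X

variable (X) in
/-- `Diagram X bs e e' f`: the morphism `f` is composed of structural isomorphisms and the boxes
`bs`, used once each, in this order. -/
inductive Diagram : List (Box X) → (e e' : WireExpr) → (e.ev X ⟶ e'.ev X) → Prop
  | structural {e e' f} : Structural X e e' f → Diagram [] e e' f
  | box (B : Box X) : Diagram [B] B.dom B.cod B.hom
  | comp {bs bs' e e' e'' f g} : Diagram bs e e' f → Diagram bs' e' e'' g →
      Diagram (bs ++ bs') e e'' (f ≫ g)
  | whiskerLeft (z) {bs e e' f} : Diagram bs e e' f →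
      Diagram bs (tens z e) (tens z e') (z.ev X ◁ f)
  | whiskerRight {bs e e' f} (z) : Diagram bs e e' f →
      Diagram bs (tens e z) (tens e' z) (f ▷ z.ev X)

theorem Diagram.isStructural {bs : List (Box X)} {e e' : WireExpr} {f : e.ev X ⟶ e'.ev X}
    (h : Diagram X bs e e' f) (hbs : bs = []) : Structural X e e' f := by
  induction h with
  | structural h => exact h
  | box B => simp at hbs
  | comp _ _ ih₁ ih₂ =>
    obtain ⟨h₁, h₂⟩ := List.append_eq_nil_iff.1 hbs
    exact (ih₁ h₁).comp (ih₂ h₂)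
  | whiskerLeft z _ ih => exact (ih hbs).whiskerLeft z
  | whiskerRight z _ ih => exact (ih hbs).whiskerRight z

/-- The first box of a diagram can be isolated. -/
theorem Diagram.exists_first {bs : List (Box X)} {e e' : WireExpr} {f : e.ev X ⟶ e'.ev X}
    (h : Diagram X bs e e' f) {B : Box X} {bs' : List (Box X)} (hbs : bs = B :: bs') :
    ∃ r p q, Structural X e (tens B.dom r) p ∧ Diagram X bs' (tens B.cod r) e' q ∧
      f = p ≫ B.hom ▷ r.ev X ≫ q := by
  induction h generalizing bs' with
  | structural h => simp at hbs
  | box B =>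
    obtain ⟨rfl, rfl⟩ := List.cons_eq_cons.1 hbs
    exact ⟨unit, _, _, .rightUnitorInv _, .structural (.rightUnitor _), by simp⟩
  | @comp bs₁ bs₂ _ _ _ f g h₁ h₂ ih₁ ih₂ =>
    rcases List.append_eq_cons_iff.1 hbs with ⟨rfl, h⟩ | ⟨l, rfl, rfl⟩
    · obtain ⟨r, p, q, hp, hq, rfl⟩ := ih₂ h
      exact ⟨r, _, q, (h₁.isStructural rfl).comp hp, hq, by simp⟩
    · obtain ⟨r, p, q, hp, hq, rfl⟩ := ih₁ rfl
      exact ⟨r, p, _, hp, hq.comp h₂, by simp⟩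
  | whiskerLeft z _ ih =>
    obtain ⟨r, p, q, hp, hq, rfl⟩ := ih hbs
    refine ⟨tens z r, _, _, (hp.whiskerLeft z).comp ((Structural.assocInv z B.dom r).comp
      (((Structural.braid z B.dom).whiskerRight r).comp (.assoc _ _ _))),
      Diagram.comp (bs := []) (.structural ((Structural.assocInv B.cod z r).comp
      (((Structural.braid B.cod z).whiskerRight r).comp (.assoc _ _ _)))) (hq.whiskerLeft z), ?_⟩
    simp only [MonoidalCategory.whiskerLeft_comp, Category.assoc, whiskerRight_tensor,
      Iso.hom_inv_id_assoc]
    rw [← comp_whiskerRight_assoc, ← comp_whiskerRight_assoc, Category.assoc,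
      ← BraidedCategory.braiding_naturality_right_assoc, SymmetricCategory.symmetry,
      Category.comp_id]
    simp
  | whiskerRight z _ ih =>
    obtain ⟨r, p, q, hp, hq, rfl⟩ := ih hbs
    refine ⟨tens r z, _, _, (hp.whiskerRight z).comp (.assoc _ _ _),
      Diagram.comp (bs := []) (.structural (.assocInv _ _ _)) (hq.whiskerRight z), ?_⟩
    simp

/-- Two string diagrams with the same boxes, in the same order, denote the same morphism, if all
wires that occur are different. -/
theorem Diagram.unique {bs : List (Box X)} {e e' : WireExpr} {f g : e.ev X ⟶ e'.ev X}
    (hn : (e.wires ++ bs.flatMap fun B => B.cod.wires).Nodup)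
    (hn' : e'.wires.Nodup) (hf : Diagram X bs e e' f) (hg : Diagram X bs e e' g) : f = g := by
  induction bs generalizing e with
  | nil =>
    exact (hf.isStructural rfl).unique (List.nodup_append.1 hn).1 hn' (hg.isStructural rfl)
  | cons B bs ih =>
    obtain ⟨r, p, q, hp, hq, rfl⟩ := hf.exists_first rfl
    obtain ⟨r', p', q', hp', hq', rfl⟩ := hg.exists_first rfl
    have h₁ := hp.perm
    have h₂ := hp'.perm
    obtain ⟨s, hs⟩ := exists_structural (X := X) (e := r) (e' := r')
      ((List.perm_append_left_iff _).1 (h₁.symm.trans h₂))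
    have hn₂ : (tens B.dom r').wires.Nodup := h₂.nodup_iff.1 (List.nodup_append.1 hn).1
    obtain rfl := (hp.comp (hs.whiskerLeft B.dom)).unique (List.nodup_append.1 hn).1 hn₂ hp'
    have h₃ : ((B.dom.wires ++ r.wires) ++ (B.cod.wires ++
        bs.flatMap fun B => B.cod.wires)).Nodup := (h₁.append_right _).nodup_iff.1 hn
    have h₄ : ((tens B.cod r).wires ++ bs.flatMap fun B => B.cod.wires).Perm
        (r.wires ++ (B.cod.wires ++ bs.flatMap fun B => B.cod.wires)) := by
      rw [← List.append_assoc]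
      exact List.perm_append_comm.append_right _
    rw [List.append_assoc] at h₃
    have h₅ := ih (h₄.nodup_iff.2 (List.nodup_append.1 h₃).2.1) hq
      (Diagram.comp (bs := []) (.structural (hs.whiskerLeft B.cod)) hq')
    simp [h₅, whisker_exchange_assoc]

/-! The following classes let type class inference translate a morphism of `C`, of a given source
expression, into a string diagram. The morphisms that are boxes have to be declared by
`isDiagram_box`, as local instances. Every wire that leaves a box gets a number of its own, even if
its object occurs already, because coherence needs distinct wires.

Diagrams are compared by `eq_of_diagram`, whose side conditions are decided by evaluation. It takes
the boxes to be listed in the same order on both sides. Where the order differs, two independent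
boxes are first brought into the form `f ⊗ₘ g`, which expands to either order by `tensorHom_def` and
`tensorHom_def'`. -/

/-- The assignment of the objects of a list to the wires `0, 1, …`. -/
def objects : List C → ℕ → C
  | [], _ => 𝟙_ C
  | A :: _, 0 => A
  | _ :: l, i + 1 => objects l i

variable (X)

/-- The expression `e` denotes the object `A`. -/
class Denotes (e : WireExpr) (A : C) : Prop where
  eq : e.ev X = A

instance : Denotes X unit (𝟙_ C) := ⟨rfl⟩

instance (a b : WireExpr) (A B : C) [ha : Denotes X a A] [hb : Denotes X b B] :
    Denotes X (tens a b) (A ⊗ B) := by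
  obtain rfl := ha.eq
  obtain rfl := hb.eq
  exact ⟨rfl⟩

/-- The morphism `f` is denoted by a string diagram with the boxes `bs`. -/
class IsDiagram (bs : outParam (List (Box X))) (e : WireExpr) (e' : outParam WireExpr) {A A' : C}
    (f : A ⟶ A') : Prop where
  exists_diagram : ∃ (h : e.ev X = A) (h' : e'.ev X = A'),
    Diagram X bs e e' (eqToHom h ≫ f ≫ eqToHom h'.symm)

section Instances

variable {X}

theorem IsDiagram.congr {bs bs' : List (Box X)} {e e' e'' : WireExpr} {A A' : C} {f : A ⟶ A'}
    (h : IsDiagram X bs e e' f) (hbs : bs = bs') (he : e' = e'') : IsDiagram X bs' e e'' f := by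
  subst hbs he
  exact h

theorem Diagram.isDiagram {bs : List (Box X)} {e e' : WireExpr} {f : e.ev X ⟶ e'.ev X}
    (h : Diagram X bs e e' f) : IsDiagram X bs e e' f := ⟨rfl, rfl, by simpa using h⟩

/-- The string diagram that consists of a single box. -/
theorem isDiagram_box {A A' : C} (f : A ⟶ A') (e e' : WireExpr) (h : e.ev X = A)
    (h' : e'.ev X = A') :
    IsDiagram X [⟨e, e', eqToHom h ≫ f ≫ eqToHom h'.symm⟩] e e' f :=
  ⟨h, h', .box ⟨e, e', _⟩⟩

variable (X)

instance (e : WireExpr) (A : C) [h : Denotes X e A] : IsDiagram X [] e e (𝟙 A) := by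
  obtain rfl := h.eq
  exact (Diagram.structural (.id _)).isDiagram

instance {bs bs' : List (Box X)} {e e' e'' : WireExpr} {A A' A'' : C} (f : A ⟶ A') (g : A' ⟶ A'')
    [hf : IsDiagram X bs e e' f] [hg : IsDiagram X bs' e' e'' g] :
    IsDiagram X (bs ++ bs') e e'' (f ≫ g) := by
  obtain ⟨rfl, rfl, hf⟩ := hf
  obtain ⟨_, rfl, hg⟩ := hg
  exact Diagram.isDiagram (.comp (by simpa using hf) (by simpa using hg))

instance {bs : List (Box X)} {z e e' : WireExpr} {Z A A' : C} (f : A ⟶ A')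
    [hz : Denotes X z Z] [hf : IsDiagram X bs e e' f] :
    IsDiagram X bs (tens z e) (tens z e') (Z ◁ f) := by
  obtain rfl := hz.eq
  obtain ⟨rfl, rfl, hf⟩ := hf
  exact Diagram.isDiagram (.whiskerLeft _ (by simpa using hf))

instance {bs : List (Box X)} {z e e' : WireExpr} {Z A A' : C} (f : A ⟶ A')
    [hz : Denotes X z Z] [hf : IsDiagram X bs e e' f] :
    IsDiagram X bs (tens e z) (tens e' z) (f ▷ Z) := by
  obtain rfl := hz.eq
  obtain ⟨rfl, rfl, hf⟩ := hf
  exact Diagram.isDiagram (.whiskerRight _ (by simpa using hf))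

instance {bs bs' : List (Box X)} {a a' b b' : WireExpr} {A A' B B' : C} (f : A ⟶ A') (g : B ⟶ B')
    [hf : IsDiagram X bs a a' f] [hg : IsDiagram X bs' b b' g] :
    IsDiagram X (bs ++ bs') (tens a b) (tens a' b') (f ⊗ₘ g) := by
  rw [MonoidalCategory.tensorHom_def]
  obtain ⟨rfl, rfl, hf⟩ := hf
  obtain ⟨rfl, rfl, hg⟩ := hg
  exact Diagram.isDiagram (.comp (.whiskerRight _ (by simpa using hf))
    (.whiskerLeft _ (by simpa using hg)))

section

variable (a b c : WireExpr) (A B D : C)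

instance [ha : Denotes X a A] [hb : Denotes X b B] [hc : Denotes X c D] :
    IsDiagram X [] (tens (tens a b) c) (tens a (tens b c)) (α_ A B D).hom := by
  obtain rfl := ha.eq; obtain rfl := hb.eq; obtain rfl := hc.eq
  exact (Diagram.structural (.assoc _ _ _)).isDiagram

instance [ha : Denotes X a A] [hb : Denotes X b B] [hc : Denotes X c D] :
    IsDiagram X [] (tens a (tens b c)) (tens (tens a b) c) (α_ A B D).inv := by
  obtain rfl := ha.eq; obtain rfl := hb.eq; obtain rfl := hc.eq
  exact (Diagram.structural (.assocInv _ _ _)).isDiagram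

instance [ha : Denotes X a A] : IsDiagram X [] (tens unit a) a (λ_ A).hom := by
  obtain rfl := ha.eq
  exact (Diagram.structural (.leftUnitor _)).isDiagram

instance [ha : Denotes X a A] : IsDiagram X [] a (tens unit a) (λ_ A).inv := by
  obtain rfl := ha.eq
  exact (Diagram.structural (.leftUnitorInv _)).isDiagram

instance [ha : Denotes X a A] : IsDiagram X [] (tens a unit) a (ρ_ A).hom := by
  obtain rfl := ha.eq
  exact (Diagram.structural (.rightUnitor _)).isDiagram

instance [ha : Denotes X a A] : IsDiagram X [] a (tens a unit) (ρ_ A).inv := by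
  obtain rfl := ha.eq
  exact (Diagram.structural (.rightUnitorInv _)).isDiagram

instance [ha : Denotes X a A] [hb : Denotes X b B] :
    IsDiagram X [] (tens a b) (tens b a) (β_ A B).hom := by
  obtain rfl := ha.eq; obtain rfl := hb.eq
  exact (Diagram.structural (.braid _ _)).isDiagram

end

instance (a b c d : WireExpr) (A B A' B' : C) [Denotes X a A] [Denotes X b B] [Denotes X c A']
    [Denotes X d B'] : IsDiagram X [] (tens (tens a b) (tens c d)) (tens (tens a c) (tens b d))
      (tensorμ A B A' B') := by
  unfold tensorμ
  exact IsDiagram.congr inferInstance rfl rfl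

end Instances

/-- Two morphisms that are denoted by string diagrams with the same boxes are equal. -/
theorem eq_of_diagram (e : WireExpr) {e' e'' : WireExpr} {bs bs' : List (Box X)} {A A' : C}
    {f g : A ⟶ A'} [hf : IsDiagram X bs e e' f] [hg : IsDiagram X bs' e e'' g] (he : e' = e'')
    (hbs : bs = bs')
    (hn : decide (e.wires ++ bs.flatMap fun B => B.cod.wires).Nodup = true)
    (hn' : decide e'.wires.Nodup = true) : f = g := by
  subst he hbs
  obtain ⟨rfl, rfl, hf⟩ := hf
  obtain ⟨_, _, hg⟩ := hg
  simpa using hf.unique (of_decide_eq_true hn) (of_decide_eq_true hn') hg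

section Objects

variable (A B : C) (l : List C)

instance : Denotes (objects (A :: l)) (wire 0) A := ⟨rfl⟩
instance (i : ℕ) [h : Denotes (objects l) (wire i) A] :
    Denotes (objects (B :: l)) (wire (i + 1)) A := ⟨h.eq⟩

end Objects

end Coherence

/-! ### Dual pairs of objects -/

section DualPair

variable {C : Type u} [Category.{v} C] [MonoidalCategory C] [SymmetricCategory C]

/-- A pair of mutually dual objects of a symmetric monoidal category. Both morphisms refer to the
order `A ⊗ D` of the two objects, whence the braidings in the zigzag identities. -/
structure DualPair (A D : C) where
  coev : 𝟙_ C ⟶ A ⊗ D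
  ev : A ⊗ D ⟶ 𝟙_ C
  zigzag_left : (λ_ A).inv ≫ coev ▷ A ≫ (α_ _ _ _).hom ≫ A ◁ (β_ D A).hom ≫ A ◁ ev ≫
    (ρ_ A).hom = 𝟙 A
  zigzag_right : (ρ_ D).inv ≫ D ◁ coev ≫ (α_ _ _ _).inv ≫ (β_ D A).hom ▷ D ≫ ev ▷ D ≫
    (λ_ D).hom = 𝟙 D

namespace DualPair

variable {A D : C} (p : DualPair A D)

/-- The dual pair with the two objects interchanged. -/
def swap : DualPair D A where
  coev := p.coev ≫ (β_ A D).hom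
  ev := (β_ D A).hom ≫ p.ev
  zigzag_left := by
    refine Eq.trans ?_ p.zigzag_right
    have := isDiagram_box (X := objects [D, A, D]) p.coev unit (tens (wire 1) (wire 2)) rfl rfl
    have := isDiagram_box (X := objects [D, A, D]) p.ev (tens (wire 1) (wire 0)) unit rfl rfl
    exact eq_of_diagram (objects [D, A, D]) (wire 0) rfl rfl rfl rfl
  zigzag_right := by
    refine Eq.trans ?_ p.zigzag_left
    have := isDiagram_box (X := objects [A, A, D]) p.coev unit (tens (wire 1) (wire 2)) rfl rfl
    have := isDiagram_box (X := objects [A, A, D]) p.ev (tens (wire 0) (wire 2)) unit rfl rfl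
    exact eq_of_diagram (objects [A, A, D]) (wire 0) rfl rfl rfl rfl

/-- The evaluation is determined by the coevaluation and one zigzag identity. -/
theorem ev_unique (e : A ⊗ D ⟶ 𝟙_ C)
    (h : (ρ_ D).inv ≫ D ◁ p.coev ≫ (α_ _ _ _).inv ≫ (β_ D A).hom ▷ D ≫ e ▷ D ≫
      (λ_ D).hom = 𝟙 D) : e = p.ev := by
  let P : A ⊗ D ⟶ (A ⊗ D) ⊗ (A ⊗ D) := (λ_ _).inv ≫ p.coev ▷ (A ⊗ D) ≫
    (A ⊗ D) ◁ (β_ A D).hom ≫ tensorμ A D D A ≫ (A ⊗ D) ◁ (β_ D A).hom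
  have := isDiagram_box (X := objects [A, D, A, D]) p.coev unit (tens (wire 2) (wire 3)) rfl rfl
  have := isDiagram_box (X := objects [A, D, A, D]) e (tens (wire 2) (wire 1)) unit rfl rfl
  have := isDiagram_box (X := objects [A, D, A, D]) p.ev (tens (wire 0) (wire 3)) unit rfl rfl
  have h₁ : P ≫ (e ⊗ₘ p.ev) ≫ (λ_ _).hom = p.ev := by
    conv_rhs => rw [← Category.id_comp p.ev, ← MonoidalCategory.whiskerLeft_id, ← h]
    exact eq_of_diagram (objects [A, D, A, D]) (tens (wire 0) (wire 1)) rfl rfl rfl rfl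
  have h₂ : P ≫ (e ⊗ₘ p.ev) ≫ (λ_ _).hom = e := by
    rw [MonoidalCategory.tensorHom_def']
    conv_rhs => rw [← Category.id_comp e, ← MonoidalCategory.id_whiskerRight, ← p.zigzag_left]
    exact eq_of_diagram (objects [A, D, A, D]) (tens (wire 0) (wire 1)) rfl rfl rfl rfl
  exact h₂.symm.trans h₁

end DualPair

variable [LeftRigidCategory C]

/-- An object and its chosen dual. -/
def dualPair (b : C) : DualPair b (ᘁb) where
  coev := coform b ≫ (β_ _ _).hom
  ev := form b
  zigzag_left := by
    have h := ExactPairing.coevaluation_evaluation (ᘁb) b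
    have h' : 𝟙 b = (ρ_ b).inv ≫ (b ◁ coform b ≫ (α_ _ _ _).inv ≫ form b ▷ b) ≫ (λ_ b).hom := by
      unfold coform form
      rw [h]; simp
    rw [h']
    have := isDiagram_box (X := objects [b, ᘁb, b]) (coform b) unit (tens (wire 1) (wire 2))
      rfl rfl
    have := isDiagram_box (X := objects [b, ᘁb, b]) (form b) (tens (wire 0) (wire 1)) unit
      rfl rfl
    exact eq_of_diagram (objects [b, ᘁb, b]) (wire 0) rfl rfl rfl rfl
  zigzag_right := by
    have h := ExactPairing.evaluation_coevaluation (ᘁb) b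
    have h' : 𝟙 (ᘁb) = (λ_ _).inv ≫ (coform b ▷ (ᘁb) ≫ (α_ _ _ _).hom ≫ (ᘁb) ◁ form b) ≫
        (ρ_ _).hom := by
      unfold coform form
      rw [h]; simp
    rw [h']
    have := isDiagram_box (X := objects [ᘁb, ᘁb, b]) (coform b) unit (tens (wire 1) (wire 2))
      rfl rfl
    have := isDiagram_box (X := objects [ᘁb, ᘁb, b]) (form b) (tens (wire 2) (wire 0)) unit
      rfl rfl
    exact eq_of_diagram (objects [ᘁb, ᘁb, b]) (wire 0) rfl rfl rfl rfl

/-- This is where stability enters: the form of the dual object is the symmetric partner of the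
form of the object. -/
theorem dualForm_eq [Stable C] (b : C) : dualForm b = (β_ _ _).hom ≫ form b := by
  -- the zigzag identity of `b*`, with `b**` replaced by an arbitrary object that is equal to it
  have key : ∀ (A : C) (e : (ᘁ(ᘁb)) = A) (κ : 𝟙_ C ⟶ A ⊗ (ᘁb))
      (_ : κ = coform (ᘁb) ≫ (eqToHom e ▷ (ᘁb))),
      (ρ_ (ᘁb)).inv ≫ (ᘁb) ◁ κ ≫ (α_ _ _ _).inv ≫ (((ᘁb) ◁ eqToHom e.symm) ≫ form (ᘁb)) ▷ (ᘁb) ≫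
        (λ_ (ᘁb)).hom = 𝟙 (ᘁb) := by
    rintro _ rfl _ rfl
    have h := ExactPairing.coevaluation_evaluation (ᘁ(ᘁb)) (ᘁb)
    unfold coform form
    simp [reassoc_of% h]
  have h := key b (Stable.dual_dual b) _ (Stable.canonical_eq_id b)
  change _ ≫ _ ≫ _ ≫ dualForm b ▷ _ ≫ _ = _ at h
  have h₁ : (β_ _ _).hom ≫ dualForm b = form b := by
    refine (dualPair b).ev_unique _ (Eq.trans ?_ h)
    simp only [dualPair]
    rw [← comp_whiskerRight_assoc, SymmetricCategory.symmetry_assoc]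
  rw [← h₁]
  simp

end DualPair

/-! ### Tensor products of finite families -/

section BigTensor

variable {C : Type u} [Category.{v} C] [MonoidalCategory C]

theorem bigTensorMap_succ {n : ℕ} {X Y : Fin (n + 1) → C} (f : ∀ k, X k ⟶ Y k) :
    bigTensorMap f = f 0 ⊗ₘ bigTensorMap fun k => f k.succ := rfl

theorem bigTensorMap_id {n : ℕ} (X : Fin n → C) : bigTensorMap (fun k => 𝟙 (X k)) = 𝟙 _ := by
  induction n with
  | zero => rfl
  | succ n ih =>
    rw [bigTensorMap_succ, ih fun k => X k.succ, MonoidalCategory.id_tensorHom_id]; rfl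

theorem bigTensorMap_comp {n : ℕ} {X Y Z : Fin n → C} (f : ∀ k, X k ⟶ Y k) (g : ∀ k, Y k ⟶ Z k) :
    bigTensorMap (fun k => f k ≫ g k) = bigTensorMap f ≫ bigTensorMap g := by
  induction n with
  | zero => exact (Category.comp_id _).symm
  | succ n ih =>
    rw [bigTensorMap_succ, ih (fun k => f k.succ) fun k => g k.succ,
      ← MonoidalCategory.tensorHom_comp_tensorHom]; rfl

/-- The family of morphisms with `f` in place `i` and identities in all other places. -/
def placeMap {A A' : C} (f : A ⟶ A') : {n : ℕ} → (i : Fin n) → ∀ k, place A i k ⟶ place A' i k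
  | n + 1, ⟨0, h⟩ => Fin.cons (α := fun k : Fin (n + 1) => place A ⟨0, h⟩ k ⟶ place A' ⟨0, h⟩ k)
      f fun _ => 𝟙 (𝟙_ C)
  | n + 1, ⟨i + 1, h⟩ => Fin.cons
      (α := fun k : Fin (n + 1) => place A ⟨i + 1, h⟩ k ⟶ place A' ⟨i + 1, h⟩ k)
      (𝟙 (𝟙_ C)) (placeMap f ⟨i, Nat.lt_of_succ_lt_succ h⟩)

/-- The canonical morphisms `1 ⊗ 1 ⟶ 1` and the identity of `A ⊗ B`. -/
def placeMul (A B : C) : {n : ℕ} → (i : Fin n) → ∀ k, place A i k ⊗ place B i k ⟶ place (A ⊗ B) i k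
  | n + 1, ⟨0, h⟩ => Fin.cons
      (α := fun k : Fin (n + 1) => place A ⟨0, h⟩ k ⊗ place B ⟨0, h⟩ k ⟶ place (A ⊗ B) ⟨0, h⟩ k)
      (𝟙 (A ⊗ B)) fun _ => (λ_ (𝟙_ C)).hom
  | n + 1, ⟨i + 1, h⟩ => Fin.cons
      (α := fun k : Fin (n + 1) =>
        place A ⟨i + 1, h⟩ k ⊗ place B ⟨i + 1, h⟩ k ⟶ place (A ⊗ B) ⟨i + 1, h⟩ k)
      (λ_ (𝟙_ C)).hom (placeMul A B ⟨i, Nat.lt_of_succ_lt_succ h⟩)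

variable (C) in
/-- If the unit is put in place `i`, all places hold the unit. -/
def placeUnit : {n : ℕ} → (i : Fin n) → ∀ k, place (𝟙_ C) i k ⟶ 𝟙_ C
  | n + 1, ⟨0, h⟩ => Fin.cons (α := fun k : Fin (n + 1) => place (𝟙_ C) ⟨0, h⟩ k ⟶ 𝟙_ C)
      (𝟙 (𝟙_ C)) fun _ => 𝟙 (𝟙_ C)
  | n + 1, ⟨i + 1, h⟩ => Fin.cons (α := fun k : Fin (n + 1) => place (𝟙_ C) ⟨i + 1, h⟩ k ⟶ 𝟙_ C)
      (𝟙 (𝟙_ C)) (placeUnit ⟨i, Nat.lt_of_succ_lt_succ h⟩)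

theorem placeIso_natural {A A' : C} (f : A ⟶ A') {n : ℕ} (i : Fin n) :
    f ≫ (placeIso A' i).hom = (placeIso A i).hom ≫ bigTensorMap (placeMap f i) := by
  induction n with
  | zero => exact i.elim0
  | succ n ih =>
    obtain ⟨_ | i, h⟩ := i
    · change f ≫ (ρ_ A').inv ≫ (𝟙 A' ⊗ₘ (unitIso n).hom) = ((ρ_ A).inv ≫ (𝟙 A ⊗ₘ (unitIso n).hom)) ≫
        (f ⊗ₘ bigTensorMap fun _ => 𝟙 (𝟙_ C))
      rw [bigTensorMap_id]
      simp only [MonoidalCategory.id_tensorHom, MonoidalCategory.tensorHom_id, Category.assoc]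
      rw [rightUnitor_inv_naturality_assoc, whisker_exchange]
    · change f ≫ (placeIso A' ⟨i, _⟩).hom ≫ (λ_ _).inv = ((placeIso A ⟨i, _⟩).hom ≫ (λ_ _).inv) ≫
        (𝟙 (𝟙_ C) ⊗ₘ bigTensorMap (placeMap f ⟨i, Nat.lt_of_succ_lt_succ h⟩))
      rw [← Category.assoc, ih]
      simp

theorem placeIso_unit {n : ℕ} (i : Fin n) :
    (placeIso (𝟙_ C) i).hom ≫ bigTensorMap (placeUnit C i) = (unitIso n).hom := by
  induction n with
  | zero => exact i.elim0
  | succ n ih =>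
    obtain ⟨_ | i, h⟩ := i
    · change ((ρ_ (𝟙_ C)).inv ≫ (𝟙 (𝟙_ C) ⊗ₘ (unitIso n).hom)) ≫
        (𝟙 (𝟙_ C) ⊗ₘ bigTensorMap fun _ => 𝟙 (𝟙_ C)) = (unitIso n).hom ≫ (λ_ _).inv
      rw [bigTensorMap_id]
      simp [unitors_equal]
    · change ((placeIso (𝟙_ C) ⟨i, _⟩).hom ≫ (λ_ _).inv) ≫
        (𝟙 (𝟙_ C) ⊗ₘ bigTensorMap (placeUnit C ⟨i, Nat.lt_of_succ_lt_succ h⟩)) =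
        (unitIso n).hom ≫ (λ_ _).inv
      rw [← ih ⟨i, Nat.lt_of_succ_lt_succ h⟩]
      simp

variable [SymmetricCategory C]

/-! The induction steps for the following properties of `mulIso` are stated for arbitrary objects in
place of the tensor products of the tails of the families. -/

theorem middle_natural_step {x x' y y' A A' B B' P P' : C} (f : x ⟶ x') (g : y ⟶ y')
    (F : A ⟶ A') (G : B ⟶ B') (m : A ⊗ B ⟶ P) (m' : A' ⊗ B' ⟶ P') (H : P ⟶ P')
    (h : (F ⊗ₘ G) ≫ m' = m ≫ H) :
    ((f ⊗ₘ F) ⊗ₘ (g ⊗ₘ G)) ≫ tensorμ x' A' y' B' ≫ (𝟙 _ ⊗ₘ m') =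
      (tensorμ x A y B ≫ (𝟙 _ ⊗ₘ m)) ≫ ((f ⊗ₘ g) ⊗ₘ H) := by
  rw [tensorμ_natural_assoc, Category.assoc, MonoidalCategory.tensorHom_comp_tensorHom,
    MonoidalCategory.tensorHom_comp_tensorHom, h, Category.comp_id, Category.id_comp]

theorem middle_assoc_step (x y z : C) {A B D P Q R S : C} (a : A ⊗ B ⟶ P) (b : P ⊗ D ⟶ R)
    (c : B ⊗ D ⟶ Q) (d : A ⊗ Q ⟶ S) (e : R ⟶ S)
    (h : a ▷ D ≫ b ≫ e = (α_ _ _ _).hom ≫ A ◁ c ≫ d) :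
    (tensorμ x A y B ≫ (𝟙 _ ⊗ₘ a)) ▷ (z ⊗ D) ≫ (tensorμ (x ⊗ y) P z D ≫ (𝟙 _ ⊗ₘ b)) ≫
        ((α_ x y z).hom ⊗ₘ e) =
      (α_ _ _ _).hom ≫ (x ⊗ A) ◁ (tensorμ y B z D ≫ (𝟙 _ ⊗ₘ c)) ≫
        (tensorμ x A (y ⊗ z) Q ≫ (𝟙 _ ⊗ₘ d)) := by
  let X := objects [x, A, y, B, z, D, P, R, S, Q]
  have := isDiagram_box (X := X) a (tens (wire 1) (wire 3)) (wire 6) rfl rfl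
  have := isDiagram_box (X := X) b (tens (wire 6) (wire 5)) (wire 7) rfl rfl
  have := isDiagram_box (X := X) c (tens (wire 3) (wire 5)) (wire 9) rfl rfl
  have := isDiagram_box (X := X) d (tens (wire 1) (wire 9)) (wire 8) rfl rfl
  have := isDiagram_box (X := X) e (wire 7) (wire 8) rfl rfl
  let s := tens (tens (tens (wire 0) (wire 1)) (tens (wire 2) (wire 3))) (tens (wire 4) (wire 5))
  calc _ = tensorμ x A y B ▷ (z ⊗ D) ≫ tensorμ (x ⊗ y) (A ⊗ B) z D ≫
        ((α_ x y z).hom ⊗ₘ (a ▷ D ≫ b ≫ e)) := by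
        exact eq_of_diagram X s rfl rfl rfl rfl
    _ = _ := by
        rw [h]
        exact eq_of_diagram X s rfl rfl rfl rfl

theorem middle_braid_step (x y : C) {A B P Q : C} (a : A ⊗ B ⟶ P) (b : B ⊗ A ⟶ Q) (e : P ⟶ Q)
    (h : a ≫ e = (β_ _ _).hom ≫ b) :
    (tensorμ x A y B ≫ (𝟙 _ ⊗ₘ a)) ≫ ((β_ x y).hom ⊗ₘ e) =
      (β_ _ _).hom ≫ tensorμ y B x A ≫ (𝟙 _ ⊗ₘ b) := by
  let X := objects [x, A, y, B, P, Q]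
  have := isDiagram_box (X := X) a (tens (wire 1) (wire 3)) (wire 4) rfl rfl
  have := isDiagram_box (X := X) b (tens (wire 3) (wire 1)) (wire 5) rfl rfl
  have := isDiagram_box (X := X) e (wire 4) (wire 5) rfl rfl
  let s := tens (tens (wire 0) (wire 1)) (tens (wire 2) (wire 3))
  calc _ = tensorμ x A y B ≫ ((β_ x y).hom ⊗ₘ (a ≫ e)) := by
        exact eq_of_diagram X s rfl rfl rfl rfl
    _ = _ := by
        rw [h]
        exact eq_of_diagram X s rfl rfl rfl rfl

theorem middle_unit_step (x : C) {A I P : C} (u : I ⟶ 𝟙_ C) (a : A ⊗ I ⟶ P) (e : P ⟶ A)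
    (h : a ≫ e = A ◁ u ≫ (ρ_ A).hom) :
    (tensorμ x A (𝟙_ C) I ≫ (𝟙 _ ⊗ₘ a)) ≫ ((ρ_ x).hom ⊗ₘ e) =
      (x ⊗ A) ◁ ((λ_ I).hom ≫ u) ≫ (ρ_ _).hom := by
  let X := objects [x, A, I, P, A]
  have := isDiagram_box (X := X) a (tens (wire 1) (wire 2)) (wire 3) rfl rfl
  have := isDiagram_box (X := X) e (wire 3) (wire 4) rfl rfl
  have := isDiagram_box (X := X) u (wire 2) unit rfl rfl
  let s := tens (tens (wire 0) (wire 1)) (tens unit (wire 2))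
  calc _ = tensorμ x A (𝟙_ C) I ≫ ((ρ_ x).hom ⊗ₘ (a ≫ e)) := by
        exact eq_of_diagram X s rfl rfl rfl rfl
    _ = _ := by
        rw [h]
        exact eq_of_diagram X s rfl rfl rfl rfl

theorem mulIso_natural {n : ℕ} {X X' Y Y' : Fin n → C} (f : ∀ k, X k ⟶ X' k)
    (g : ∀ k, Y k ⟶ Y' k) :
    (bigTensorMap f ⊗ₘ bigTensorMap g) ≫ (mulIso X' Y').hom =
      (mulIso X Y).hom ≫ bigTensorMap fun k => f k ⊗ₘ g k := by
  induction n with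
  | zero =>
    change (𝟙 (𝟙_ C) ⊗ₘ 𝟙 (𝟙_ C)) ≫ (λ_ (𝟙_ C)).hom = (λ_ (𝟙_ C)).hom ≫ 𝟙 (𝟙_ C)
    simp
  | succ n ih => exact middle_natural_step _ _ _ _ _ _ _ (ih (fun k => f k.succ) fun k => g k.succ)

theorem mulIso_assoc {n : ℕ} (X Y Z : Fin n → C) :
    (mulIso X Y).hom ▷ bigTensor Z ≫ (mulIso (fun k => X k ⊗ Y k) Z).hom ≫
      bigTensorMap (fun k => (α_ (X k) (Y k) (Z k)).hom) =
    (α_ _ _ _).hom ≫ bigTensor X ◁ (mulIso Y Z).hom ≫ (mulIso X fun k => Y k ⊗ Z k).hom := by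
  induction n with
  | zero =>
    change (λ_ (𝟙_ C)).hom ▷ (𝟙_ C) ≫ (λ_ (𝟙_ C)).hom ≫ 𝟙 (𝟙_ C) =
      (α_ _ _ _).hom ≫ (𝟙_ C) ◁ (λ_ (𝟙_ C)).hom ≫ (λ_ (𝟙_ C)).hom
    monoidal
  | succ n ih =>
    exact middle_assoc_step _ _ _ _ _ _ _ _
      (ih (fun k => X k.succ) (fun k => Y k.succ) fun k => Z k.succ)

theorem mulIso_braid {n : ℕ} (X Y : Fin n → C) :
    (mulIso X Y).hom ≫ bigTensorMap (fun k => (β_ (X k) (Y k)).hom) =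
      (β_ _ _).hom ≫ (mulIso Y X).hom := by
  induction n with
  | zero =>
    change (λ_ (𝟙_ C)).hom ≫ 𝟙 (𝟙_ C) = (β_ (𝟙_ C) (𝟙_ C)).hom ≫ (λ_ (𝟙_ C)).hom
    rw [braiding_tensorUnit_left]
    monoidal
  | succ n ih => exact middle_braid_step _ _ _ _ _ (ih (fun k => X k.succ) fun k => Y k.succ)

theorem mulIso_unit_right {n : ℕ} (X : Fin n → C) :
    (mulIso X fun _ => 𝟙_ C).hom ≫ bigTensorMap (fun k => (ρ_ (X k)).hom) =
      bigTensor X ◁ (unitIso n).inv ≫ (ρ_ _).hom := by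
  induction n with
  | zero =>
    change (λ_ (𝟙_ C)).hom ≫ 𝟙 (𝟙_ C) = 𝟙_ C ◁ 𝟙 _ ≫ (ρ_ (𝟙_ C)).hom
    simp [unitors_equal]
  | succ n ih => exact middle_unit_step _ _ _ _ (ih fun k => X k.succ)

theorem unitIso_mul (n : ℕ) :
    ((unitIso n).hom ⊗ₘ (unitIso n).hom) ≫
      (mulIso (fun _ : Fin n => 𝟙_ C) fun _ => 𝟙_ C).hom ≫
      bigTensorMap (fun _ => (λ_ (𝟙_ C)).hom) = (λ_ (𝟙_ C)).hom ≫ (unitIso n).hom := by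
  have h := mulIso_unit_right fun _ : Fin n => 𝟙_ C
  simp only [← unitors_equal] at h
  rw [h, MonoidalCategory.tensorHom_def]
  simp [unitors_equal]

theorem place_zero_mul_step (A B : C) {I J P Q : C} (a : 𝟙_ C ⟶ I) (b : 𝟙_ C ⟶ J) (m : I ⊗ J ⟶ P)
    (e : P ⟶ Q) :
    (((ρ_ A).inv ≫ (𝟙 A ⊗ₘ a)) ⊗ₘ ((ρ_ B).inv ≫ (𝟙 B ⊗ₘ b))) ≫
        (tensorμ A I B J ≫ (𝟙 _ ⊗ₘ m)) ≫ (𝟙 _ ⊗ₘ e) =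
      (ρ_ _).inv ≫ (𝟙 _ ⊗ₘ ((λ_ _).inv ≫ (a ⊗ₘ b) ≫ m ≫ e)) := by
  let X := objects [A, B, I, J, P, Q]
  have := isDiagram_box (X := X) a unit (wire 2) rfl rfl
  have := isDiagram_box (X := X) b unit (wire 3) rfl rfl
  have := isDiagram_box (X := X) m (tens (wire 2) (wire 3)) (wire 4) rfl rfl
  have := isDiagram_box (X := X) e (wire 4) (wire 5) rfl rfl
  exact eq_of_diagram X (tens (wire 0) (wire 1)) rfl rfl rfl rfl

theorem place_succ_mul_step {A B I J P Q : C} (a : A ⟶ I) (b : B ⟶ J) (m : I ⊗ J ⟶ P)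
    (e : P ⟶ Q) :
    ((a ≫ (λ_ _).inv) ⊗ₘ (b ≫ (λ_ _).inv)) ≫ (tensorμ _ _ _ _ ≫ (𝟙 _ ⊗ₘ m)) ≫
      ((λ_ (𝟙_ C)).hom ⊗ₘ e) = ((a ⊗ₘ b) ≫ m ≫ e) ≫ (λ_ _).inv := by
  let X := objects [A, B, I, J, P, Q]
  have := isDiagram_box (X := X) a (wire 0) (wire 2) rfl rfl
  have := isDiagram_box (X := X) b (wire 1) (wire 3) rfl rfl
  have := isDiagram_box (X := X) m (tens (wire 2) (wire 3)) (wire 4) rfl rfl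
  have := isDiagram_box (X := X) e (wire 4) (wire 5) rfl rfl
  exact eq_of_diagram X (tens (wire 0) (wire 1)) rfl rfl rfl rfl

theorem placeIso_mul (A B : C) {n : ℕ} (i : Fin n) :
    ((placeIso A i).hom ⊗ₘ (placeIso B i).hom) ≫ (mulIso _ _).hom ≫
      bigTensorMap (placeMul A B i) = (placeIso (A ⊗ B) i).hom := by
  induction n with
  | zero => exact i.elim0
  | succ n ih =>
    obtain ⟨_ | i, h⟩ := i
    · change (((ρ_ A).inv ≫ (𝟙 A ⊗ₘ (unitIso n).hom)) ⊗ₘ ((ρ_ B).inv ≫ (𝟙 B ⊗ₘ (unitIso n).hom))) ≫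
        (tensorμ A (bigTensor fun _ => 𝟙_ C) B (bigTensor fun _ => 𝟙_ C) ≫
          (𝟙 _ ⊗ₘ (mulIso _ _).hom)) ≫ (𝟙 _ ⊗ₘ bigTensorMap fun _ => (λ_ (𝟙_ C)).hom) =
        (ρ_ _).inv ≫ (𝟙 _ ⊗ₘ (unitIso n).hom)
      have h := unitIso_mul (C := C) n
      have e : (unitIso n).hom = (λ_ (𝟙_ C)).inv ≫ ((unitIso n).hom ⊗ₘ (unitIso n).hom) ≫
          (mulIso (fun _ : Fin n => 𝟙_ C) fun _ => 𝟙_ C).hom ≫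
          bigTensorMap (fun _ => (λ_ (𝟙_ C)).hom) := by rw [h]; simp
      conv_rhs => rw [e]
      exact place_zero_mul_step _ _ _ _ _ _
    · change (((placeIso A ⟨i, _⟩).hom ≫ (λ_ _).inv) ⊗ₘ ((placeIso B ⟨i, _⟩).hom ≫ (λ_ _).inv)) ≫
        (tensorμ _ _ _ _ ≫ (𝟙 _ ⊗ₘ (mulIso _ _).hom)) ≫
        ((λ_ (𝟙_ C)).hom ⊗ₘ bigTensorMap (placeMul A B ⟨i, Nat.lt_of_succ_lt_succ h⟩)) =
        (placeIso (A ⊗ B) ⟨i, _⟩).hom ≫ (λ_ _).inv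
      rw [← ih]
      exact place_succ_mul_step _ _ _ _

end BigTensor

/-! ### Framed objects and graded morphisms -/

section Frame

variable {C : Type u} [Category.{v} C] [MonoidalCategory C]

variable (C) in
/-- An object of `C` that is identified with the tensor product of a family of `n` objects, one for
each generator. -/
structure Frame (n : ℕ) where
  obj : C
  fam : Fin n → C
  iso : obj ≅ bigTensor fam

namespace Frame

variable {n : ℕ}

/-- A morphism between framed objects is graded if it is the tensor product of a family of
morphisms. -/
def Graded (A B : Frame C n) (f : A.obj ⟶ B.obj) : Prop :=
  ∃ g : ∀ k, A.fam k ⟶ B.fam k, f ≫ B.iso.hom = A.iso.hom ≫ bigTensorMap g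

theorem graded_id (A : Frame C n) : Graded A A (𝟙 _) :=
  ⟨fun _ => 𝟙 _, by rw [bigTensorMap_id]; simp⟩

theorem Graded.comp {A B D : Frame C n} {f : A.obj ⟶ B.obj} {g : B.obj ⟶ D.obj}
    (hf : Graded A B f) (hg : Graded B D g) : Graded A D (f ≫ g) := by
  obtain ⟨f', hf⟩ := hf
  obtain ⟨g', hg⟩ := hg
  exact ⟨fun k => f' k ≫ g' k, by rw [bigTensorMap_comp, Category.assoc, hg, reassoc_of% hf]⟩

variable (C n) in
/-- The unit object, framed by the unit objects. -/
abbrev one : Frame C n where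
  obj := 𝟙_ C
  fam _ := 𝟙_ C
  iso := unitIso n

/-- The object `X`, framed by `X` in place `i`. -/
abbrev single (X : C) (i : Fin n) : Frame C n where
  obj := X
  fam := place X i
  iso := placeIso X i

theorem graded_single {X Y : C} (f : X ⟶ Y) (i : Fin n) : Graded (single X i) (single Y i) f :=
  ⟨placeMap f i, placeIso_natural f i⟩

theorem graded_single_unit (i : Fin n) : Graded (single (𝟙_ C) i) (one C n) (𝟙 _) :=
  ⟨placeUnit C i, (Category.id_comp _).trans (placeIso_unit i).symm⟩

variable [SymmetricCategory C]

/-- The tensor product of two framed objects. -/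
abbrev tensor (A B : Frame C n) : Frame C n where
  obj := A.obj ⊗ B.obj
  fam k := A.fam k ⊗ B.fam k
  iso := (A.iso ⊗ᵢ B.iso) ≪≫ mulIso _ _

theorem Graded.tensor {A A' B B' : Frame C n} {f : A.obj ⟶ A'.obj} {g : B.obj ⟶ B'.obj}
    (hf : Graded A A' f) (hg : Graded B B' g) : Graded (A.tensor B) (A'.tensor B') (f ⊗ₘ g) := by
  obtain ⟨f', hf⟩ := hf
  obtain ⟨g', hg⟩ := hg
  refine ⟨fun k => f' k ⊗ₘ g' k, ?_⟩
  simp only [Frame.tensor, Iso.trans_hom, tensorIso_hom, Category.assoc]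
  rw [← mulIso_natural, tensorHom_comp_tensorHom_assoc, tensorHom_comp_tensorHom_assoc, hf, hg]

theorem Graded.whiskerRight {A A' : Frame C n} {f : A.obj ⟶ A'.obj} (hf : Graded A A' f)
    (B : Frame C n) : Graded (A.tensor B) (A'.tensor B) (f ▷ B.obj) := by
  rw [← MonoidalCategory.tensorHom_id]
  exact hf.tensor B.graded_id

theorem Graded.whiskerLeft (B : Frame C n) {A A' : Frame C n} {f : A.obj ⟶ A'.obj}
    (hf : Graded A A' f) : Graded (B.tensor A) (B.tensor A') (B.obj ◁ f) := by
  rw [← MonoidalCategory.id_tensorHom]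
  exact B.graded_id.tensor hf

theorem graded_assoc (A B D : Frame C n) :
    Graded ((A.tensor B).tensor D) (A.tensor (B.tensor D)) (α_ A.obj B.obj D.obj).hom := by
  refine ⟨fun k => (α_ (A.fam k) (B.fam k) (D.fam k)).hom, ?_⟩
  have h := mulIso_assoc A.fam B.fam D.fam
  simp only [Frame.tensor, Iso.trans_hom, tensorIso_hom, Category.assoc]
  generalize (mulIso A.fam B.fam).hom = a at *
  generalize (mulIso (fun k => A.fam k ⊗ B.fam k) D.fam).hom = b at *
  generalize (mulIso B.fam D.fam).hom = c at *
  generalize (mulIso A.fam fun k => B.fam k ⊗ D.fam k).hom = d at *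
  have h₁ : (A.iso.hom ⊗ₘ (B.iso.hom ⊗ₘ D.iso.hom) ≫ c) =
      (A.iso.hom ⊗ₘ (B.iso.hom ⊗ₘ D.iso.hom)) ≫ bigTensor A.fam ◁ c := by
    simp [MonoidalCategory.tensorHom_def]
  have h₂ : ((A.iso.hom ⊗ₘ B.iso.hom) ≫ a ⊗ₘ D.iso.hom) =
      ((A.iso.hom ⊗ₘ B.iso.hom) ⊗ₘ D.iso.hom) ≫ a ▷ bigTensor D.fam := by
    simp [MonoidalCategory.tensorHom_def']
  rw [h₁, h₂, Category.assoc, Category.assoc, h, associator_naturality_assoc]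

theorem graded_braid (A B : Frame C n) :
    Graded (A.tensor B) (B.tensor A) (β_ A.obj B.obj).hom := by
  refine ⟨fun k => (β_ (A.fam k) (B.fam k)).hom, ?_⟩
  simp only [Frame.tensor, Iso.trans_hom, tensorIso_hom, Category.assoc]
  rw [mulIso_braid, BraidedCategory.braiding_naturality_assoc]

theorem graded_rightUnitor (A : Frame C n) :
    Graded (A.tensor (one C n)) A (ρ_ A.obj).hom := by
  refine ⟨fun k => (ρ_ (A.fam k)).hom, ?_⟩
  simp only [Frame.tensor, Iso.trans_hom, tensorIso_hom, Category.assoc, one]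
  rw [mulIso_unit_right]
  simp [MonoidalCategory.tensorHom_def, ← MonoidalCategory.whiskerLeft_comp_assoc]

theorem graded_single_mul (X Y : C) (i : Fin n) :
    Graded ((single X i).tensor (single Y i)) (single (X ⊗ Y) i) (𝟙 _) := by
  refine ⟨placeMul X Y i, ?_⟩
  simp only [Frame.tensor, Iso.trans_hom, tensorIso_hom, Category.assoc, single]
  exact (Category.id_comp _).trans (placeIso_mul X Y i).symm

/-- The framed object `R(b)`. -/
abbrev word [LeftRigidCategory C] (b : C) (R : Word n) : Frame C n where
  obj := wordObj b R
  fam := genObj b R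
  iso := wordIso b R

end Frame
end Frame

/-! ### Balanced functionals and the action of open morphisms -/

section Functionals

variable (K : Type w) [Field K] {C : Type u} [Category.{v} C] [Preadditive C] [Linear K C]
  [MonoidalCategory C] [MonoidalPreadditive C] [MonoidalLinear K C] [SymmetricCategory C] (n : ℕ)

/-- The space of balanced functionals with coefficients in `T`: families of linear functionals on
the morphisms `A ⟶ A ⊗ T`, for all framed objects `A`, which take the same value on `f ≫ ψ` and
`ψ ≫ (f ▷ T)` for graded morphisms `f`. It depends contravariantly on `T`. -/
def Functionals (T : C) : Submodule K (∀ A : Frame C n, (A.obj ⟶ A.obj ⊗ T) →ₗ[K] K) where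
  carrier := {F | ∀ (A B : Frame C n) (f : A.obj ⟶ B.obj), Frame.Graded A B f →
    ∀ ψ : B.obj ⟶ A.obj ⊗ T, F A (f ≫ ψ) = F B (ψ ≫ f ▷ T)}
  add_mem' {F G} hF hG A B f hf ψ := by
    simp only [Pi.add_apply, LinearMap.add_apply, hF A B f hf ψ, hG A B f hf ψ]
  zero_mem' _ _ _ _ _ := rfl
  smul_mem' c F hF A B f hf ψ := by
    simp only [Pi.smul_apply, LinearMap.smul_apply, hF A B f hf ψ]

variable {K n}

namespace Functionals

variable {T T' T'' : C}

theorem ext {F G : Functionals K n T} (h : ∀ A ψ, F.1 A ψ = G.1 A ψ) : F = G :=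
  Subtype.ext (funext fun A => LinearMap.ext (h A))

theorem balanced (F : Functionals K n T) {A B : Frame C n} {f : A.obj ⟶ B.obj}
    (hf : Frame.Graded A B f) (ψ : B.obj ⟶ A.obj ⊗ T) : F.1 A (f ≫ ψ) = F.1 B (ψ ≫ f ▷ T) :=
  F.2 A B f hf ψ

/-- The action of a morphism of coefficients. -/
def map (f : T ⟶ T') : Functionals K n T' →ₗ[K] Functionals K n T where
  toFun F := ⟨fun A => (F.1 A).comp (Linear.rightComp K A.obj (A.obj ◁ f)), fun A B g hg ψ => by
    simp only [LinearMap.comp_apply, Linear.rightComp_apply, Category.assoc]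
    rw [balanced F hg, Category.assoc, whisker_exchange]⟩
  map_add' _ _ := rfl
  map_smul' _ _ := rfl

theorem map_apply (f : T ⟶ T') (F : Functionals K n T') (A : Frame C n) (ψ : A.obj ⟶ A.obj ⊗ T) :
    (map f F).1 A ψ = F.1 A (ψ ≫ A.obj ◁ f) := rfl

theorem map_map (f : T ⟶ T') (g : T' ⟶ T'') (F : Functionals K n T'') :
    map f (map g F) = map (f ≫ g) F := by
  refine ext fun A ψ => ?_
  simp [map_apply]

theorem map_id_apply (F : Functionals K n T) : map (𝟙 T) F = F := by
  refine ext fun A ψ => ?_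
  simp [map_apply]

theorem map_add (f g : T ⟶ T') : map (K := K) (n := n) (f + g) = map f + map g := by
  refine LinearMap.ext fun F => ext fun A ψ => ?_
  simp [map_apply, Preadditive.comp_add]

theorem map_smul (c : K) (f : T ⟶ T') : map (K := K) (n := n) (c • f) = c • map f := by
  refine LinearMap.ext fun F => ext fun A ψ => ?_
  simp [map_apply]

theorem map_sum {ι : Type*} (s : Finset ι) (f : ι → (T ⟶ T')) :
    map (K := K) (n := n) (∑ i ∈ s, f i) = ∑ i ∈ s, map (f i) := by
  classical
  induction s using Finset.induction_on with
  | empty =>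
    refine LinearMap.ext fun F => ext fun A ψ => ?_
    simp [map_apply]
  | insert a s ha ih => rw [Finset.sum_insert ha, Finset.sum_insert ha, map_add, ih]

/-- The morphism `ψ` followed by the open morphism `Φ`, side by side. -/
def graft {D D' A A' : C} (ψ : D ⟶ D' ⊗ T) (Φ : T ⊗ A ⟶ A' ⊗ T') :
    D ⊗ A ⟶ (D' ⊗ A') ⊗ T' :=
  ψ ▷ A ≫ (α_ _ _ _).hom ≫ D' ◁ Φ ≫ (α_ _ _ _).inv

/-- The action of an open morphism `Φ : T ⊗ A ⟶ A ⊗ T'`, where `A` is framed: the morphism at which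
a functional is evaluated is continued by `Φ`, and its object is extended by `A`. -/
def tube (A : Frame C n) (Φ : T ⊗ A.obj ⟶ A.obj ⊗ T') :
    Functionals K n T' →ₗ[K] Functionals K n T where
  toFun F := ⟨fun D =>
    { toFun := fun ψ => F.1 (D.tensor A) (graft ψ Φ)
      map_add' := fun ψ ψ' => by
        rw [← LinearMap.map_add]
        simp [graft, Preadditive.add_comp]
      map_smul' := fun c ψ => by
        rw [← LinearMap.map_smul]
        simp [graft] }, fun D D' f hf ψ => by
    have h := balanced F (hf.whiskerRight A) (graft ψ Φ)
    refine Eq.trans ?_ (h.trans ?_)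
    · change F.1 _ _ = _
      congr 1
      simp [graft]
    · change _ = F.1 _ _
      congr 1
      simp only [graft, Category.assoc, comp_whiskerRight]
      rw [← associator_inv_naturality_left, whisker_exchange_assoc,
        associator_naturality_left_assoc]⟩
  map_add' _ _ := rfl
  map_smul' _ _ := rfl

theorem tube_apply (A : Frame C n) (Φ : T ⊗ A.obj ⟶ A.obj ⊗ T') (F : Functionals K n T')
    (D : Frame C n) (ψ : D.obj ⟶ D.obj ⊗ T) :
    (tube A Φ F).1 D ψ = F.1 (D.tensor A) (graft ψ Φ) := rfl

/-- The defining property of balanced functionals: a graded morphism may be moved once around the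
framed object of an open morphism. -/
theorem tube_slide {A A' : Frame C n} {f : A.obj ⟶ A'.obj} (hf : Frame.Graded A A' f)
    (Φ : T ⊗ A'.obj ⟶ A.obj ⊗ T') :
    tube (K := K) A (T ◁ f ≫ Φ) = tube A' (Φ ≫ f ▷ T') := by
  refine LinearMap.ext fun F => ext fun D ψ => ?_
  rw [tube_apply, tube_apply]
  have h := balanced F (hf.whiskerLeft D) (ψ ▷ A'.obj ≫ (α_ _ _ _).hom ≫ D.obj ◁ Φ ≫ (α_ _ _ _).inv)
  refine Eq.trans ?_ (h.trans ?_)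
  · congr 1
    simp [graft, whisker_exchange_assoc]
  · congr 1
    simp [graft, Frame.tensor]

theorem tube_comp (A A' : Frame C n) (Φ : T ⊗ A.obj ⟶ A.obj ⊗ T')
    (Φ' : T' ⊗ A'.obj ⟶ A'.obj ⊗ T'') :
    tube (K := K) A Φ ∘ₗ tube A' Φ' = tube (A.tensor A') ((α_ _ _ _).inv ≫ Φ ▷ A'.obj ≫
      (α_ _ _ _).hom ≫ A.obj ◁ Φ' ≫ (α_ _ _ _).inv) := by
  refine LinearMap.ext fun F => ext fun D ψ => ?_
  rw [LinearMap.comp_apply, tube_apply, tube_apply, tube_apply]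
  have h := balanced F (Frame.graded_assoc D A A') ((α_ _ _ _).inv ≫ graft (graft ψ Φ) Φ')
  refine Eq.trans ?_ (h.trans ?_)
  · congr 1
    simp
  · congr 1
    simp [graft, Frame.tensor]

theorem map_comp_tube (f : T ⟶ T') (A : Frame C n) (Φ : T' ⊗ A.obj ⟶ A.obj ⊗ T'') :
    map (K := K) f ∘ₗ tube A Φ = tube A (f ▷ A.obj ≫ Φ) := by
  refine LinearMap.ext fun F => ext fun D ψ => ?_
  rw [LinearMap.comp_apply, map_apply, tube_apply, tube_apply]
  simp [graft]

theorem tube_comp_map (A : Frame C n) (Φ : T ⊗ A.obj ⟶ A.obj ⊗ T') (f : T' ⟶ T'') :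
    tube (K := K) A Φ ∘ₗ map f = tube A (Φ ≫ A.obj ◁ f) := by
  refine LinearMap.ext fun F => ext fun D ψ => ?_
  rw [LinearMap.comp_apply, tube_apply, map_apply, tube_apply]
  simp [graft, Frame.tensor]

theorem tube_one (T : C) :
    tube (K := K) (Frame.one C n) ((ρ_ T).hom ≫ (λ_ T).inv) = LinearMap.id := by
  refine LinearMap.ext fun F => ext fun D ψ => ?_
  rw [tube_apply, LinearMap.id_apply]
  have h := balanced F (Frame.graded_rightUnitor D) (ψ ≫ (ρ_ _).inv ▷ T)
  refine Eq.trans ?_ (h.trans ?_)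
  · congr 1
    simp [graft]
  · simp

end Functionals
end Functionals

/-! ### Operators on a tensor factor of the coefficients -/

section Slot

variable {C : Type u} [Category.{v} C] [MonoidalCategory C] [SymmetricCategory C]

/-- An open morphism next to an additional factor `Z`. -/
def slot {X Y A A' : C} (φ : X ⊗ A ⟶ A' ⊗ Y) (Z : C) : (X ⊗ Z) ⊗ A ⟶ A' ⊗ (Y ⊗ Z) :=
  (α_ _ _ _).hom ≫ X ◁ (β_ Z A).hom ≫ (α_ _ _ _).inv ≫ φ ▷ Z ≫ (α_ _ _ _).hom

/-- The composite of two open morphisms. -/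
def seq {X X' X'' A A' : C} (φ : X ⊗ A ⟶ A ⊗ X') (φ' : X' ⊗ A' ⟶ A' ⊗ X'') :
    X ⊗ (A ⊗ A') ⟶ (A ⊗ A') ⊗ X'' :=
  (α_ _ _ _).inv ≫ φ ▷ A' ≫ (α_ _ _ _).hom ≫ A ◁ φ' ≫ (α_ _ _ _).inv

/-- The transposition of the first two factors. -/
def swapLeft (X Y Z : C) : X ⊗ (Y ⊗ Z) ⟶ Y ⊗ (X ⊗ Z) :=
  (α_ _ _ _).inv ≫ (β_ X Y).hom ▷ Z ≫ (α_ _ _ _).hom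

instance (X : ℕ → C) (a b c : WireExpr) (A B D : C) [Denotes X a A] [Denotes X b B]
    [Denotes X c D] : IsDiagram X [] (tens a (tens b c)) (tens b (tens a c)) (swapLeft A B D) :=
  IsDiagram.congr (inferInstanceAs (IsDiagram X _ (tens a (tens b c)) _
    ((α_ A B D).inv ≫ (β_ A B).hom ▷ D ≫ (α_ B A D).hom))) rfl rfl

theorem slot_natural {X Y A A' : C} (φ : X ⊗ A ⟶ A' ⊗ Y) {Z Z' : C} (f : Z ⟶ Z') :
    (X ◁ f) ▷ A ≫ slot φ Z' = slot φ Z ≫ A' ◁ (Y ◁ f) := by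
  let W := objects [X, Z, A, A', Y, Z']
  have := isDiagram_box (X := W) φ (tens (wire 0) (wire 2)) (tens (wire 3) (wire 4)) rfl rfl
  have := isDiagram_box (X := W) f (wire 1) (wire 5) rfl rfl
  let s := tens (tens (wire 0) (wire 1)) (wire 2)
  trans (α_ _ _ _).hom ≫ X ◁ (β_ Z A).hom ≫ (α_ _ _ _).inv ≫ (φ ⊗ₘ f) ≫ (α_ _ _ _).hom
  · rw [MonoidalCategory.tensorHom_def']
    unfold slot
    exact eq_of_diagram W s rfl rfl rfl rfl
  · unfold slot
    exact eq_of_diagram W s rfl rfl rfl rfl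

set_option synthInstance.maxSize 4000 in
set_option synthInstance.maxHeartbeats 400000 in
theorem seq_slot {X X' X'' A A' : C} (φ : X ⊗ A ⟶ A ⊗ X') (φ' : X' ⊗ A' ⟶ A' ⊗ X'') (Z : C) :
    seq (slot φ Z) (slot φ' Z) = slot (seq φ φ') Z := by
  let W := objects [X, Z, A, A', A, X', A', X'']
  have := isDiagram_box (X := W) φ (tens (wire 0) (wire 2)) (tens (wire 4) (wire 5)) rfl rfl
  have := isDiagram_box (X := W) φ' (tens (wire 5) (wire 3)) (tens (wire 6) (wire 7)) rfl rfl
  unfold seq slot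
  exact eq_of_diagram W (tens (tens (wire 0) (wire 1)) (tens (wire 2) (wire 3))) rfl rfl rfl rfl

theorem whiskerLeft_slot {X Y A A' : C} (f : A ⟶ A') (φ : X ⊗ A' ⟶ A ⊗ Y) (Z : C) :
    slot (X ◁ f ≫ φ) Z = (X ⊗ Z) ◁ f ≫ slot φ Z := by
  let W := objects [X, Z, A, A', A, Y]
  have := isDiagram_box (X := W) φ (tens (wire 0) (wire 3)) (tens (wire 4) (wire 5)) rfl rfl
  have := isDiagram_box (X := W) f (wire 2) (wire 3) rfl rfl
  unfold slot
  exact eq_of_diagram W (tens (tens (wire 0) (wire 1)) (wire 2)) rfl rfl rfl rfl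

theorem slot_whiskerRight {X Y A A' : C} (f : A ⟶ A') (φ : X ⊗ A' ⟶ A ⊗ Y) (Z : C) :
    slot (φ ≫ f ▷ Y) Z = slot φ Z ≫ f ▷ (Y ⊗ Z) := by
  let W := objects [X, Z, A', A, Y, A']
  have := isDiagram_box (X := W) φ (tens (wire 0) (wire 2)) (tens (wire 3) (wire 4)) rfl rfl
  have := isDiagram_box (X := W) f (wire 3) (wire 5) rfl rfl
  unfold slot
  exact eq_of_diagram W (tens (tens (wire 0) (wire 1)) (wire 2)) rfl rfl rfl rfl

theorem whiskerRight_slot {X X' Y A A' : C} (f : X ⟶ X') (φ : X' ⊗ A ⟶ A' ⊗ Y) (Z : C) :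
    (f ▷ Z) ▷ A ≫ slot φ Z = slot (f ▷ A ≫ φ) Z := by
  let W := objects [X, Z, A, A', Y, X']
  have := isDiagram_box (X := W) φ (tens (wire 5) (wire 2)) (tens (wire 3) (wire 4)) rfl rfl
  have := isDiagram_box (X := W) f (wire 0) (wire 5) rfl rfl
  unfold slot
  exact eq_of_diagram W (tens (tens (wire 0) (wire 1)) (wire 2)) rfl rfl rfl rfl

theorem slot_whiskerLeft {X Y Y' A A' : C} (φ : X ⊗ A ⟶ A' ⊗ Y) (f : Y ⟶ Y') (Z : C) :
    slot φ Z ≫ A' ◁ (f ▷ Z) = slot (φ ≫ A' ◁ f) Z := by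
  let W := objects [X, Z, A, A', Y, Y']
  have := isDiagram_box (X := W) φ (tens (wire 0) (wire 2)) (tens (wire 3) (wire 4)) rfl rfl
  have := isDiagram_box (X := W) f (wire 4) (wire 5) rfl rfl
  unfold slot
  exact eq_of_diagram W (tens (tens (wire 0) (wire 1)) (wire 2)) rfl rfl rfl rfl

theorem slot_unit (X Z : C) : slot ((ρ_ X).hom ≫ (λ_ X).inv) Z = (ρ_ _).hom ≫ (λ_ _).inv := by
  unfold slot
  exact eq_of_diagram (objects [X, Z]) (tens (tens (wire 0) (wire 1)) unit) rfl rfl rfl rfl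

set_option synthInstance.maxSize 4000 in
set_option synthInstance.maxHeartbeats 400000 in
/-- Open morphisms on different factors commute, up to the transposition of their framed
objects. -/
theorem seq_slot_swap {X Y A B : C} (φ : X ⊗ A ⟶ A ⊗ X) (φ' : Y ⊗ B ⟶ B ⊗ Y) (Z : C) :
    (X ⊗ (Y ⊗ Z)) ◁ (β_ B A).hom ≫
      seq (slot φ (Y ⊗ Z)) (swapLeft X Y Z ▷ B ≫ slot φ' (X ⊗ Z) ≫ B ◁ swapLeft Y X Z) ≫
      (β_ A B).hom ▷ (X ⊗ (Y ⊗ Z)) =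
    seq (swapLeft X Y Z ▷ B ≫ slot φ' (X ⊗ Z) ≫ B ◁ swapLeft Y X Z) (slot φ (Y ⊗ Z)) := by
  let W := objects [X, Y, Z, B, A, A, X, B, Y]
  have := isDiagram_box (X := W) φ (tens (wire 0) (wire 4)) (tens (wire 5) (wire 6)) rfl rfl
  have := isDiagram_box (X := W) φ' (tens (wire 1) (wire 3)) (tens (wire 7) (wire 8)) rfl rfl
  let s := tens (tens (wire 0) (tens (wire 1) (wire 2))) (tens (wire 3) (wire 4))
  let P : (X ⊗ (Y ⊗ Z)) ⊗ (B ⊗ A) ⟶ Z ⊗ ((X ⊗ A) ⊗ (Y ⊗ B)) :=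
    ((α_ _ _ _).inv ≫ (β_ _ _).hom) ▷ (B ⊗ A) ≫ (α_ _ _ _).hom ≫
      Z ◁ ((X ⊗ Y) ◁ (β_ _ _).hom ≫ tensorμ X Y A B)
  let Q : Z ⊗ ((A ⊗ X) ⊗ (B ⊗ Y)) ⟶ (B ⊗ A) ⊗ (X ⊗ (Y ⊗ Z)) :=
    Z ◁ (tensorμ A X B Y ≫ (β_ _ _).hom ▷ _) ≫ (β_ _ _).hom ≫ (α_ _ _ _).hom ≫
      (B ⊗ A) ◁ (α_ _ _ _).hom
  trans P ≫ Z ◁ (φ ⊗ₘ φ') ≫ Q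
  · unfold seq slot
    exact eq_of_diagram W s rfl rfl rfl rfl
  · rw [MonoidalCategory.tensorHom_def']
    unfold seq slot
    exact eq_of_diagram W s rfl rfl rfl rfl

end Slot

section Operators

variable {K : Type w} [Field K] {C : Type u} [Category.{v} C] [Preadditive C] [Linear K C]
  [MonoidalCategory C] [MonoidalPreadditive C] [MonoidalLinear K C] [SymmetricCategory C] {n : ℕ}

open Functionals

/-- The action of an open morphism `φ : X ⊗ A ⟶ A ⊗ Y` on the first factor of the coefficients. -/
def op (A : Frame C n) {X Y : C} (φ : X ⊗ A.obj ⟶ A.obj ⊗ Y) (Z : C) :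
    Functionals K n (Y ⊗ Z) →ₗ[K] Functionals K n (X ⊗ Z) :=
  tube A (slot φ Z)

theorem map_op_right (A : Frame C n) {X Y : C} (φ : X ⊗ A.obj ⟶ A.obj ⊗ Y) {Z Z' : C}
    (f : Z ⟶ Z') (F : Functionals K n (Y ⊗ Z')) :
    map (X ◁ f) (op A φ Z' F) = op A φ Z (map (Y ◁ f) F) := by
  have h := slot_natural φ f
  exact LinearMap.congr_fun ((map_comp_tube _ A _).trans
    ((congrArg (tube A) h).trans (tube_comp_map A _ _).symm)) F

theorem op_op (A A' : Frame C n) {X Y Y' : C} (φ : X ⊗ A.obj ⟶ A.obj ⊗ Y)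
    (φ' : Y ⊗ A'.obj ⟶ A'.obj ⊗ Y') (Z : C) (F : Functionals K n (Y' ⊗ Z)) :
    op A φ Z (op A' φ' Z F) = op (A.tensor A') (seq φ φ') Z F := by
  have h := seq_slot φ φ' Z
  exact LinearMap.congr_fun ((tube_comp A A' _ _).trans (congrArg (tube (A.tensor A')) h)) F

theorem op_slide {A A' : Frame C n} {f : A.obj ⟶ A'.obj} (hf : Frame.Graded A A' f) {X Y : C}
    (φ : X ⊗ A'.obj ⟶ A.obj ⊗ Y) (Z : C) :
    op (K := K) A (X ◁ f ≫ φ) Z = op A' (φ ≫ f ▷ Y) Z := by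
  unfold op
  rw [whiskerLeft_slot, slot_whiskerRight, tube_slide hf]

theorem map_op_left (A : Frame C n) {X X' Y : C} (f : X ⟶ X') (φ : X' ⊗ A.obj ⟶ A.obj ⊗ Y) (Z : C)
    (F : Functionals K n (Y ⊗ Z)) : map (f ▷ Z) (op A φ Z F) = op A (f ▷ A.obj ≫ φ) Z F := by
  have h := whiskerRight_slot f φ Z
  exact LinearMap.congr_fun ((map_comp_tube _ A _).trans (congrArg (tube A) h)) F

theorem op_map_left (A : Frame C n) {X Y Y' : C} (φ : X ⊗ A.obj ⟶ A.obj ⊗ Y) (f : Y ⟶ Y') (Z : C)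
    (F : Functionals K n (Y' ⊗ Z)) : op A φ Z (map (f ▷ Z) F) = op A (φ ≫ A.obj ◁ f) Z F := by
  have h := slot_whiskerLeft φ f Z
  exact LinearMap.congr_fun ((tube_comp_map A _ _).trans (congrArg (tube A) h)) F

theorem op_one (X Z : C) :
    op (K := K) (Frame.one C n) ((ρ_ X).hom ≫ (λ_ X).inv) Z = LinearMap.id := by
  unfold op
  rw [slot_unit]
  exact tube_one _

variable (K n C) in
/-- Families of operators, which act on the first factor of the coefficients. -/
abbrev Operators : Type (max u v w) := ∀ X Z : C, Module.End K (Functionals K n (X ⊗ Z))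

/-- A family of operators, acting on the second factor of the coefficients. -/
def onSecond (h : Operators K C n) (X Y Z : C) : Module.End K (Functionals K n (X ⊗ (Y ⊗ Z))) :=
  map (swapLeft X Y Z) ∘ₗ h Y (X ⊗ Z) ∘ₗ map (swapLeft Y X Z)

theorem onSecond_apply (h : Operators K C n) (X Y Z : C) (F : Functionals K n (X ⊗ (Y ⊗ Z))) :
    onSecond h X Y Z F = map (swapLeft X Y Z) (h Y (X ⊗ Z) (map (swapLeft Y X Z) F)) := rfl

/-- Families of operators which are natural and compatible with tensor products. They play the role
of elements of the group of which the objects of `C` are the representations. -/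
structure IsPoint (h : Operators K C n) : Prop where
  left : ∀ {X Y : C} (f : X ⟶ Y) (Z : C) (F : Functionals K n (Y ⊗ Z)),
    map (f ▷ Z) (h Y Z F) = h X Z (map (f ▷ Z) F)
  right : ∀ (X : C) {Y Z : C} (f : Y ⟶ Z) (F : Functionals K n (X ⊗ Z)),
    map (X ◁ f) (h X Z F) = h X Y (map (X ◁ f) F)
  unit : ∀ (Z : C) (F : Functionals K n (𝟙_ C ⊗ Z)), h (𝟙_ C) Z F = F
  tensor : ∀ (X Y Z : C) (F : Functionals K n ((X ⊗ Y) ⊗ Z)),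
    h (X ⊗ Y) Z F = map (α_ X Y Z).hom (h X (Y ⊗ Z) (onSecond h X Y Z (map (α_ X Y Z).inv F)))

/-- The two families commute when they act on different factors. -/
def SlotCommute (h k : Operators K C n) : Prop :=
  ∀ (X Y Z : C) (F : Functionals K n (X ⊗ (Y ⊗ Z))),
    h X (Y ⊗ Z) (onSecond k X Y Z F) = onSecond k X Y Z (h X (Y ⊗ Z) F)

/-- The operators of the `i`-th generator: `X` is fed into the place `i`, and what was in this place
comes out. This is the action of the identity of `X ⊗ X`, as an open morphism whose in-end is the
first factor and whose out-end is the second factor. -/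
def gen (i : Fin n) : Operators K C n := fun X Z => op (Frame.single X i) (𝟙 (X ⊗ X)) Z

/-- Open morphisms which act on different factors of the coefficients commute, because the
transposition of their framed objects is graded. -/
theorem op_commute (A B : Frame C n) {X Y : C} (φ : X ⊗ A.obj ⟶ A.obj ⊗ X)
    (φ' : Y ⊗ B.obj ⟶ B.obj ⊗ Y) (Z : C) (F : Functionals K n (X ⊗ (Y ⊗ Z))) :
    op A φ (Y ⊗ Z) (map (swapLeft X Y Z) (op B φ' (X ⊗ Z) (map (swapLeft Y X Z) F))) =
      map (swapLeft X Y Z) (op B φ' (X ⊗ Z) (map (swapLeft Y X Z) (op A φ (Y ⊗ Z) F))) := by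
  have h₁ : map (K := K) (swapLeft X Y Z) ∘ₗ op B φ' (X ⊗ Z) ∘ₗ map (swapLeft Y X Z) =
      tube B (swapLeft X Y Z ▷ B.obj ≫ slot φ' (X ⊗ Z) ≫ B.obj ◁ swapLeft Y X Z) := by
    unfold op
    rw [tube_comp_map, map_comp_tube]
  have h₂ := tube_comp (K := K) A B (slot φ (Y ⊗ Z))
    (swapLeft X Y Z ▷ B.obj ≫ slot φ' (X ⊗ Z) ≫ B.obj ◁ swapLeft Y X Z)
  have h₃ := tube_comp (K := K) B A
    (swapLeft X Y Z ▷ B.obj ≫ slot φ' (X ⊗ Z) ≫ B.obj ◁ swapLeft Y X Z) (slot φ (Y ⊗ Z))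
  have h₄ := seq_slot_swap φ φ' Z
  have h₅ := tube_slide (K := K) (Frame.graded_braid B A) (T' := X ⊗ (Y ⊗ Z))
    ((seq (slot φ (Y ⊗ Z)) (swapLeft X Y Z ▷ B.obj ≫ slot φ' (X ⊗ Z) ≫ B.obj ◁ swapLeft Y X Z)) ≫
      (β_ A.obj B.obj).hom ▷ _)
  rw [h₄, Category.assoc, ← comp_whiskerRight, SymmetricCategory.symmetry,
    MonoidalCategory.id_whiskerRight, Category.comp_id] at h₅
  have h₆ := (h₂.trans h₅.symm).trans h₃.symm
  rw [← h₁] at h₆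
  exact LinearMap.congr_fun h₆ F

theorem gen_slotCommute (i j : Fin n) : SlotCommute (gen (K := K) (C := C) i) (gen j) :=
  fun _ _ Z F => op_commute _ _ _ _ Z F

set_option synthInstance.maxSize 4000 in
set_option synthInstance.maxHeartbeats 400000 in
theorem gen_isPoint (i : Fin n) : IsPoint (gen (K := K) (C := C) i) where
  left {X Y} f Z F := by
    unfold gen
    rw [map_op_left, op_map_left, Category.id_comp]
    have h := op_slide (K := K) (Frame.graded_single f i) (𝟙 (X ⊗ Y)) Z
    rw [Category.comp_id, Category.id_comp] at h
    exact (congrArg (fun g => op (Frame.single Y i) g Z F) (Category.comp_id _)).trans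
      (LinearMap.congr_fun h.symm F)
  right _ {_ _} f F := map_op_right _ _ f F
  unit Z F := by
    have h := op_slide (K := K) (Frame.graded_single_unit (C := C) i) (𝟙 (𝟙_ C ⊗ 𝟙_ C)) Z
    have h' := op_one (K := K) (n := n) (𝟙_ C) Z
    rw [← unitors_equal, Iso.hom_inv_id] at h'
    simp only [MonoidalCategory.whiskerLeft_id, MonoidalCategory.id_whiskerRight,
      Category.comp_id] at h
    unfold gen
    exact (LinearMap.congr_fun h F).trans (LinearMap.congr_fun h' F)
  tensor X Y Z F := by
    have h := op_slide (K := K) (Frame.graded_single_mul X Y i) (𝟙 ((X ⊗ Y) ⊗ (X ⊗ Y))) Z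
    simp only [MonoidalCategory.whiskerLeft_id, MonoidalCategory.id_whiskerRight,
      Category.comp_id] at h
    -- the identity of `(X ⊗ Y) ⊗ (X ⊗ Y)` is the composite of the identities of `X ⊗ X` and `Y ⊗ Y`
    have h₁ : (α_ X Y Z).hom ▷ (X ⊗ Y) ≫ seq (slot (𝟙 (X ⊗ X)) (Y ⊗ Z))
        (swapLeft X Y Z ▷ Y ≫ slot (𝟙 (Y ⊗ Y)) (X ⊗ Z) ≫ Y ◁ (swapLeft Y X Z ≫ (α_ X Y Z).inv)) =
        slot (𝟙 ((X ⊗ Y) ⊗ (X ⊗ Y))) Z := by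
      unfold seq slot
      exact eq_of_diagram (objects [X, Y, Z, X, Y])
        (tens (tens (tens (wire 0) (wire 1)) (wire 2)) (tens (wire 3) (wire 4))) rfl rfl rfl rfl
    have h₂ : map (K := K) (α_ X Y Z).hom ∘ₗ gen i X (Y ⊗ Z) ∘ₗ map (swapLeft X Y Z) ∘ₗ
        gen i Y (X ⊗ Z) ∘ₗ map (swapLeft Y X Z ≫ (α_ X Y Z).inv) =
        tube ((Frame.single X i).tensor (Frame.single Y i)) (slot (𝟙 ((X ⊗ Y) ⊗ (X ⊗ Y))) Z) := by
      rw [← h₁]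
      unfold gen op
      rw [tube_comp_map, map_comp_tube, tube_comp, map_comp_tube]
      rfl
    unfold onSecond
    simp only [LinearMap.comp_apply, map_map]
    exact (LinearMap.congr_fun h.symm F).trans (LinearMap.congr_fun h₂.symm F)

end Operators

/-! ### The group of points -/

section InsDel

variable {C : Type u} [Category.{v} C] [MonoidalCategory C] [SymmetricCategory C] {A D : C}

namespace DualPair

/-- The insertion of a pair of dual objects in front of `Z`. -/
def ins (p : DualPair A D) (Z : C) : Z ⟶ A ⊗ (D ⊗ Z) := (λ_ Z).inv ≫ p.coev ▷ Z ≫ (α_ _ _ _).hom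

/-- The removal of a pair of dual objects in front of `Z`. -/
def del (p : DualPair A D) (Z : C) : A ⊗ (D ⊗ Z) ⟶ Z := (α_ _ _ _).inv ≫ p.ev ▷ Z ≫ (λ_ Z).hom

variable (p : DualPair A D) {Z : C}

theorem swap_swap : p.swap.swap = p := by
  obtain ⟨c, e, _, _⟩ := p
  simp [swap]

theorem ins_natural {Z Z' : C} (f : Z ⟶ Z') : f ≫ p.ins Z' = p.ins Z ≫ A ◁ (D ◁ f) := by
  simp only [ins, Category.assoc]
  rw [leftUnitor_inv_naturality_assoc, whisker_exchange_assoc, ← associator_naturality_right]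

theorem del_natural {Z Z' : C} (f : Z ⟶ Z') : A ◁ (D ◁ f) ≫ p.del Z' = p.del Z ≫ f := by
  simp only [del, Category.assoc]
  rw [← leftUnitor_naturality, ← whisker_exchange_assoc, ← associator_inv_naturality_right_assoc]

theorem swapLeft_del : swapLeft D A Z ≫ p.del Z = p.swap.del Z := by
  simp [swapLeft, del, swap]

theorem ins_swapLeft : p.ins Z ≫ swapLeft A D Z = p.swap.ins Z := by
  simp [swapLeft, ins, swap]

theorem whiskerLeft_ins_del : A ◁ p.swap.ins Z ≫ p.del (A ⊗ Z) = 𝟙 (A ⊗ Z) := by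
  let W := objects [A, Z, D, A]
  have := isDiagram_box (X := W) p.coev unit (tens (wire 3) (wire 2)) rfl rfl
  have := isDiagram_box (X := W) p.ev (tens (wire 0) (wire 2)) unit rfl rfl
  rw [← MonoidalCategory.id_whiskerRight, ← p.zigzag_left]
  unfold ins del swap
  exact eq_of_diagram W (tens (wire 0) (wire 1)) rfl rfl rfl rfl

theorem ins_whiskerLeft_del : p.ins (A ⊗ Z) ≫ A ◁ p.swap.del Z = 𝟙 (A ⊗ Z) := by
  let W := objects [A, Z, D, A]
  have := isDiagram_box (X := W) p.coev unit (tens (wire 3) (wire 2)) rfl rfl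
  have := isDiagram_box (X := W) p.ev (tens (wire 0) (wire 2)) unit rfl rfl
  rw [← MonoidalCategory.id_whiskerRight, ← p.zigzag_left]
  unfold ins del swap
  exact eq_of_diagram W (tens (wire 0) (wire 1)) rfl rfl rfl rfl

end DualPair

theorem swapLeft_swapLeft (X Y Z : C) : swapLeft X Y Z ≫ swapLeft Y X Z = 𝟙 _ :=
  eq_of_diagram (objects [X, Y, Z]) (tens (wire 0) (tens (wire 1) (wire 2))) rfl rfl rfl rfl

end InsDel

section Points

variable {K : Type w} [Field K] {C : Type u} [Category.{v} C] [Preadditive C] [Linear K C]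
  [MonoidalCategory C] [MonoidalPreadditive C] [MonoidalLinear K C] [SymmetricCategory C] {n : ℕ}

open Functionals

theorem onSecond_mul (h k : Operators K C n) (X Y Z : C) (F : Functionals K n (X ⊗ (Y ⊗ Z))) :
    onSecond (h * k) X Y Z F = onSecond h X Y Z (onSecond k X Y Z F) := by
  simp only [onSecond_apply, map_map, swapLeft_swapLeft, map_id_apply]
  rfl

theorem onSecond_one (X Y Z : C) (F : Functionals K n (X ⊗ (Y ⊗ Z))) :
    onSecond 1 X Y Z F = F := by
  change map _ (map _ F) = F
  rw [map_map, swapLeft_swapLeft, map_id_apply]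

theorem mul_apply (h k : Operators K C n) (X Z : C) (F : Functionals K n (X ⊗ Z)) :
    (h * k) X Z F = h X Z (k X Z F) := rfl

namespace IsPoint

variable {h k : Operators K C n}

theorem one : IsPoint (1 : Operators K C n) where
  left _ _ _ := rfl
  right _ _ _ _ _ := rfl
  unit _ _ := rfl
  tensor X Y Z F := by
    rw [onSecond_one]
    change F = map _ (map _ F)
    rw [map_map, Iso.hom_inv_id, map_id_apply]

/-- For the compatibility of `h * k` with tensor products, `k` on the first factor has to be
interchanged with `h` on the second factor. -/
theorem mul (hh : IsPoint h) (hk : IsPoint k) (hc : SlotCommute k h) : IsPoint (h * k) where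
  left f Z F := by rw [mul_apply, hh.left, hk.left]; rfl
  right X _ _ f F := by rw [mul_apply, hh.right, hk.right]; rfl
  unit Z F := by rw [mul_apply, hk.unit, hh.unit]
  tensor X Y Z F := by
    rw [mul_apply, hh.tensor, hk.tensor, map_map, Iso.inv_hom_id, map_id_apply, mul_apply,
      onSecond_mul, hc]

/-- The insertion of a pair of dual objects is invariant under the simultaneous action of a point on
both objects. -/
theorem map_ins (hh : IsPoint h) {A D : C} (p : DualPair A D) (Z : C)
    (F : Functionals K n (A ⊗ (D ⊗ Z))) :
    map (p.ins Z) (h A (D ⊗ Z) (onSecond h A D Z F)) = map (p.ins Z) F := by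
  have h₁ := hh.tensor A D Z (map (α_ A D Z).hom F)
  rw [map_map (α_ A D Z).inv, Iso.inv_hom_id, map_id_apply] at h₁
  unfold DualPair.ins
  rw [← map_map, ← map_map, ← h₁, hh.left, hh.unit, map_map, map_map,
    Category.assoc]

/-- The removal of a pair of dual objects is invariant under the simultaneous action of a point on
both objects. -/
theorem map_del (hh : IsPoint h) {A D : C} (p : DualPair A D) (Z : C) (F : Functionals K n Z) :
    h A (D ⊗ Z) (onSecond h A D Z (map (p.del Z) F)) = map (p.del Z) F := by
  have h₁ := hh.tensor A D Z (map (p.ev ▷ Z ≫ (λ_ Z).hom) F)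
  rw [← map_map, ← hh.left, hh.unit, map_map, map_map] at h₁
  have h₂ := congrArg (Functionals.map (α_ A D Z).inv) h₁
  rw [map_map, map_map, Iso.inv_hom_id, map_id_apply] at h₂
  exact h₂.symm

end IsPoint

theorem SlotCommute.mul_left {h h' k : Operators K C n} (hc : SlotCommute h k)
    (hc' : SlotCommute h' k) : SlotCommute (h * h') k := fun X Y Z F => by
  rw [mul_apply, hc', hc]; rfl

theorem SlotCommute.mul_right {h k k' : Operators K C n} (hc : SlotCommute h k)
    (hc' : SlotCommute h k') : SlotCommute h (k * k') := fun X Y Z F => by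
  rw [onSecond_mul, onSecond_mul, hc, hc']

theorem SlotCommute.one_left (k : Operators K C n) : SlotCommute 1 k := fun _ _ _ _ => rfl

theorem SlotCommute.one_right (h : Operators K C n) : SlotCommute h 1 := fun X Y Z F => by
  rw [onSecond_one, onSecond_one]

theorem inv_mul_apply (h : (Operators K C n)ˣ) (X Z : C) (F : Functionals K n (X ⊗ Z)) :
    h⁻¹.1 X Z (h.1 X Z F) = F :=
  LinearMap.congr_fun (congrFun (congrFun h.inv_mul X) Z) F

theorem mul_inv_apply (h : (Operators K C n)ˣ) (X Z : C) (F : Functionals K n (X ⊗ Z)) :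
    h.1 X Z (h⁻¹.1 X Z F) = F :=
  LinearMap.congr_fun (congrFun (congrFun h.mul_inv X) Z) F

theorem onSecond_inv_mul (h : (Operators K C n)ˣ) (X Y Z : C)
    (F : Functionals K n (X ⊗ (Y ⊗ Z))) : onSecond h⁻¹.1 X Y Z (onSecond h.1 X Y Z F) = F := by
  rw [← onSecond_mul, h.inv_mul, onSecond_one]

theorem onSecond_mul_inv (h : (Operators K C n)ˣ) (X Y Z : C)
    (F : Functionals K n (X ⊗ (Y ⊗ Z))) : onSecond h.1 X Y Z (onSecond h⁻¹.1 X Y Z F) = F := by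
  rw [← onSecond_mul, h.mul_inv, onSecond_one]

theorem SlotCommute.inv_left {h : (Operators K C n)ˣ} {k : Operators K C n}
    (hc : SlotCommute h.1 k) : SlotCommute h⁻¹.1 k := fun X Y Z F => by
  have h₁ := hc X Y Z (h⁻¹.1 X (Y ⊗ Z) F)
  rw [mul_inv_apply] at h₁
  rw [← h₁, inv_mul_apply]

theorem SlotCommute.inv_right {h : Operators K C n} {k : (Operators K C n)ˣ}
    (hc : SlotCommute h k.1) : SlotCommute h k⁻¹.1 := fun X Y Z F => by
  have h₁ := hc X Y Z (onSecond k⁻¹.1 X Y Z F)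
  rw [onSecond_mul_inv] at h₁
  rw [h₁, onSecond_inv_mul]

theorem IsPoint.inv {h : (Operators K C n)ˣ} (hh : IsPoint h.1) (hc : SlotCommute h.1 h.1) :
    IsPoint h⁻¹.1 where
  left f Z F := by
    rw [← inv_mul_apply h _ Z (map (f ▷ Z) (h⁻¹.1 _ Z F)), ← hh.left, mul_inv_apply]
  right X _ _ f F := by
    rw [← inv_mul_apply h X _ (map (X ◁ f) (h⁻¹.1 X _ F)), ← hh.right, mul_inv_apply]
  unit Z F := by
    conv_lhs => rw [← hh.unit Z F]
    rw [inv_mul_apply]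
  tensor X Y Z F := by
    have h₁ := hh.tensor X Y Z
      (map (α_ X Y Z).hom (h⁻¹.1 X (Y ⊗ Z) (onSecond h⁻¹.1 X Y Z (map (α_ X Y Z).inv F))))
    rw [map_map, Iso.inv_hom_id, map_id_apply, ← hc.inv_left, mul_inv_apply, onSecond_mul_inv,
      map_map, Iso.hom_inv_id, map_id_apply] at h₁
    rw [← inv_mul_apply h (X ⊗ Y) Z (map _ _), h₁]

/-- The operator on `X` that is the transpose of the operator `h` on the dual object of `X`. -/
def transpose (h : Operators K C n) {X D : C} (p : DualPair X D) (Z : C) :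
    Module.End K (Functionals K n (X ⊗ Z)) :=
  map (X ◁ p.swap.ins Z ≫ swapLeft X D (X ⊗ Z)) ∘ₗ h D (X ⊗ (X ⊗ Z)) ∘ₗ map (p.swap.del (X ⊗ Z))

theorem transpose_apply (h : Operators K C n) {X D : C} (p : DualPair X D) (Z : C)
    (F : Functionals K n (X ⊗ Z)) : transpose h p Z F =
      map (X ◁ p.swap.ins Z ≫ swapLeft X D (X ⊗ Z))
        (h D (X ⊗ (X ⊗ Z)) (map (p.swap.del (X ⊗ Z)) F)) := rfl

theorem IsPoint.apply_transpose {h : Operators K C n} (hh : IsPoint h) {X D : C}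
    (p : DualPair X D) (Z : C) (F : Functionals K n (X ⊗ Z)) : h X Z (transpose h p Z F) = F := by
  have h₁ := hh.map_del p (X ⊗ Z) F
  rw [onSecond_apply, map_map, p.swapLeft_del] at h₁
  rw [transpose_apply, ← map_map, ← hh.right, h₁, map_map, p.whiskerLeft_ins_del, map_id_apply]

theorem IsPoint.transpose_apply_self {h : Operators K C n} (hh : IsPoint h) {X D : C}
    (p : DualPair X D) (Z : C) (F : Functionals K n (X ⊗ Z)) :
    transpose h p Z (h X Z F) = F := by
  have h₁ : p.swap.del (X ⊗ Z) = D ◁ swapLeft X X Z ≫ swapLeft D X (X ⊗ Z) ≫ X ◁ p.swap.del Z := by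
    let W := objects [D, X, X, Z]
    have := isDiagram_box (X := W) p.ev (tens (wire 1) (wire 0)) WireExpr.unit rfl rfl
    unfold DualPair.del DualPair.swap
    exact eq_of_diagram W (tens (wire 0) (tens (wire 1) (tens (wire 2) (wire 3)))) rfl rfl rfl rfl
  have h₂ : (X ◁ p.swap.ins Z ≫ swapLeft X D (X ⊗ Z)) ≫ D ◁ swapLeft X X Z =
      p.swap.ins (X ⊗ Z) := by
    let W := objects [X, Z, X, D]
    have := isDiagram_box (X := W) p.coev WireExpr.unit (tens (wire 2) (wire 3)) rfl rfl
    unfold DualPair.ins DualPair.swap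
    exact eq_of_diagram W (tens (wire 0) (wire 1)) rfl rfl rfl rfl
  have h₃ := hh.map_ins p.swap (X ⊗ Z) (map (swapLeft D X (X ⊗ Z) ≫ X ◁ p.swap.del Z) F)
  rw [onSecond_apply, map_map (swapLeft X D _), ← Category.assoc, swapLeft_swapLeft,
    Category.id_comp, ← hh.right, map_map, map_map] at h₃
  rw [transpose_apply, h₁, ← map_map (D ◁ swapLeft X X Z), ← hh.right, map_map, h₂, h₃,
    ← Category.assoc, p.swap.ins_swapLeft, p.swap_swap, p.ins_whiskerLeft_del, map_id_apply]

variable [LeftRigidCategory C]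

/-- A point is invertible: its inverse is the transpose of its operator on the dual object. -/
def IsPoint.toUnit {h : Operators K C n} (hh : IsPoint h) : (Operators K C n)ˣ where
  val := h
  inv X Z := transpose h (dualPair X) Z
  val_inv := funext fun _ => funext fun Z => LinearMap.ext fun F => hh.apply_transpose _ Z F
  inv_val := funext fun _ => funext fun Z => LinearMap.ext fun F => hh.transpose_apply_self _ Z F

theorem IsPoint.inv_eq_transpose {h : (Operators K C n)ˣ} (hh : IsPoint h.1) {X D : C}
    (p : DualPair X D) (Z : C) (F : Functionals K n (X ⊗ Z)) :
    h⁻¹.1 X Z F = transpose h.1 p Z F := by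
  rw [← hh.transpose_apply_self p Z (h⁻¹.1 X Z F), mul_inv_apply]

variable (K C n) in
/-- The point that belongs to an element of the free group on the generators. -/
def point : FreeGroup (Fin n) →* (Operators K C n)ˣ :=
  FreeGroup.lift fun i => (gen_isPoint i).toUnit

theorem point_of (i : Fin n) : (point K C n (FreeGroup.of i)).1 = gen i := by
  rw [point, FreeGroup.lift_apply_of]; rfl

theorem point_slotCommute (g g' : FreeGroup (Fin n)) :
    SlotCommute (point K C n g).1 (point K C n g').1 := by
  induction g using FreeGroup.induction_on with
  | C1 => rw [map_one]; exact SlotCommute.one_left _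
  | of i =>
    rw [point_of]
    induction g' using FreeGroup.induction_on with
    | C1 => rw [map_one]; exact SlotCommute.one_right _
    | of j => rw [point_of]; exact gen_slotCommute i j
    | inv_of j ih => rw [map_inv]; exact ih.inv_right
    | mul x y hx hy => rw [map_mul]; exact hx.mul_right hy
  | inv_of i ih => rw [map_inv]; exact ih.inv_left
  | mul x y hx hy => rw [map_mul]; exact hx.mul_left hy

theorem point_isPoint (g : FreeGroup (Fin n)) : IsPoint (point K C n g).1 := by
  induction g using FreeGroup.induction_on with
  | C1 => rw [map_one]; exact IsPoint.one
  | of i => rw [point_of]; exact gen_isPoint i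
  | inv_of i ih => rw [map_inv]; exact ih.inv (point_slotCommute _ _)
  | mul x y hx hy => rw [map_mul]; exact hx.mul hy (point_slotCommute _ _)

end Points

/-! ### The operators of words -/

section WordOperators

variable {K : Type w} [Field K] {C : Type u} [Category.{v} C] [Preadditive C] [Linear K C]
  [MonoidalCategory C] [MonoidalPreadditive C] [MonoidalLinear K C] [SymmetricCategory C] {n : ℕ}

open Functionals

/-- The open morphism `f(b, l)` with `l ≥ 0`, in place `i`, acts as the `l`-th power of the
generator. -/
theorem op_power (b : C) (l : ℕ) (i : Fin n) (Z : C) (F : Functionals K n (b ⊗ Z)) :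
    op (Frame.single (power b l) i) (powerOpen b l) Z F = (gen i ^ l : Operators K C n) b Z F := by
  induction l generalizing F with
  | zero =>
    have h := op_slide (K := K) (Frame.graded_single_unit (C := C) i)
      ((ρ_ b).hom ≫ (λ_ b).inv) Z
    rw [MonoidalCategory.whiskerLeft_id, MonoidalCategory.id_whiskerRight, Category.comp_id,
      Category.id_comp] at h
    exact (LinearMap.congr_fun h F).trans (LinearMap.congr_fun (op_one b Z) F)
  | succ l ih =>
    have h := op_slide (K := K) (Frame.graded_single_mul (power b l) b i) (powerOpen b (l + 1)) Z
    have h₁ : seq (powerOpen b l) (𝟙 (b ⊗ b)) = powerOpen b (l + 1) := by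
      simp [seq, powerOpen]
      rfl
    have h₂ := op_op (Frame.single (power b l) i) (Frame.single b i) (powerOpen b l)
      (𝟙 (b ⊗ b)) Z F
    rw [ih, h₁] at h₂
    refine Eq.trans ?_ h₂.symm
    refine Eq.trans ?_ ((LinearMap.congr_fun h F).symm.trans ?_)
    · congr 2
      exact (congrArg (fun f => powerOpen b (l + 1) ≫ f)
        (MonoidalCategory.id_whiskerRight _ _)).trans (Category.comp_id _) |>.symm
    · congr 2
      exact (congrArg (fun f => f ≫ powerOpen b (l + 1))
        (MonoidalCategory.whiskerLeft_id _ _)).trans (Category.id_comp _)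

variable [LeftRigidCategory C]

set_option synthInstance.maxSize 4000 in
set_option synthInstance.maxHeartbeats 400000 in
/-- The reverse of an open morphism is its transpose. -/
theorem slot_reverse (b : C) {A A' : C} (φ : (ᘁb) ⊗ A ⟶ A' ⊗ (ᘁb)) (Z : C) :
    slot (reverse b φ) Z =
      (b ◁ (dualPair b).swap.ins Z ≫ swapLeft b (ᘁb) (b ⊗ Z)) ▷ A ≫ slot φ (b ⊗ (b ⊗ Z)) ≫
        A' ◁ (dualPair b).swap.del (b ⊗ Z) := by
  let W := objects [b, Z, A, ᘁb, b, A', ᘁb]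
  have := isDiagram_box (X := W) (coform b) unit (tens (wire 3) (wire 4)) rfl rfl
  have := isDiagram_box (X := W) φ (tens (wire 3) (wire 2)) (tens (wire 5) (wire 6)) rfl rfl
  have := isDiagram_box (X := W) (form b) (tens (wire 0) (wire 6)) unit rfl rfl
  unfold slot reverse DualPair.ins DualPair.del dualPair
  simp only [DualPair.swap]
  exact eq_of_diagram W (tens (tens (wire 0) (wire 1)) (wire 2)) rfl rfl rfl rfl

theorem op_reverse (A : Frame C n) (b : C) (φ : (ᘁb) ⊗ A.obj ⟶ A.obj ⊗ (ᘁb)) (Z : C)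
    (F : Functionals K n (b ⊗ Z)) : op A (reverse b φ) Z F =
      map (b ◁ (dualPair b).swap.ins Z ≫ swapLeft b (ᘁb) (b ⊗ Z))
        (op A φ (b ⊗ (b ⊗ Z)) (map ((dualPair b).swap.del (b ⊗ Z)) F)) := by
  have h : op (K := K) A (reverse b φ) Z =
      map (b ◁ (dualPair b).swap.ins Z ≫ swapLeft b (ᘁb) (b ⊗ Z)) ∘ₗ
        op A φ (b ⊗ (b ⊗ Z)) ∘ₗ map ((dualPair b).swap.del (b ⊗ Z)) := by
    unfold op
    rw [slot_reverse, tube_comp_map, map_comp_tube]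
  exact LinearMap.congr_fun h F

/-- The open morphism of a syllable acts as the point of the syllable. For a negative exponent the
reverse is a transpose, which is the inverse of the action. -/
theorem op_syllable (b : C) (l : ℤ) (i : Fin n) (Z : C) (F : Functionals K n (b ⊗ Z)) :
    op (Frame.single (zpower b l) i) (syllableOpen b l) Z F =
      (point K C n (FreeGroup.of i ^ l)).1 b Z F := by
  have key : ∀ l : ℕ, (point K C n (FreeGroup.of i ^ l)).1 = gen i ^ l := fun l => by
    rw [map_pow, Units.val_pow_eq_pow_val, point_of]
  obtain l | l := l
  · refine (op_power b l i Z F).trans ?_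
    rw [Int.ofNat_eq_natCast, zpow_natCast, key]
  · refine (op_reverse (Frame.single (power (ᘁb) (l + 1)) i) b _ Z F).trans ?_
    rw [op_power, zpow_negSucc, map_inv,
      IsPoint.inv_eq_transpose (point_isPoint _) (dualPair b), key]
    rfl

/-- The open morphism of a word acts as the point of the group element that the word spells.
Therefore its action does not depend on the spelling. -/
theorem op_word (b : C) (R : Word n) (Z : C) (F : Functionals K n (b ⊗ Z)) :
    op (Frame.word b R) (wordOpen b R) Z F = (point K C n R.value).1 b Z F := by
  induction R generalizing F with
  | nil =>
    refine (LinearMap.congr_fun (op_one b Z) F).trans ?_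
    rw [Word.value, List.map_nil, List.prod_nil, map_one]
    rfl
  | cons s R ih =>
    have h := op_op (Frame.single (zpower b s.2) s.1) (Frame.word b R) (syllableOpen b s.2)
      (wordOpen b R) Z F
    rw [ih, op_syllable] at h
    refine h.symm.trans ?_
    rw [show Word.value (s :: R) = FreeGroup.of s.1 ^ s.2 * Word.value R from List.prod_cons,
      map_mul]
    rfl

end WordOperators

/-! ### Traces of operators -/

section OperatorTrace

variable {K : Type w} [Field K] {C : Type u} [Category.{v} C] [Preadditive C] [Linear K C]
  [MonoidalCategory C] [MonoidalPreadditive C] [MonoidalLinear K C] [SymmetricCategory C] {n : ℕ}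

open Functionals

/-- The partial trace of an operator over the object `A` with dual `D`. -/
def opTrace {A D : C} (p : DualPair A D) (h : Operators K C n) (Z : C) :
    Module.End K (Functionals K n Z) :=
  map (p.ins Z) ∘ₗ h A (D ⊗ Z) ∘ₗ map (p.del Z)

theorem opTrace_apply {A D : C} (p : DualPair A D) (h : Operators K C n) (Z : C)
    (F : Functionals K n Z) :
    opTrace p h Z F = map (p.ins Z) (h A (D ⊗ Z) (map (p.del Z) F)) := rfl

theorem opTrace_natural {A D : C} (p : DualPair A D) {h : Operators K C n} (hh : IsPoint h)
    {Z Z' : C} (f : Z ⟶ Z') (F : Functionals K n Z') :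
    map f (opTrace p h Z' F) = opTrace p h Z (map f F) := by
  rw [opTrace_apply, opTrace_apply, map_map, p.ins_natural, ← map_map, hh.right, map_map,
    map_map, p.del_natural]

/-- A trace may be taken behind the first factor of the coefficients. -/
theorem opTrace_eq_onSecond {A D : C} (p : DualPair A D) {h : Operators K C n} (hh : IsPoint h)
    (X Z : C) (F : Functionals K n (X ⊗ Z)) : opTrace p h (X ⊗ Z) F =
      map (X ◁ p.ins Z) (onSecond h X A (D ⊗ Z) (map (X ◁ p.del Z) F)) := by
  have h₁ : swapLeft A X (D ⊗ Z) ≫ X ◁ p.del Z = A ◁ swapLeft X D Z ≫ p.del (X ⊗ Z) := by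
    let W := objects [A, X, D, Z]
    have := isDiagram_box (X := W) p.ev (tens (wire 0) (wire 2)) WireExpr.unit rfl rfl
    unfold DualPair.del
    exact eq_of_diagram W (tens (wire 0) (tens (wire 1) (tens (wire 2) (wire 3)))) rfl rfl rfl rfl
  have h₂ : (X ◁ p.ins Z ≫ swapLeft X A (D ⊗ Z)) ≫ A ◁ swapLeft X D Z = p.ins (X ⊗ Z) := by
    let W := objects [X, Z, A, D]
    have := isDiagram_box (X := W) p.coev WireExpr.unit (tens (wire 2) (wire 3)) rfl rfl
    unfold DualPair.ins
    exact eq_of_diagram W (tens (wire 0) (wire 1)) rfl rfl rfl rfl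
  rw [onSecond_apply, map_map (swapLeft A X _), h₁, map_map, ← map_map (A ◁ swapLeft X D Z),
    ← hh.right, map_map, h₂, opTrace_apply]

/-- Operators on the coefficients commute with the traces of other operators. -/
theorem opTrace_commute {A D : C} (p : DualPair A D) {h k : Operators K C n} (hh : IsPoint h)
    (hk : IsPoint k) (hc : SlotCommute k h) (X Z : C) (F : Functionals K n (X ⊗ Z)) :
    opTrace p h (X ⊗ Z) (k X Z F) = k X Z (opTrace p h (X ⊗ Z) F) := by
  rw [opTrace_eq_onSecond p hh, opTrace_eq_onSecond p hh, hk.right, ← hc, ← hk.right]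

/-- The insertion of a scalar loop: the endomorphism `θ` of a framed object, side by side with the
coefficients. -/
def loop (A : Frame C n) (θ : A.obj ⟶ A.obj) (Z : C) : Module.End K (Functionals K n Z) :=
  tube A ((β_ Z A.obj).hom ≫ θ ▷ Z)

variable [LeftRigidCategory C]

/-- The trace is conjugation invariant: the two factors of the conjugation are moved around the
loop, through the dual object, where they cancel. -/
theorem opTrace_conj {A D : C} (p : DualPair A D) (g g' : FreeGroup (Fin n)) (Z : C) :
    opTrace p (point K C n (g * g' * g⁻¹)).1 Z = opTrace p (point K C n g').1 Z := by
  refine LinearMap.ext fun F => ?_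
  rw [map_mul, map_mul, map_inv, opTrace_apply, Units.val_mul, Units.val_mul, mul_apply, mul_apply]
  generalize hG : (point K C n g').1 A (D ⊗ Z)
    ((point K C n g)⁻¹.1 A (D ⊗ Z) (map (p.del Z) F)) = G
  have h₁ := (point_isPoint (K := K) (C := C) g).map_ins p Z
    (onSecond (point K C n g)⁻¹.1 A D Z G)
  have h₂ := (point_isPoint (K := K) (C := C) g⁻¹).map_del p Z F
  have hc := point_slotCommute (K := K) (C := C) g' g⁻¹
  have hc' := point_slotCommute (K := K) (C := C) g⁻¹ g⁻¹
  rw [onSecond_mul_inv] at h₁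
  rw [map_inv] at h₂ hc hc'
  rw [h₁, ← hG, ← hc, ← hc', h₂, opTrace_apply]

/-- The trace over the dual object is the trace of the inverse. -/
theorem opTrace_swap {A D : C} (p : DualPair A D) (g : FreeGroup (Fin n)) (Z : C) :
    opTrace p.swap (point K C n g).1 Z = opTrace p (point K C n g⁻¹).1 Z := by
  refine LinearMap.ext fun F => ?_
  have h₁ := (point_isPoint (K := K) (C := C) g).map_ins p Z
    ((point K C n g)⁻¹.1 A (D ⊗ Z) (map (p.del Z) F))
  rw [point_slotCommute g g, mul_inv_apply, onSecond_apply, map_map, map_map, p.ins_swapLeft,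
    p.swapLeft_del] at h₁
  rw [opTrace_apply, h₁, map_inv, opTrace_apply]

set_option synthInstance.maxSize 4000 in
set_option synthInstance.maxHeartbeats 400000 in
theorem closeUp_diagram [Stable C] (b : C) {A : C} (φ : b ⊗ A ⟶ A ⊗ b) (Z : C) :
    (dualPair b).ins Z ▷ A ≫ slot φ ((ᘁb) ⊗ Z) ≫ A ◁ (dualPair b).del Z =
      (β_ Z A).hom ≫ closeUp b φ ▷ Z := by
  let W := objects [Z, A, ᘁb, b, A, b]
  have := isDiagram_box (X := W) (coform b) WireExpr.unit (tens (wire 2) (wire 3)) rfl rfl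
  have := isDiagram_box (X := W) φ (tens (wire 3) (wire 1)) (tens (wire 4) (wire 5)) rfl rfl
  have := isDiagram_box (X := W) (form b) (tens (wire 5) (wire 2)) WireExpr.unit rfl rfl
  unfold slot closeUp DualPair.ins DualPair.del dualPair
  rw [dualForm_eq]
  exact eq_of_diagram W (tens (wire 0) (wire 1)) rfl rfl rfl rfl

/-- The closure of an open morphism acts as the trace of the operator of the open morphism. -/
theorem opTrace_word [Stable C] (b : C) (R : Word n) (Z : C) :
    opTrace (dualPair b) (point K C n R.value).1 Z =
      loop (Frame.word b R) (closeUp b (wordOpen b R)) Z := by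
  have h : map (K := K) ((dualPair b).ins Z) ∘ₗ op (Frame.word b R) (wordOpen b R) ((ᘁb) ⊗ Z) ∘ₗ
      map ((dualPair b).del Z) = loop (Frame.word b R) (closeUp b (wordOpen b R)) Z := by
    unfold op loop
    rw [tube_comp_map, map_comp_tube, closeUp_diagram]
  rw [← h]
  refine LinearMap.ext fun F => ?_
  rw [opTrace_apply, ← op_word]
  rfl

end OperatorTrace

/-! ### Semisimplicity -/

section Rotation

variable {C : Type u} [Category.{v} C] [MonoidalCategory C] [SymmetricCategory C] {A D : C}

namespace DualPair

variable (p : DualPair A D)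

/-- The morphism `A ⟶ X` that corresponds to a morphism `𝟙 ⟶ A* ⊗ X`. -/
def rotIn {X : C} (ε : 𝟙_ C ⟶ D ⊗ X) : A ⟶ X := (ρ_ A).inv ≫ A ◁ ε ≫ p.del X

/-- The morphism `X ⟶ A` that corresponds to a morphism `A* ⊗ X ⟶ 𝟙`. -/
def rotOut {X : C} (ω : D ⊗ X ⟶ 𝟙_ C) : X ⟶ A := p.ins X ≫ A ◁ ω ≫ (ρ_ A).hom

/-- The trace of an endomorphism. -/
def trace (f : A ⟶ A) : 𝟙_ C ⟶ 𝟙_ C := p.swap.coev ≫ D ◁ f ≫ p.swap.ev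

theorem rotIn_coev {X : C} (f : A ⟶ X) : p.rotIn (p.swap.coev ≫ D ◁ f) = f := by
  let W := objects [A, A, D, X]
  have := isDiagram_box (X := W) p.coev unit (tens (wire 1) (wire 2)) rfl rfl
  have := isDiagram_box (X := W) p.ev (tens (wire 0) (wire 2)) unit rfl rfl
  have := isDiagram_box (X := W) f (wire 1) (wire 3) rfl rfl
  trans ((λ_ A).inv ≫ p.coev ▷ A ≫ (α_ _ _ _).hom ≫ A ◁ (β_ D A).hom ≫ A ◁ p.ev ≫
    (ρ_ A).hom) ≫ f
  · have h : p.coev ▷ A ≫ (α_ _ _ _).hom ≫ (f ⊗ₘ ((β_ D A).hom ≫ p.ev)) =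
      p.coev ▷ A ≫ (α_ _ _ _).hom ≫ A ◁ ((β_ D A).hom ≫ p.ev) ≫ f ▷ (𝟙_ C) := by
      rw [MonoidalCategory.tensorHom_def']
    trans (λ_ A).inv ≫ (p.coev ▷ A ≫ (α_ _ _ _).hom ≫ (f ⊗ₘ ((β_ D A).hom ≫ p.ev))) ≫ (ρ_ X).hom
    · rw [MonoidalCategory.tensorHom_def]
      unfold rotIn del swap
      exact eq_of_diagram W (wire 0) rfl rfl rfl rfl
    · rw [h]
      exact eq_of_diagram W (wire 0) rfl rfl rfl rfl
  · rw [p.zigzag_left, Category.id_comp]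

theorem coev_rotIn {X : C} (ε : 𝟙_ C ⟶ D ⊗ X) : p.swap.coev ≫ D ◁ p.rotIn ε = ε := by
  let W := objects [A, D, D, X]
  have := isDiagram_box (X := W) p.coev unit (tens (wire 0) (wire 1)) rfl rfl
  have := isDiagram_box (X := W) ε unit (tens (wire 2) (wire 3)) rfl rfl
  have := isDiagram_box (X := W) p.ev (tens (wire 0) (wire 2)) unit rfl rfl
  trans ε ≫ ((ρ_ D).inv ≫ D ◁ p.coev ≫ (α_ _ _ _).inv ≫ (β_ D A).hom ▷ D ≫ p.ev ▷ D ≫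
    (λ_ D).hom) ▷ X
  · trans (λ_ _).inv ≫ (p.coev ⊗ₘ ε) ≫ (β_ A D).hom ▷ (D ⊗ X) ≫ (α_ _ _ _).hom ≫ D ◁ p.del X
    · rw [MonoidalCategory.tensorHom_def]
      unfold rotIn del swap
      exact eq_of_diagram W unit rfl rfl rfl rfl
    · rw [MonoidalCategory.tensorHom_def']
      unfold del
      exact eq_of_diagram W unit rfl rfl rfl rfl
  · rw [p.zigzag_right, MonoidalCategory.id_whiskerRight, Category.comp_id]

theorem rotOut_ev {X : C} (ω : D ⊗ X ⟶ 𝟙_ C) : D ◁ p.rotOut ω ≫ p.swap.ev = ω := by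
  let W := objects [D, X, A, D]
  have := isDiagram_box (X := W) p.coev unit (tens (wire 2) (wire 3)) rfl rfl
  have := isDiagram_box (X := W) ω (tens (wire 3) (wire 1)) unit rfl rfl
  have := isDiagram_box (X := W) p.ev (tens (wire 2) (wire 0)) unit rfl rfl
  trans ((ρ_ D).inv ≫ D ◁ p.coev ≫ (α_ _ _ _).inv ≫ (β_ D A).hom ▷ D ≫ p.ev ▷ D ≫
    (λ_ D).hom) ▷ X ≫ ω
  · trans D ◁ p.ins X ≫ (α_ _ _ _).inv ≫ (β_ _ _).hom ▷ _ ≫ (p.ev ⊗ₘ ω) ≫ (λ_ _).hom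
    · rw [MonoidalCategory.tensorHom_def']
      unfold rotOut ins swap
      exact eq_of_diagram W (tens (wire 0) (wire 1)) rfl rfl rfl rfl
    · rw [MonoidalCategory.tensorHom_def]
      unfold ins
      exact eq_of_diagram W (tens (wire 0) (wire 1)) rfl rfl rfl rfl
  · rw [p.zigzag_right, MonoidalCategory.id_whiskerRight, Category.id_comp]

theorem trace_rotIn_rotOut {X : C} (ε : 𝟙_ C ⟶ D ⊗ X) (ω : D ⊗ X ⟶ 𝟙_ C) :
    p.trace (p.rotIn ε ≫ p.rotOut ω) = ε ≫ ω := by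
  rw [trace, MonoidalCategory.whiskerLeft_comp, Category.assoc, p.rotOut_ev, ← Category.assoc,
    p.coev_rotIn]

end DualPair

theorem trace_dualPair [LeftRigidCategory C] [Stable C] {b : C} (f : b ⟶ b) :
    (dualPair b).trace f = rank f := by
  rw [DualPair.trace, rank, dualForm_eq]
  simp [DualPair.swap, dualPair]

end Rotation

section Semisimple

variable {K : Type w} [Field K] {C : Type u} [Category.{v} C] [Abelian C] [Linear K C]

/-- Dual bases are transported along isomorphisms. -/
def DualBases.congr {a A B : C} (d : DualBases K a A) (e : A ≅ B) : DualBases K a B where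
  size := d.size
  basis := d.basis.map (Linear.homCongr K (Iso.refl a) e)
  dual := d.dual.map (Linear.homCongr K e (Iso.refl a))
  comp_eq i j := by simp [Linear.homCongr, d.comp_eq]

theorem DualBases.congr_basis {a A B : C} (d : DualBases K a A) (e : A ≅ B) (i : Fin d.size) :
    (d.congr e).basis i = d.basis i ≫ e.hom := by
  refine (Module.Basis.map_apply _ _ _).trans ?_
  rw [Linear.homCongr_apply]
  simp only [Iso.refl_inv, Category.id_comp]
  rfl

theorem DualBases.congr_dual {a A B : C} (d : DualBases K a A) (e : A ≅ B) (i : Fin d.size) :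
    (d.congr e).dual i = e.inv ≫ d.dual i := by
  refine (Module.Basis.map_apply _ _ _).trans ?_
  rw [Linear.homCongr_apply]
  simp only [Iso.refl_hom, Category.comp_id]
  rfl

attribute [local instance] Abelian.hasFiniteBiproducts

variable [MonoidalCategory C] (S : Semisimple K C)

namespace Semisimple

theorem scalar_eq {f : 𝟙_ C ⟶ 𝟙_ C} {c : K} (h : f = c • 𝟙 (𝟙_ C)) : S.scalar f = c :=
  (S.existsUnique_scalar S.unit_mem f).unique (S.scalar_spec f) h

theorem smul_id_injective {a : C} (ha : a ∈ S.simples) {c c' : K} (h : c • 𝟙 a = c' • 𝟙 a) :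
    c = c' :=
  (S.existsUnique_scalar ha (c • 𝟙 a)).unique rfl h

theorem scalar_smul (c : K) (f : 𝟙_ C ⟶ 𝟙_ C) : S.scalar (c • f) = c * S.scalar f :=
  S.scalar_eq (by conv_lhs => rw [S.scalar_spec f, smul_smul])

theorem scalar_add (f g : 𝟙_ C ⟶ 𝟙_ C) : S.scalar (f + g) = S.scalar f + S.scalar g :=
  S.scalar_eq (by conv_lhs => rw [S.scalar_spec f, S.scalar_spec g, ← add_smul])

/-- Endomorphisms are detected by the morphisms from simple objects. -/
theorem eq_id_of_simple {A : C} (T : A ⟶ A)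
    (h : ∀ (c : S.simples) (f : c.1 ⟶ A), f ≫ T = f) : T = 𝟙 A := by
  obtain ⟨n, f, hf, ⟨e⟩⟩ := S.decomposition A
  have h₁ : e.inv ≫ T = e.inv := by
    refine Limits.biproduct.hom_ext' _ _ fun i => ?_
    have := h ⟨f i, hf i⟩ (Limits.biproduct.ι f i ≫ e.inv)
    rwa [Category.assoc] at this
  rw [← e.hom_inv_id, ← h₁, Iso.hom_inv_id_assoc]

variable [SymmetricCategory C] [LeftRigidCategory C] [Stable C] [MonoidalPreadditive C]
  [MonoidalLinear K C]

/-- The rank of an object. -/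
def dim (b : C) : K := S.scalar (rank (𝟙 b))

/-- By semisimplicity the composite of `rotIn` and `rotOut` is a scalar multiple of the identity of
`c`, and the trace identifies the scalar. In particular the rank of `c` is invertible if the bases
are nonempty. -/
theorem dim_smul_comp {A : C} (d : ∀ c : S.simples, DualBases K (𝟙_ C) ((ᘁc.1) ⊗ A))
    (c : S.simples) (i j : Fin (d c).size) :
    S.dim c.1 • ((dualPair c.1).rotIn ((d c).basis i) ≫ (dualPair c.1).rotOut ((d c).dual j)) =
      if i = j then 𝟙 c.1 else 0 := by
  obtain ⟨s, hs, -⟩ := S.existsUnique_scalar c.2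
    ((dualPair c.1).rotIn ((d c).basis i) ≫ (dualPair c.1).rotOut ((d c).dual j))
  have h := (dualPair c.1).trace_rotIn_rotOut ((d c).basis i) ((d c).dual j)
  rw [hs, (d c).comp_eq, DualPair.trace, MonoidalLinear.whiskerLeft_smul, Linear.smul_comp,
    Linear.comp_smul] at h
  change s • (dualPair c.1).trace (𝟙 c.1) = _ at h
  rw [trace_dualPair, S.scalar_spec (rank _), smul_smul] at h
  rw [hs, smul_smul, mul_comm]
  change (s * S.dim c.1) • _ = _ at h
  by_cases hij : i = j
  · subst hij
    rw [if_pos rfl] at h ⊢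
    rw [S.smul_id_injective S.unit_mem (h.trans (one_smul K _).symm), one_smul]
  · rw [if_neg (Ne.symm hij)] at h
    rw [if_neg hij, S.smul_id_injective S.unit_mem (h.trans (zero_smul K _).symm), zero_smul]

/-- The fusion identity: the identity of an object is the sum, with ranks as coefficients, of
composites through simple objects, which are given by dual bases. -/
theorem sum_dim_smul_rot {A : C} (d : ∀ c : S.simples, DualBases K (𝟙_ C) ((ᘁc.1) ⊗ A)) :
    ∑ c : S.simples, ∑ i, S.dim c.1 •
      ((dualPair c.1).rotOut ((d c).dual i) ≫ (dualPair c.1).rotIn ((d c).basis i)) = 𝟙 A := by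
  refine S.eq_id_of_simple _ fun c f => ?_
  have key : ∀ j, (dualPair c.1).rotIn ((d c).basis j) ≫ (∑ c : S.simples, ∑ i, S.dim c.1 •
      ((dualPair c.1).rotOut ((d c).dual i) ≫ (dualPair c.1).rotIn ((d c).basis i))) =
      (dualPair c.1).rotIn ((d c).basis j) := by
    intro j
    rw [Preadditive.comp_sum, Finset.sum_eq_single c]
    · rw [Preadditive.comp_sum, Finset.sum_eq_single j]
      · rw [Linear.comp_smul, ← Category.assoc, ← Linear.smul_comp, S.dim_smul_comp, if_pos rfl,
          Category.id_comp]
      · intro i _ hi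
        rw [Linear.comp_smul, ← Category.assoc, ← Linear.smul_comp, S.dim_smul_comp,
          if_neg hi.symm, Limits.zero_comp]
      · exact fun h => absurd (Finset.mem_univ _) h
    · intro c' _ hc
      rw [Preadditive.comp_sum]
      refine Finset.sum_eq_zero fun i _ => ?_
      rw [Linear.comp_smul, ← Category.assoc, S.hom_eq_zero c.1 c.2 c'.1 c'.2
        (fun h => hc (Subtype.ext h.symm)) (_ ≫ (dualPair c'.1).rotOut _), Limits.zero_comp,
        smul_zero]
    · exact fun h => absurd (Finset.mem_univ _) h
  -- every morphism from `c` is a linear combination of the rotated basis morphisms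
  have hf := (dualPair c.1).rotIn_coev f
  rw [← (d c).basis.sum_repr ((dualPair c.1).swap.coev ≫ _ ◁ f)] at hf
  generalize ((d c).basis.repr ((dualPair c.1).swap.coev ≫ _ ◁ f)) = x at hf
  have h₁ : ∑ j, x j • (dualPair c.1).rotIn ((d c).basis j) = f := by
    rw [← hf]
    simp only [DualPair.rotIn, Preadditive.sum_comp, Preadditive.comp_sum,
      whiskerLeft_sum, MonoidalLinear.whiskerLeft_smul, Linear.smul_comp, Linear.comp_smul]
  conv_lhs => rw [← h₁]
  rw [Preadditive.sum_comp]
  conv_rhs => rw [← h₁]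
  exact Finset.sum_congr rfl fun j _ => by rw [Linear.smul_comp, key]

end Semisimple

end Semisimple

/-! ### The operators of relators -/

section Sliding

variable {C : Type u} [Category.{v} C] [MonoidalCategory C] [SymmetricCategory C] {b b' c c' : C}
  (p : DualPair b b') (q : DualPair c c') (X Z : C)

/-- The permutation that brings two dual pairs together. -/
def pairUp : ((b ⊗ b') ⊗ (c ⊗ c')) ⊗ (X ⊗ Z) ⟶ (c' ⊗ (b' ⊗ X)) ⊗ (c ⊗ (b ⊗ Z)) :=
  (tensorμ b b' c c' ≫ (β_ _ _).hom) ▷ (X ⊗ Z) ≫ tensorμ _ _ _ _ ≫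
    (((β_ b' c').hom ▷ X ≫ (α_ _ _ _).hom) ⊗ₘ ((β_ b c).hom ▷ Z ≫ (α_ _ _ _).hom))

/-- The inverse permutation. -/
def pairDown : (c' ⊗ (b' ⊗ X)) ⊗ (c ⊗ (b ⊗ Z)) ⟶ ((b ⊗ b') ⊗ (c ⊗ c')) ⊗ (X ⊗ Z) :=
  (((α_ _ _ _).inv ≫ (β_ c' b').hom ▷ X) ⊗ₘ ((α_ _ _ _).inv ≫ (β_ c b).hom ▷ Z)) ≫
    tensorμ _ _ _ _ ≫ ((β_ _ _).hom ≫ tensorμ b c b' c') ▷ (X ⊗ Z)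

set_option synthInstance.maxSize 4000 in
set_option synthInstance.maxHeartbeats 400000 in
/-- Both sides are the insertion of `b` and `c` with their dual objects, followed by `ω`. -/
theorem ins_rotOut {X : C} (ω : c' ⊗ (b' ⊗ X) ⟶ 𝟙_ C) (Z : C) :
    (p.swap.ins (X ⊗ Z) ≫ b' ◁ swapLeft b X Z ≫ (α_ _ _ _).inv) ≫ q.rotOut ω ▷ (b ⊗ Z) =
      q.ins (X ⊗ Z) ≫ c ◁ ((α_ _ _ _).inv ≫ p.rotOut (swapLeft b' c' X ≫ ω) ▷ Z) := by
  let W := objects [X, Z, b, b', c, c']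
  have := isDiagram_box (X := W) p.coev unit (tens (wire 2) (wire 3)) rfl rfl
  have := isDiagram_box (X := W) q.coev unit (tens (wire 4) (wire 5)) rfl rfl
  have := isDiagram_box (X := W) ω (tens (wire 5) (tens (wire 3) (wire 0))) unit rfl rfl
  trans ((λ_ _).inv ≫ (λ_ (𝟙_ C)).inv ▷ _) ≫ (p.coev ⊗ₘ q.coev) ▷ (X ⊗ Z) ≫ pairUp X Z ≫
    ω ▷ (c ⊗ (b ⊗ Z)) ≫ (λ_ _).hom
  · rw [MonoidalCategory.tensorHom_def]
    unfold pairUp DualPair.rotOut DualPair.ins DualPair.swap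
    exact eq_of_diagram W (tens (wire 0) (wire 1)) rfl rfl rfl rfl
  · rw [MonoidalCategory.tensorHom_def']
    unfold pairUp DualPair.rotOut DualPair.ins
    exact eq_of_diagram W (tens (wire 0) (wire 1)) rfl rfl rfl rfl

set_option synthInstance.maxSize 4000 in
set_option synthInstance.maxHeartbeats 400000 in
/-- Both sides are `ε`, followed by the removal of `b` and `c` with their dual objects. -/
theorem rotIn_del {X : C} (ε : 𝟙_ C ⟶ c' ⊗ (b' ⊗ X)) (Z : C) :
    q.rotIn ε ▷ (b ⊗ Z) ≫ (α_ _ _ _).hom ≫ b' ◁ swapLeft X b Z ≫ p.swap.del (X ⊗ Z) =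
      c ◁ (p.rotIn (ε ≫ swapLeft c' b' X) ▷ Z ≫ (α_ _ _ _).hom) ≫ q.del (X ⊗ Z) := by
  let W := objects [c, b, Z, c', b', X]
  have := isDiagram_box (X := W) ε unit (tens (wire 3) (tens (wire 4) (wire 5))) rfl rfl
  have := isDiagram_box (X := W) p.ev (tens (wire 1) (wire 4)) unit rfl rfl
  have := isDiagram_box (X := W) q.ev (tens (wire 0) (wire 3)) unit rfl rfl
  trans (λ_ _).inv ≫ ε ▷ (c ⊗ (b ⊗ Z)) ≫ pairDown X Z ≫ (p.ev ⊗ₘ q.ev) ▷ (X ⊗ Z) ≫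
    (λ_ (𝟙_ C)).hom ▷ _ ≫ (λ_ _).hom
  · rw [MonoidalCategory.tensorHom_def']
    unfold pairDown DualPair.rotIn DualPair.del DualPair.swap
    exact eq_of_diagram W (tens (wire 0) (tens (wire 1) (wire 2))) rfl rfl rfl rfl
  · rw [MonoidalCategory.tensorHom_def]
    unfold pairDown DualPair.rotIn DualPair.del
    exact eq_of_diagram W (tens (wire 0) (tens (wire 1) (wire 2))) rfl rfl rfl rfl

theorem swapLeft_whiskerLeft_del :
    b' ◁ swapLeft X b Z ≫ p.swap.del (X ⊗ Z) = swapLeft b' X (b ⊗ Z) ≫ X ◁ p.swap.del Z := by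
  let W := objects [b', X, b, Z]
  have := isDiagram_box (X := W) p.ev (tens (wire 2) (wire 0)) unit rfl rfl
  unfold DualPair.del DualPair.swap
  exact eq_of_diagram W (tens (wire 0) (tens (wire 1) (tens (wire 2) (wire 3)))) rfl rfl rfl rfl

/-- The transposition of the first two factors, as an isomorphism. -/
def swapLeftIso (X Y Z : C) : X ⊗ (Y ⊗ Z) ≅ Y ⊗ (X ⊗ Z) where
  hom := swapLeft X Y Z
  inv := swapLeft Y X Z
  hom_inv_id := swapLeft_swapLeft X Y Z
  inv_hom_id := swapLeft_swapLeft Y X Z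

end Sliding

section Fuse

variable {K : Type w} [Field K] {C : Type u} [Category.{v} C] [Preadditive C] [Linear K C]
  [MonoidalCategory C] [MonoidalPreadditive C] [MonoidalLinear K C] [SymmetricCategory C] {n : ℕ}

open Functionals

/-- An operator next to a trace is absorbed into the trace. -/
theorem opTrace_swap_apply {h : Operators K C n} (hh : IsPoint h) {b b' : C} (p : DualPair b b')
    (X Z : C) (F : Functionals K n (X ⊗ Z)) : opTrace p.swap h (X ⊗ Z) (h X Z F) =
      map (p.swap.ins (X ⊗ Z) ≫ b' ◁ swapLeft b X Z ≫ (α_ _ _ _).inv) (h (b' ⊗ X) (b ⊗ Z)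
        (map ((α_ _ _ _).hom ≫ b' ◁ swapLeft X b Z ≫ p.swap.del (X ⊗ Z)) F)) := by
  have h₁ : p.swap.del (X ⊗ Z) =
      b' ◁ swapLeft b X Z ≫ swapLeft b' X (b ⊗ Z) ≫ X ◁ p.swap.del Z := by
    rw [← swapLeft_whiskerLeft_del, ← Category.assoc, ← MonoidalCategory.whiskerLeft_comp,
      swapLeft_swapLeft, MonoidalCategory.whiskerLeft_id, Category.id_comp]
  rw [hh.tensor, onSecond_apply, map_map, map_map, map_map,
    Category.assoc (swapLeft X b' _), Iso.inv_hom_id_assoc, swapLeft_whiskerLeft_del,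
    ← Category.assoc (swapLeft X b' _), swapLeft_swapLeft, Category.id_comp,
    ← hh.right X (p.swap.del Z), map_map]
  rw [opTrace_apply]
  conv_lhs => rw [h₁]
  rw [← map_map (b' ◁ swapLeft b X Z), ← hh.right, map_map]
  congr 2
  simp

end Fuse

section Delta

variable {K : Type w} [Field K] {C : Type u} [Category.{v} C] [Abelian C] [Linear K C]
  [MonoidalCategory C] [MonoidalPreadditive C] [MonoidalLinear K C] [SymmetricCategory C]
  [LeftRigidCategory C] [Stable C] (S : Semisimple K C) {n : ℕ}

open Functionals

/-- The operator that a point contributes as a relator: the sum of the traces over all simple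
objects, with their ranks as coefficients. If the objects of `C` are regarded as the representations
of a finite group, then this is the delta function of the identity, times the order of the group,
evaluated on the point. -/
def delta (h : Operators K C n) (Z : C) : Module.End K (Functionals K n Z) :=
  ∑ b : S.simples, S.dim b.1 • opTrace (dualPair b.1) h Z

theorem delta_apply (h : Operators K C n) (Z : C) (F : Functionals K n Z) :
    delta S h Z F = ∑ b : S.simples, S.dim b.1 • opTrace (dualPair b.1) h Z F := by
  simp [delta]

/-- The fusion identity for an object of coefficients, next to a factor `Y`. -/
theorem sum_map_rotOut {A : C} (d : ∀ c : S.simples, DualBases K (𝟙_ C) ((ᘁc.1) ⊗ A)) (Y : C)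
    (G : Functionals K n (A ⊗ Y)) : ∑ c : S.simples, ∑ i, S.dim c.1 •
      map ((dualPair c.1).rotOut ((d c).dual i) ▷ Y)
        (map ((dualPair c.1).rotIn ((d c).basis i) ▷ Y) G) = G := by
  have h := congrArg (fun f => map (K := K) (n := n) (f ▷ Y) G) (S.sum_dim_smul_rot d)
  simp only [MonoidalCategory.id_whiskerRight, map_id_apply, sum_whiskerRight,
    MonoidalLinear.smul_whiskerRight, Functionals.map_sum, Functionals.map_smul,
    LinearMap.sum_apply, LinearMap.smul_apply,
    comp_whiskerRight] at h
  simpa only [map_map] using h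

/-- The fusion identity for an object of coefficients behind a factor `D`. -/
theorem sum_map_rotOut_right {A : C} (d : ∀ c : S.simples, DualBases K (𝟙_ C) ((ᘁc.1) ⊗ A))
    {D E Z : C} (e : E ≅ A ⊗ Z)
    (G : Functionals K n (D ⊗ E)) : ∑ c : S.simples, ∑ i, S.dim c.1 •
      map (D ◁ (e.hom ≫ (dualPair c.1).rotOut ((d c).dual i) ▷ Z))
        (map (D ◁ ((dualPair c.1).rotIn ((d c).basis i) ▷ Z ≫ e.inv)) G) = G := by
  have h := congrArg (fun f => map (K := K) (n := n) (D ◁ (e.hom ≫ f ▷ Z ≫ e.inv)) G)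
    (S.sum_dim_smul_rot d)
  simp only [MonoidalCategory.id_whiskerRight, map_id_apply, sum_whiskerRight,
    MonoidalLinear.smul_whiskerRight, Functionals.map_sum, Functionals.map_smul,
    LinearMap.sum_apply, LinearMap.smul_apply,
    comp_whiskerRight, Category.id_comp, Iso.hom_inv_id, MonoidalCategory.whiskerLeft_id,
    Preadditive.sum_comp, Preadditive.comp_sum, whiskerLeft_sum, Linear.smul_comp,
    Linear.comp_smul, MonoidalLinear.whiskerLeft_smul] at h
  simpa only [map_map, MonoidalCategory.whiskerLeft_comp, Category.assoc] using h

/-- Sliding an operator over the loops of a relator turns the loops around. On both sides the fusion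
identity is applied, on the left to `b* ⊗ X` and on the right to `c* ⊗ X`; after this, the sums over
`b` and `c` agree term by term. -/
theorem sum_opTrace_swap_apply {h : Operators K C n} (hh : IsPoint h) (X Z : C)
    (F : Functionals K n (X ⊗ Z)) :
    ∑ b : S.simples, S.dim b.1 • opTrace (dualPair b.1).swap h (X ⊗ Z) (h X Z F) =
      delta S h (X ⊗ Z) F := by
  let d : ∀ b c : S.simples, DualBases K (𝟙_ C) ((ᘁc.1) ⊗ ((ᘁb.1) ⊗ X)) := fun b c =>
    S.dualBases S.unit_mem _
  let d' : ∀ c b : S.simples, DualBases K (𝟙_ C) ((ᘁb.1) ⊗ ((ᘁc.1) ⊗ X)) := fun c b =>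
    (d b c).congr (swapLeftIso _ _ _)
  -- an operator on `b* ⊗ X` is expanded in operators on simple objects `c`
  have h₁ : ∀ b : S.simples, opTrace (dualPair b.1).swap h (X ⊗ Z) (h X Z F) =
      ∑ c : S.simples, ∑ i, S.dim c.1 •
        map ((dualPair b.1).swap.ins (X ⊗ Z) ≫ _ ◁ swapLeft b.1 X Z ≫ (α_ _ _ _).inv)
          (map ((dualPair c.1).rotOut ((d b c).dual i) ▷ (b.1 ⊗ Z)) (h c.1 (b.1 ⊗ Z)
            (map ((dualPair c.1).rotIn ((d b c).basis i) ▷ (b.1 ⊗ Z)) (map ((α_ _ _ _).hom ≫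
              _ ◁ swapLeft X b.1 Z ≫ (dualPair b.1).swap.del (X ⊗ Z)) F)))) := by
    intro b
    rw [opTrace_swap_apply hh, ← sum_map_rotOut S (d b) (b.1 ⊗ Z) (h _ _ _)]
    simp only [_root_.map_sum, _root_.map_smul, hh.left]
  -- the identity of `c* ⊗ X`, behind the operator on `c`, is expanded in simple objects `b`
  have h₂ : ∀ c : S.simples, opTrace (dualPair c.1) h (X ⊗ Z) F =
      ∑ b : S.simples, ∑ i, S.dim b.1 •
        map ((dualPair c.1).ins (X ⊗ Z)) (map (c.1 ◁ ((α_ _ _ _).inv ≫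
          (dualPair b.1).rotOut ((d' c b).dual i) ▷ Z)) (h c.1 (b.1 ⊗ Z)
            (map (c.1 ◁ ((dualPair b.1).rotIn ((d' c b).basis i) ▷ Z ≫ (α_ _ _ _).hom))
              (map ((dualPair c.1).del (X ⊗ Z)) F)))) := by
    intro c
    rw [opTrace_apply, ← sum_map_rotOut_right S (d' c) (α_ (ᘁc.1) X Z).symm (h _ _ _)]
    simp only [_root_.map_sum, _root_.map_smul, hh.right, Iso.symm_hom, Iso.symm_inv]
  rw [delta_apply]
  simp only [h₁, h₂, Finset.smul_sum]
  rw [Finset.sum_comm]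
  refine Finset.sum_congr rfl fun c _ => Finset.sum_congr rfl fun b _ =>
    Finset.sum_congr rfl fun i _ => ?_
  rw [smul_comm, map_map, map_map, map_map, map_map, ins_rotOut, rotIn_del]
  simp only [d', DualBases.congr_basis, DualBases.congr_dual]
  rfl

end Delta

/-! ### Relations between the operators of relators -/

section LoopLinear

variable {K : Type w} [Field K] {C : Type u} [Category.{v} C] [Preadditive C] [Linear K C]
  [MonoidalCategory C] [MonoidalPreadditive C] [MonoidalLinear K C] [SymmetricCategory C] {n : ℕ}

open Functionals

theorem loop_smul (c : K) (A : Frame C n) (θ : A.obj ⟶ A.obj) (Z : C) :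
    loop (K := K) A (c • θ) Z = c • loop A θ Z := by
  refine LinearMap.ext fun F => Functionals.ext fun D ψ => ?_
  change F.1 (D.tensor A) (graft ψ _) = c * F.1 (D.tensor A) (graft ψ _)
  rw [← smul_eq_mul, ← LinearMap.map_smul]
  congr 1
  simp [graft]

end LoopLinear

section DeltaRelations

variable {K : Type w} [Field K] {C : Type u} [Category.{v} C] [Abelian C] [Linear K C]
  [MonoidalCategory C] [MonoidalPreadditive C] [MonoidalLinear K C] [SymmetricCategory C]
  [LeftRigidCategory C] [Stable C] (S : Semisimple K C) {n : ℕ}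

open Functionals

theorem delta_natural {h : Operators K C n} (hh : IsPoint h) {Z Z' : C} (f : Z ⟶ Z')
    (F : Functionals K n Z') : map f (delta S h Z' F) = delta S h Z (map f F) := by
  rw [delta_apply, delta_apply, _root_.map_sum]
  exact Finset.sum_congr rfl fun b _ => by rw [_root_.map_smul, opTrace_natural _ hh]

theorem delta_commute {h k : Operators K C n} (hh : IsPoint h) (hk : IsPoint k)
    (hc : SlotCommute k h) (X Z : C) (F : Functionals K n (X ⊗ Z)) :
    delta S h (X ⊗ Z) (k X Z F) = k X Z (delta S h (X ⊗ Z) F) := by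
  rw [delta_apply, delta_apply, _root_.map_sum]
  exact Finset.sum_congr rfl fun b _ => by rw [_root_.map_smul, opTrace_commute _ hh hk hc]

variable (K C) in
/-- The operator of a relator `g`, with coefficients in `Z`. -/
def relOp (g : FreeGroup (Fin n)) (Z : C) : Module.End K (Functionals K n Z) :=
  delta S (point K C n g).1 Z

theorem relOp_natural (g : FreeGroup (Fin n)) {Z Z' : C} (f : Z ⟶ Z')
    (F : Functionals K n Z') : map f (relOp K C S g Z' F) = relOp K C S g Z (map f F) :=
  delta_natural S (point_isPoint g) f F

theorem relOp_point (g g' : FreeGroup (Fin n)) (X Z : C) (F : Functionals K n (X ⊗ Z)) :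
    relOp K C S g (X ⊗ Z) ((point K C n g').1 X Z F) =
      (point K C n g').1 X Z (relOp K C S g (X ⊗ Z) F) :=
  delta_commute S (point_isPoint g) (point_isPoint g') (point_slotCommute g' g) X Z F

theorem relOp_commute (g g' : FreeGroup (Fin n)) (Z : C) :
    Commute (relOp K C S g Z) (relOp K C S g' Z) := by
  refine LinearMap.ext fun F => ?_
  change relOp K C S g Z (delta S (point K C n g').1 Z F) =
    delta S (point K C n g').1 Z (relOp K C S g Z F)
  rw [delta_apply, delta_apply, _root_.map_sum]
  refine Finset.sum_congr rfl fun b _ => ?_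
  rw [_root_.map_smul, opTrace_apply, opTrace_apply, ← relOp_natural, relOp_point, relOp_natural]

theorem relOp_conj (g g' : FreeGroup (Fin n)) (Z : C) :
    relOp K C S (g * g' * g⁻¹) Z = relOp K C S g' Z :=
  Finset.sum_congr rfl fun b _ => by rw [opTrace_conj]

/-- The sliding lemma, with the loops turned around by inverting the group element. -/
theorem relOp_inv_point (g : FreeGroup (Fin n)) (X Z : C) (F : Functionals K n (X ⊗ Z)) :
    relOp K C S g⁻¹ (X ⊗ Z) ((point K C n g).1 X Z F) = relOp K C S g (X ⊗ Z) F := by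
  rw [relOp, relOp, ← sum_opTrace_swap_apply S (point_isPoint g), delta_apply]
  exact Finset.sum_congr rfl fun b _ => by rw [opTrace_swap]

/-- The case of trivial coefficients of `relOp_inv_point`. -/
theorem relOp_inv (g : FreeGroup (Fin n)) (Z : C) : relOp K C S g⁻¹ Z = relOp K C S g Z := by
  refine LinearMap.ext fun F => ?_
  have h := relOp_inv_point S g (𝟙_ C) Z (map (λ_ Z).hom F)
  rw [(point_isPoint g).unit, ← relOp_natural, ← relOp_natural] at h
  have h' := congrArg (Functionals.map (λ_ Z).inv) h
  rwa [map_map, map_map, Iso.inv_hom_id, map_id_apply, map_id_apply] at h'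

/-- The operator of a relator absorbs the action of the relator on the coefficients. -/
theorem relOp_point_self (g : FreeGroup (Fin n)) (X Z : C) (F : Functionals K n (X ⊗ Z)) :
    relOp K C S g (X ⊗ Z) ((point K C n g).1 X Z F) = relOp K C S g (X ⊗ Z) F := by
  conv_lhs => rw [← relOp_inv]
  exact relOp_inv_point S g X Z F

/-- In the presence of the relator `g'` the relator `g * g'` may be replaced with `g`: the operator
of `g'` absorbs the action of `g'` in the loops of the other relator. -/
theorem relOp_mul_relOp (g g' : FreeGroup (Fin n)) (Z : C) :
    relOp K C S (g * g') Z * relOp K C S g' Z = relOp K C S g Z * relOp K C S g' Z := by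
  -- absorption works on the left, and conjugation by `g'` brings `g'` to the left
  have h : relOp K C S g' Z * relOp K C S (g' * g) Z = relOp K C S g' Z * relOp K C S g Z := by
    refine LinearMap.ext fun F => ?_
    change relOp K C S g' Z (delta S _ Z F) = relOp K C S g' Z (delta S _ Z F)
    rw [delta_apply, delta_apply, _root_.map_sum, _root_.map_sum]
    refine Finset.sum_congr rfl fun b _ => ?_
    rw [_root_.map_smul, _root_.map_smul, opTrace_apply, opTrace_apply, ← relOp_natural,
      ← relOp_natural, map_mul, Units.val_mul, mul_apply, relOp_point_self]
  have h' := relOp_conj S g' (g * g') Z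
  rw [← h', show g' * (g * g') * g'⁻¹ = g' * g by group, (relOp_commute S _ _ Z).eq, h,
    (relOp_commute S _ _ Z).eq]

/-- The operator of a relator is the sum of the insertions of the morphisms of the relator. -/
theorem relOp_value (R : Word n) (Z : C) : relOp K C S R.value Z =
    ∑ b : S.simples, loop (Frame.word b.1 R) (wordMorphism S b.1 R) Z := by
  refine Finset.sum_congr rfl fun b _ => ?_
  rw [opTrace_word]
  exact (loop_smul _ _ _ _).symm

end DeltaRelations

/-! ### The full partial trace as a balanced functional -/

section FullTrace

variable {K : Type w} [Field K] {C : Type u} [Category.{v} C] [Abelian C] [Linear K C]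
  [MonoidalCategory C] (S : Semisimple K C)

theorem DualBases.comp_dual {a A : C} (d : DualBases K a A) (f : a ⟶ A) (j : Fin d.size) :
    f ≫ d.dual j = d.basis.repr f j • 𝟙 a := by
  conv_lhs => rw [← d.basis.sum_repr f, Preadditive.sum_comp]
  simp only [Linear.smul_comp, d.comp_eq, smul_ite, smul_zero, Finset.sum_ite_eq,
    Finset.mem_univ, if_true]

theorem DualBases.basis_comp {a A : C} (d : DualBases K a A) (f : A ⟶ a) (i : Fin d.size) :
    d.basis i ≫ f = d.dual.repr f i • 𝟙 a := by
  conv_lhs => rw [← d.dual.sum_repr f, Preadditive.comp_sum]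
  simp only [Linear.comp_smul, d.comp_eq, smul_ite, smul_zero, Finset.sum_ite_eq',
    Finset.mem_univ, if_true]

namespace Semisimple

/-- The scalar of an endomorphism of the unit object, as a linear map. -/
def scalarHom : (𝟙_ C ⟶ 𝟙_ C) →ₗ[K] K where
  toFun := S.scalar
  map_add' := S.scalar_add
  map_smul' := S.scalar_smul

theorem scalarHom_apply (f : 𝟙_ C ⟶ 𝟙_ C) : S.scalarHom f = S.scalar f := rfl

/-- The expansion of a morphism in dual bases moves to the other side of the dual bases. -/
theorem sum_basis_comp (S : Semisimple K C) {U V : C} (d : DualBases K (𝟙_ C) U)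
    (e : DualBases K (𝟙_ C) V) (f : U ⟶ V) (B : (𝟙_ C ⟶ V) →ₗ[K] (U ⟶ 𝟙_ C) →ₗ[K] K) :
    ∑ i, B (d.basis i ≫ f) (d.dual i) = ∑ j, B (e.basis j) (f ≫ e.dual j) := by
  let x : Fin d.size → Fin e.size → K := fun i j => S.scalar (d.basis i ≫ f ≫ e.dual j)
  have hx : ∀ i j, d.basis i ≫ f ≫ e.dual j = x i j • 𝟙 _ := fun i j => S.scalar_spec _
  have h₁ : ∀ i, d.basis i ≫ f = ∑ j, x i j • e.basis j := by
    intro i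
    conv_lhs => rw [← e.basis.sum_repr (d.basis i ≫ f)]
    refine Finset.sum_congr rfl fun j _ => ?_
    congr 1
    refine S.smul_id_injective S.unit_mem ?_
    rw [← hx, ← Category.assoc, e.comp_dual]
  have h₂ : ∀ j, f ≫ e.dual j = ∑ i, x i j • d.dual i := by
    intro j
    conv_lhs => rw [← d.dual.sum_repr (f ≫ e.dual j)]
    refine Finset.sum_congr rfl fun i _ => ?_
    congr 1
    refine S.smul_id_injective S.unit_mem ?_
    rw [← hx, d.basis_comp]
  simp only [h₁, h₂, _root_.map_sum, _root_.map_smul, LinearMap.sum_apply, LinearMap.smul_apply]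
  exact Finset.sum_comm

/-- The scalar of the partial trace over all factors. -/
def fullTrace {n : ℕ} {U : Fin n → C} (φ : bigTensor U ⟶ bigTensor U) : K :=
  S.scalar ((unitIso n).hom ≫ partialTrace (fun k => S.dualBases S.unit_mem (U k)) φ ≫
    (unitIso n).inv)

theorem fullTrace_zero {U : Fin 0 → C} (φ : 𝟙_ C ⟶ 𝟙_ C) :
    S.fullTrace (U := U) φ = S.scalar φ := by
  change S.scalar (_ ≫ (∑ _, _) ≫ _) = _
  rw [Fintype.sum_unique]
  congr 1
  change 𝟙 (𝟙_ C) ≫ (𝟙 (𝟙_ C) ≫ φ ≫ 𝟙 (𝟙_ C)) ≫ 𝟙 (𝟙_ C) = φ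
  simp

/-- The contraction of a morphism in the first factor. -/
def contract {A B T T' : C} (ε : 𝟙_ C ⟶ A) (φ : A ⊗ T ⟶ B ⊗ T') (ω : B ⟶ 𝟙_ C) : T ⟶ T' :=
  (λ_ T).inv ≫ ε ▷ T ≫ φ ≫ ω ▷ T' ≫ (λ_ T').hom

theorem contract_step {A T I J : C} (a : 𝟙_ C ⟶ I) (b : J ⟶ 𝟙_ C) (ε : 𝟙_ C ⟶ A) (ω : A ⟶ 𝟙_ C)
    (e : I ⟶ T) (e' : T ⟶ J) (φ : A ⊗ T ⟶ A ⊗ T) :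
    (a ≫ (λ_ I).inv) ≫ ((ε ⊗ₘ e) ≫ φ ≫ (ω ⊗ₘ e')) ≫ (λ_ J).hom ≫ b =
      a ≫ (e ≫ contract ε φ ω ≫ e') ≫ b := by
  rw [MonoidalCategory.tensorHom_def', MonoidalCategory.tensorHom_def, contract]
  simp only [Category.assoc, leftUnitor_naturality_assoc, leftUnitor_inv_naturality_assoc]

theorem contract_comp_left {A A' B T T' T'' : C} (ε : 𝟙_ C ⟶ A) (f : A ⟶ A') (g : T ⟶ T')
    (φ : A' ⊗ T' ⟶ B ⊗ T'') (ω : B ⟶ 𝟙_ C) :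
    contract ε ((f ⊗ₘ g) ≫ φ) ω = g ≫ contract (ε ≫ f) φ ω := by
  rw [contract, contract, MonoidalCategory.tensorHom_def', comp_whiskerRight]
  simp only [Category.assoc]
  rw [leftUnitor_inv_naturality_assoc, whisker_exchange_assoc ε g]

theorem contract_comp_right {A B B' T T' T'' : C} (ε : 𝟙_ C ⟶ A) (φ : A ⊗ T ⟶ B ⊗ T')
    (f : B ⟶ B') (g : T' ⟶ T'') (ω : B' ⟶ 𝟙_ C) :
    contract ε (φ ≫ (f ⊗ₘ g)) ω = contract ε φ (f ≫ ω) ≫ g := by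
  rw [contract, contract, MonoidalCategory.tensorHom_def, comp_whiskerRight]
  simp only [Category.assoc]
  rw [← leftUnitor_naturality, whisker_exchange_assoc]

theorem fullTrace_succ {n : ℕ} {U : Fin (n + 1) → C} (φ : bigTensor U ⟶ bigTensor U) :
    S.fullTrace φ = ∑ i, S.fullTrace (U := fun k => U k.succ) (contract
      ((S.dualBases S.unit_mem (U 0)).basis i) φ ((S.dualBases S.unit_mem (U 0)).dual i)) := by
  simp only [fullTrace, partialTrace, Preadditive.sum_comp, Preadditive.comp_sum,
    ← scalarHom_apply, _root_.map_sum]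
  rw [← (Fin.consEquiv fun k => Fin (S.dualBases S.unit_mem (U k)).size).sum_comp,
    Fintype.sum_prod_type]
  refine Finset.sum_congr rfl fun i _ => Finset.sum_congr rfl fun j _ => ?_
  congr 1
  exact contract_step _ _ _ _ _ _ _

variable [MonoidalPreadditive C] [MonoidalLinear K C]

theorem contract_add_left {A B T T' : C} (ε ε' : 𝟙_ C ⟶ A) (φ : A ⊗ T ⟶ B ⊗ T') (ω : B ⟶ 𝟙_ C) :
    contract (ε + ε') φ ω = contract ε φ ω + contract ε' φ ω := by
  simp [contract, Preadditive.add_comp, Preadditive.comp_add]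

theorem contract_add_right {A B T T' : C} (ε : 𝟙_ C ⟶ A) (φ : A ⊗ T ⟶ B ⊗ T') (ω ω' : B ⟶ 𝟙_ C) :
    contract ε φ (ω + ω') = contract ε φ ω + contract ε φ ω' := by
  simp [contract, Preadditive.add_comp, Preadditive.comp_add]

theorem contract_smul_left (c : K) {A B T T' : C} (ε : 𝟙_ C ⟶ A) (φ : A ⊗ T ⟶ B ⊗ T')
    (ω : B ⟶ 𝟙_ C) : contract (c • ε) φ ω = c • contract ε φ ω := by
  simp [contract]

theorem contract_smul_right (c : K) {A B T T' : C} (ε : 𝟙_ C ⟶ A) (φ : A ⊗ T ⟶ B ⊗ T')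
    (ω : B ⟶ 𝟙_ C) : contract ε φ (c • ω) = c • contract ε φ ω := by
  simp [contract]

theorem fullTrace_add {n : ℕ} {U : Fin n → C} (φ ψ : bigTensor U ⟶ bigTensor U) :
    S.fullTrace (φ + ψ) = S.fullTrace φ + S.fullTrace ψ := by
  simp only [fullTrace, partialTrace, ← scalarHom_apply, ← LinearMap.map_add,
    Preadditive.comp_add, Preadditive.add_comp, Finset.sum_add_distrib]

theorem fullTrace_smul {n : ℕ} {U : Fin n → C} (c : K) (φ : bigTensor U ⟶ bigTensor U) :
    S.fullTrace (c • φ) = c * S.fullTrace φ := by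
  simp only [fullTrace, partialTrace, ← scalarHom_apply, ← smul_eq_mul, ← LinearMap.map_smul,
    Linear.comp_smul, Linear.smul_comp, ← Finset.smul_sum]

/-- The full partial trace is cyclic with respect to tensor products of morphisms. -/
theorem fullTrace_comm {n : ℕ} {U V : Fin n → C} (f : ∀ k, U k ⟶ V k)
    (φ : bigTensor V ⟶ bigTensor U) :
    S.fullTrace (bigTensorMap f ≫ φ) = S.fullTrace (φ ≫ bigTensorMap f) := by
  induction n with
  | zero =>
    refine (congrArg (S.fullTrace (U := U)) (Category.id_comp (X := 𝟙_ C) (Y := 𝟙_ C) φ)).trans ?_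
    refine Eq.trans ?_
      (congrArg (S.fullTrace (U := V)) (Category.comp_id (X := 𝟙_ C) (Y := 𝟙_ C) φ)).symm
    exact (S.fullTrace_zero φ).trans (S.fullTrace_zero φ).symm
  | succ n ih =>
    let g := bigTensorMap fun k => f k.succ
    -- the dependence on the dual bases in the first place is bilinear
    let B : (𝟙_ C ⟶ V 0) →ₗ[K] (U 0 ⟶ 𝟙_ C) →ₗ[K] K := LinearMap.mk₂ K
      (fun ε ω => S.fullTrace (U := fun k => V k.succ) (contract ε φ ω ≫ g))
      (fun ε ε' ω => by
        rw [← fullTrace_add, ← Preadditive.add_comp]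
        exact congrArg (fun x => S.fullTrace (x ≫ g)) (contract_add_left _ _ _ _))
      (fun c ε ω => by
        rw [smul_eq_mul, ← fullTrace_smul, ← Linear.smul_comp]
        exact congrArg (fun x => S.fullTrace (x ≫ g)) (contract_smul_left _ _ _ _))
      (fun ε ω ω' => by
        rw [← fullTrace_add, ← Preadditive.add_comp]
        exact congrArg (fun x => S.fullTrace (x ≫ g)) (contract_add_right _ _ _ _))
      (fun c ε ω => by
        rw [smul_eq_mul, ← fullTrace_smul, ← Linear.smul_comp]
        exact congrArg (fun x => S.fullTrace (x ≫ g)) (contract_smul_right _ _ _ _))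
    rw [fullTrace_succ, fullTrace_succ]
    have h := S.sum_basis_comp (S.dualBases S.unit_mem (U 0)) (S.dualBases S.unit_mem (V 0))
      (f 0) B
    refine Eq.trans (Finset.sum_congr rfl fun i _ => ?_)
      (h.trans (Finset.sum_congr rfl fun i _ => ?_))
    · exact (congrArg (S.fullTrace (U := fun k => U k.succ)) (contract_comp_left _ _ _ _ _)).trans
        (ih _ _)
    · exact (congrArg (S.fullTrace (U := fun k => V k.succ)) (contract_comp_right _ _ _ _ _)).symm

variable (n : ℕ)

/-- The full partial trace, as a balanced functional. -/
def traceFunctional : Functionals K n (𝟙_ C) :=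
  ⟨fun A =>
    { toFun := fun ψ => S.fullTrace (A.iso.inv ≫ ψ ≫ (ρ_ _).hom ≫ A.iso.hom)
      map_add' := fun ψ ψ' => by
        rw [← fullTrace_add]; simp [Preadditive.add_comp, Preadditive.comp_add]
      map_smul' := fun c ψ => by
        rw [RingHom.id_apply, smul_eq_mul, ← fullTrace_smul]; simp }, by
    rintro A B f ⟨g, hg⟩ ψ
    have h := S.fullTrace_comm g (B.iso.inv ≫ ψ ≫ (ρ_ _).hom ≫ A.iso.hom)
    have h₁ : A.iso.inv ≫ f = bigTensorMap g ≫ B.iso.inv := by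
      rw [Iso.inv_comp_eq, ← Category.assoc, ← hg]; simp
    refine Eq.trans ?_ (h.trans ?_)
    · change S.fullTrace _ = _
      rw [Category.assoc, reassoc_of% h₁]
    · change _ = S.fullTrace _
      simp only [Category.assoc]
      rw [← hg, rightUnitor_naturality_assoc]⟩

end Semisimple

end FullTrace

/-! ### The invariant in terms of the operators of the relators -/

section Loops

variable {K : Type w} [Field K] {C : Type u} [Category.{v} C] [Preadditive C] [Linear K C]
  [MonoidalCategory C] [MonoidalPreadditive C] [MonoidalLinear K C] [SymmetricCategory C] {n : ℕ}

open Functionals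

theorem loop_cyclic {A B : Frame C n} {f : A.obj ⟶ B.obj} (hf : Frame.Graded A B f)
    (θ : B.obj ⟶ A.obj) (Z : C) : loop (K := K) A (f ≫ θ) Z = loop B (θ ≫ f) Z := by
  have h := tube_slide (K := K) hf ((β_ Z B.obj).hom ≫ θ ▷ Z)
  unfold loop
  rw [comp_whiskerRight, comp_whiskerRight, ← h.trans (congrArg _ (Category.assoc _ _ _))]
  simp

theorem loop_one (Z : C) : loop (K := K) (Frame.one C n) (𝟙 (𝟙_ C)) Z = 1 := by
  have h : (β_ Z (𝟙_ C)).hom ≫ 𝟙 (𝟙_ C) ▷ Z = (ρ_ Z).hom ≫ (λ_ Z).inv := by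
    simp
  unfold loop
  rw [h]
  exact tube_one Z

theorem loop_tensor (A B : Frame C n) (θ : A.obj ⟶ A.obj) (θ' : B.obj ⟶ B.obj) (Z : C) :
    loop (K := K) (A.tensor B) (θ ⊗ₘ θ') Z = loop A θ Z * loop B θ' Z := by
  have h := tube_comp (K := K) A B ((β_ Z A.obj).hom ≫ θ ▷ Z) ((β_ Z B.obj).hom ≫ θ' ▷ Z)
  refine Eq.trans ?_ h.symm
  unfold loop
  congr 1
  let W := objects [Z, A.obj, B.obj, A.obj, B.obj]
  have := isDiagram_box (X := W) θ (wire 1) (wire 3) rfl rfl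
  have := isDiagram_box (X := W) θ' (wire 2) (wire 4) rfl rfl
  exact eq_of_diagram W (tens (wire 0) (tens (wire 1) (wire 2))) rfl rfl rfl rfl

theorem graded_leftUnitor (A : Frame C n) :
    Frame.Graded ((Frame.one C n).tensor A) A (λ_ A.obj).hom := by
  have h := (Frame.graded_braid (Frame.one C n) A).comp (Frame.graded_rightUnitor A)
  rwa [braiding_rightUnitor] at h

/-- A balanced functional with trivial coefficients is evaluated by an insertion. -/
theorem apply_eq_loop (F : Functionals K n (𝟙_ C)) (A : Frame C n) (θ : A.obj ⟶ A.obj) :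
    F.1 A (θ ≫ (ρ_ _).inv) = (loop A θ (𝟙_ C) F).1 (Frame.one C n) (ρ_ (𝟙_ C)).inv := by
  have h := balanced F (graded_leftUnitor A) (θ ≫ (ρ_ _).inv ≫ (λ_ A.obj).inv ▷ (𝟙_ C))
  refine Eq.trans ?_ (h.symm.trans ?_)
  · congr 1
    simp
  · refine congrArg (F.1 ((Frame.one C n).tensor A)) ?_
    let W := objects [A.obj, A.obj]
    have := isDiagram_box (X := W) θ (wire 0) (wire 1) rfl rfl
    unfold graft
    exact eq_of_diagram W (tens WireExpr.unit (wire 0)) rfl rfl rfl rfl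

variable [LeftRigidCategory C]

/-- The framed object of a finite sequence of words. -/
abbrev Frame.words {m : ℕ} (b : Fin m → C) (R : Fin m → Word n) : Frame C n where
  obj := bigTensor fun j => wordObj (b j) (R j)
  fam k := bigTensor fun j => genObj (b j) (R j) k
  iso := bigTensorIso (fun j => wordIso (b j) (R j)) ≪≫ transposeIso fun j k => genObj (b j) (R j) k

theorem Frame.graded_words_zero (b : Fin 0 → C) (R : Fin 0 → Word n) :
    Frame.Graded (Frame.words b R) (Frame.one C n) (𝟙 (𝟙_ C)) := by
  refine ⟨fun _ => 𝟙 (𝟙_ C), ?_⟩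
  refine Eq.trans ?_ (congrArg (fun x => (Frame.words b R).iso.hom ≫ x)
    (bigTensorMap_id fun _ : Fin n => 𝟙_ C)).symm
  change 𝟙 (𝟙_ C) ≫ (unitIso n).hom = (𝟙 (𝟙_ C) ≫ (unitIso n).hom) ≫ 𝟙 _
  simp

theorem Frame.graded_words_succ {m : ℕ} (b : Fin (m + 1) → C) (R : Fin (m + 1) → Word n) :
    Frame.Graded (Frame.words b R) ((Frame.word (b 0) (R 0)).tensor
      (Frame.words (fun j => b j.succ) fun j => R j.succ)) (𝟙 _) := by
  refine ⟨fun k => 𝟙 _, ?_⟩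
  refine Eq.trans ?_ (congrArg (fun x => (Frame.words b R).iso.hom ≫ x)
    (bigTensorMap_id (Frame.words b R).fam)).symm
  have h : ∀ {A B A' B' D' E : C} (f : A ⟶ A') (g : B ⟶ B') (t : B' ⟶ D') (m : A' ⊗ D' ⟶ E),
      𝟙 _ ≫ (f ⊗ₘ g ≫ t) ≫ m = ((f ⊗ₘ g) ≫ (𝟙 _ ⊗ₘ t) ≫ m) ≫ 𝟙 _ := by
    intros
    simp [MonoidalCategory.tensorHom_def]
  exact h _ _ _ _

/-- Insertions of several words are composed. -/
theorem loop_words {m : ℕ} (b : Fin m → C) (R : Fin m → Word n)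
    (θ : ∀ j, wordObj (b j) (R j) ⟶ wordObj (b j) (R j)) (Z : C) :
    loop (K := K) (Frame.words b R) (bigTensorMap θ) Z =
      (List.ofFn fun j => loop (Frame.word (b j) (R j)) (θ j) Z).prod := by
  induction m with
  | zero =>
    have h := loop_cyclic (K := K) (Frame.graded_words_zero b R) (𝟙 (𝟙_ C)) Z
    rw [List.ofFn_zero, List.prod_nil, ← loop_one]
    exact (congrArg (fun f => loop (Frame.words b R) f Z) (Category.id_comp (𝟙 (𝟙_ C))).symm).trans
      (h.trans (congrArg (fun f => loop (Frame.one C n) f Z) (Category.comp_id (𝟙 (𝟙_ C)))))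
  | succ m ih =>
    rw [List.ofFn_succ, List.prod_cons, ← ih, ← loop_tensor]
    have h := loop_cyclic (K := K) (Frame.graded_words_succ b R) (bigTensorMap θ) Z
    exact (congrArg (fun f => loop (Frame.words b R) f Z) (Category.id_comp _).symm).trans
      (h.trans (congrArg (fun f => loop ((Frame.word (b 0) (R 0)).tensor
      (Frame.words (fun j => b j.succ) fun j => R j.succ)) f Z) (Category.comp_id _)))

end Loops

theorem sum_prod_ofFn {A ι : Type*} [Semiring A] [Fintype ι] {m : ℕ} (a : Fin m → ι → A) :
    ∑ b : Fin m → ι, (List.ofFn fun j => a j (b j)).prod =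
      (List.ofFn fun j => ∑ i, a j i).prod := by
  induction m with
  | zero => simp
  | succ m ih =>
    rw [← (Fin.consEquiv fun _ => ι).sum_comp, Fintype.sum_prod_type, List.ofFn_succ,
      List.prod_cons, ← ih, Finset.sum_mul_sum]
    refine Finset.sum_congr rfl fun i _ => Finset.sum_congr rfl fun b _ => ?_
    rw [List.ofFn_succ, List.prod_cons]
    rfl

section Invariant

variable {K : Type w} [Field K] {C : Type u} [Category.{v} C] [Abelian C] [Linear K C]
  [MonoidalCategory C] [MonoidalPreadditive C] [MonoidalLinear K C] [SymmetricCategory C]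
  [LeftRigidCategory C] [Stable C] (S : Semisimple K C)

open Functionals

/-- The value of a balanced functional at the unit object. -/
def atUnit {n : ℕ} (F : Functionals K n (𝟙_ C)) : K := F.1 (Frame.one C n) (ρ_ (𝟙_ C)).inv

/-- The sum over the simple objects distributes over the relators. -/
theorem Q_eq (P : WordPresentation) : Q S P = atUnit ((List.ofFn fun j =>
    relOp K C S (P.rel j).value (𝟙_ C)).prod (S.traceFunctional P.numGens)) := by
  simp only [relOp_value]
  rw [← sum_prod_ofFn fun j (b : S.simples) =>
    loop (Frame.word b.1 (P.rel j)) (wordMorphism S b.1 (P.rel j)) (𝟙_ C)]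
  rw [LinearMap.sum_apply, atUnit, Submodule.coe_sum, Finset.sum_apply, LinearMap.sum_apply]
  refine Finset.sum_congr rfl fun b _ => ?_
  rw [← loop_words (fun j => (b j : C)) P.rel, ← apply_eq_loop]
  change _ = S.fullTrace (_ ≫ (_ ≫ _) ≫ _)
  rw [Category.assoc, Iso.inv_hom_id_assoc]
  rfl

end Invariant

/-! ### Families with an additional last member -/

section Append

variable {C : Type u} [Category.{v} C] [MonoidalCategory C]

/-- The family `U` with the additional last member `X`. -/
def append : {n : ℕ} → (Fin n → C) → C → Fin (n + 1) → C
  | 0, _, X => fun _ => X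
  | _ + 1, U, X => Fin.cons (U 0) (append (fun k => U k.succ) X)

/-- The family `f` of morphisms with the additional last member `g`. -/
def appendMap : {n : ℕ} → {U V : Fin n → C} → (∀ k, U k ⟶ V k) → {X Y : C} → (X ⟶ Y) →
    ∀ k, append U X k ⟶ append V Y k
  | 0, _, _, _, _, _, g => fun _ => g
  | n + 1, U, V, f, X, Y, g => Fin.cons
      (α := fun k : Fin (n + 2) => append U X k ⟶ append V Y k) (f 0)
      (appendMap (fun k => f k.succ) g)

/-- The canonical isomorphism `(⨂ₖ Uₖ) ⊗ X ≅ ⨂ₖ (U, X)ₖ`. -/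
def appendIso : {n : ℕ} → (U : Fin n → C) → (X : C) → (bigTensor U ⊗ X ≅ bigTensor (append U X))
  | 0, _, X => λ_ X ≪≫ (ρ_ X).symm
  | _ + 1, U, X => α_ (U 0) (bigTensor fun k => U k.succ) X ≪≫
      (Iso.refl (U 0) ⊗ᵢ appendIso (fun k => U k.succ) X)

/-- The products of the members of two families with additional last members, where the last two
members are multiplied by `m`. -/
def appendMul : {n : ℕ} → (U V : Fin n → C) → {X Y Z : C} → (X ⊗ Y ⟶ Z) →
    ∀ k, append U X k ⊗ append V Y k ⟶ append (fun k => U k ⊗ V k) Z k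
  | 0, _, _, _, _, _, m => fun _ => m
  | n + 1, U, V, X, Y, Z, m => Fin.cons
      (α := fun k : Fin (n + 2) => append U X k ⊗ append V Y k ⟶ append (fun k => U k ⊗ V k) Z k)
      (𝟙 (U 0 ⊗ V 0)) (appendMul (fun k => U k.succ) (fun k => V k.succ) m)

variable (C) in
/-- The unit objects with the unit object as additional last member. -/
def appendUnit : {n : ℕ} → ∀ k : Fin (n + 1), append (fun _ : Fin n => 𝟙_ C) (𝟙_ C) k ⟶ 𝟙_ C
  | 0 => fun _ => 𝟙 (𝟙_ C)
  | n + 1 => Fin.cons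
      (α := fun k : Fin (n + 2) => append (fun _ : Fin (n + 1) => 𝟙_ C) (𝟙_ C) k ⟶ 𝟙_ C)
      (𝟙 (𝟙_ C)) appendUnit

/-- The object `A` in place `i`, with the unit object as additional last member. -/
def appendPlace (A : C) : {n : ℕ} → (i : Fin n) → ∀ k,
    append (place A i) (𝟙_ C) k ⟶ place A i.castSucc k
  | n + 1, ⟨0, h⟩ => Fin.cons (α := fun k : Fin (n + 2) =>
      append (place A ⟨0, h⟩) (𝟙_ C) k ⟶ place A (Fin.castSucc ⟨0, h⟩) k) (𝟙 A) (appendUnit C)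
  | n + 1, ⟨i + 1, h⟩ => Fin.cons (α := fun k : Fin (n + 2) =>
      append (place A ⟨i + 1, h⟩) (𝟙_ C) k ⟶ place A (Fin.castSucc ⟨i + 1, h⟩) k) (𝟙 (𝟙_ C))
      (appendPlace A ⟨i, Nat.lt_of_succ_lt_succ h⟩)

/-- The unit objects with the additional last member `A`. -/
def appendLast (A : C) : {n : ℕ} → ∀ k,
    append (fun _ : Fin n => 𝟙_ C) A k ⟶ place A (Fin.last n) k
  | 0 => Fin.cons (α := fun k : Fin 1 =>
      append (fun _ : Fin 0 => 𝟙_ C) A k ⟶ place A (Fin.last 0) k) (𝟙 A) fun k => k.elim0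
  | n + 1 => Fin.cons (α := fun k : Fin (n + 2) =>
      append (fun _ : Fin (n + 1) => 𝟙_ C) A k ⟶ place A (Fin.last (n + 1)) k) (𝟙 (𝟙_ C))
      (appendLast A)

/-! The induction steps for the properties of `appendIso` are stated for arbitrary objects in place
of the tensor products of the tails of the families. -/

theorem append_natural_step {A A' T T' X Y P Q : C} (f : A ⟶ A') (g : T ⟶ T') (h : X ⟶ Y)
    (a : T ⊗ X ⟶ P) (a' : T' ⊗ Y ⟶ Q) (e : P ⟶ Q) (H : (g ⊗ₘ h) ≫ a' = a ≫ e) :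
    ((f ⊗ₘ g) ⊗ₘ h) ≫ (α_ A' T' Y).hom ≫ (𝟙 A' ⊗ₘ a') =
      ((α_ A T X).hom ≫ (𝟙 A ⊗ₘ a)) ≫ (f ⊗ₘ e) := by
  rw [associator_naturality_assoc, Category.assoc, MonoidalCategory.tensorHom_comp_tensorHom,
    MonoidalCategory.tensorHom_comp_tensorHom, H, Category.comp_id, Category.id_comp]

theorem appendIso_natural {n : ℕ} {U V : Fin n → C} (f : ∀ k, U k ⟶ V k) {X Y : C} (g : X ⟶ Y) :
    (bigTensorMap f ⊗ₘ g) ≫ (appendIso V Y).hom =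
      (appendIso U X).hom ≫ bigTensorMap (appendMap f g) := by
  induction n with
  | zero =>
    change (𝟙 (𝟙_ C) ⊗ₘ g) ≫ (λ_ Y).hom ≫ (ρ_ Y).inv =
      ((λ_ X).hom ≫ (ρ_ X).inv) ≫ (g ⊗ₘ 𝟙 (𝟙_ C))
    simp
  | succ n ih => exact append_natural_step _ _ _ _ _ _ (ih fun k => f k.succ)

theorem appendUnit_step {T P Q : C} (t : 𝟙_ C ⟶ T) (a : T ⊗ 𝟙_ C ⟶ P) (e : P ⟶ Q) (q : 𝟙_ C ⟶ Q)
    (H : t ▷ 𝟙_ C ≫ a ≫ e = (ρ_ _).hom ≫ q) :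
    (t ≫ (λ_ T).inv) ▷ 𝟙_ C ≫ ((α_ (𝟙_ C) T (𝟙_ C)).hom ≫ (𝟙 (𝟙_ C) ⊗ₘ a)) ≫ (𝟙 (𝟙_ C) ⊗ₘ e) =
      (ρ_ _).hom ≫ q ≫ (λ_ Q).inv := by
  have h : q = (ρ_ _).inv ≫ t ▷ 𝟙_ C ≫ a ≫ e := by rw [H]; simp
  rw [h]
  monoidal

theorem appendIso_unit (n : ℕ) :
    (unitIso n).hom ▷ 𝟙_ C ≫ (appendIso (fun _ : Fin n => 𝟙_ C) (𝟙_ C)).hom ≫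
      bigTensorMap (appendUnit C) = (ρ_ _).hom ≫ (unitIso (n + 1)).hom := by
  induction n with
  | zero =>
    change 𝟙 (𝟙_ C) ▷ 𝟙_ C ≫ ((λ_ (𝟙_ C)).hom ≫ (ρ_ (𝟙_ C)).inv) ≫ (𝟙 (𝟙_ C) ⊗ₘ 𝟙 (𝟙_ C)) =
      (ρ_ _).hom ≫ 𝟙 (𝟙_ C) ≫ (λ_ (𝟙_ C)).inv
    simp [unitors_equal, unitors_inv_equal]
  | succ n ih => exact appendUnit_step _ _ _ _ ih

theorem appendPlace_step {A T P Q : C} (t : 𝟙_ C ⟶ T) (a : T ⊗ 𝟙_ C ⟶ P) (e : P ⟶ 𝟙_ C ⊗ Q)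
    (q : 𝟙_ C ⟶ Q) (H : t ▷ 𝟙_ C ≫ a ≫ e = (ρ_ _).hom ≫ q ≫ (λ_ Q).inv) :
    ((ρ_ A).inv ≫ (𝟙 A ⊗ₘ t)) ▷ 𝟙_ C ≫ ((α_ A T (𝟙_ C)).hom ≫ (𝟙 A ⊗ₘ a)) ≫ (𝟙 A ⊗ₘ e) =
      (ρ_ _).hom ≫ (ρ_ A).inv ≫ (𝟙 A ⊗ₘ q ≫ (λ_ Q).inv) := by
  have h : q ≫ (λ_ Q).inv = (ρ_ _).inv ≫ t ▷ 𝟙_ C ≫ a ≫ e := by rw [H]; simp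
  rw [h]
  simp

theorem appendPlace_succ_step {A T P Q : C} (t : A ⟶ T) (a : T ⊗ 𝟙_ C ⟶ P) (e : P ⟶ Q) (q : A ⟶ Q)
    (H : t ▷ 𝟙_ C ≫ a ≫ e = (ρ_ _).hom ≫ q) :
    (t ≫ (λ_ T).inv) ▷ 𝟙_ C ≫ ((α_ (𝟙_ C) T (𝟙_ C)).hom ≫ (𝟙 (𝟙_ C) ⊗ₘ a)) ≫ (𝟙 (𝟙_ C) ⊗ₘ e) =
      (ρ_ _).hom ≫ q ≫ (λ_ Q).inv := by
  have h : q = (ρ_ _).inv ≫ t ▷ 𝟙_ C ≫ a ≫ e := by rw [H]; simp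
  rw [h]
  monoidal

theorem appendIso_place (A : C) {n : ℕ} (i : Fin n) :
    (placeIso A i).hom ▷ 𝟙_ C ≫ (appendIso (place A i) (𝟙_ C)).hom ≫
      bigTensorMap (appendPlace A i) = (ρ_ _).hom ≫ (placeIso A i.castSucc).hom := by
  induction n with
  | zero => exact i.elim0
  | succ n ih =>
    obtain ⟨_ | i, h⟩ := i
    · exact appendPlace_step _ _ _ _ (appendIso_unit n)
    · exact appendPlace_succ_step _ _ _ _ (ih ⟨i, Nat.lt_of_succ_lt_succ h⟩)

theorem appendLast_step {A T P Q : C} (t : 𝟙_ C ⟶ T) (a : T ⊗ A ⟶ P) (e : P ⟶ Q)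
    (q : A ⟶ Q) (H : t ▷ A ≫ a ≫ e = (λ_ A).hom ≫ q) :
    (t ≫ (λ_ T).inv) ▷ A ≫ ((α_ (𝟙_ C) T A).hom ≫ (𝟙 (𝟙_ C) ⊗ₘ a)) ≫ (𝟙 (𝟙_ C) ⊗ₘ e) =
      (λ_ _).hom ≫ q ≫ (λ_ Q).inv := by
  have h : q = (λ_ _).inv ≫ t ▷ A ≫ a ≫ e := by rw [H]; simp
  rw [h]
  simp

theorem appendIso_last (A : C) (n : ℕ) :
    (unitIso n).hom ▷ A ≫ (appendIso (fun _ : Fin n => 𝟙_ C) A).hom ≫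
      bigTensorMap (appendLast A) = (λ_ _).hom ≫ (placeIso A (Fin.last n)).hom := by
  induction n with
  | zero =>
    change 𝟙 (𝟙_ C) ▷ A ≫ ((λ_ A).hom ≫ (ρ_ A).inv) ≫ (𝟙 A ⊗ₘ 𝟙 (𝟙_ C)) =
      (λ_ _).hom ≫ (ρ_ A).inv ≫ (𝟙 A ⊗ₘ 𝟙 (𝟙_ C))
    simp
  | succ n ih => exact appendLast_step _ _ _ _ ih

variable [SymmetricCategory C]

theorem append_mul_step (A B : C) {T T' X Y Z P P' R M N : C} (a : T ⊗ X ⟶ P) (a' : T' ⊗ Y ⟶ P')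
    (μ : P ⊗ P' ⟶ R) (e : R ⟶ N) (ν : T ⊗ T' ⟶ M) (m : X ⊗ Y ⟶ Z) (a'' : M ⊗ Z ⟶ N)
    (H : (a ⊗ₘ a') ≫ μ ≫ e = tensorμ T X T' Y ≫ (ν ⊗ₘ m) ≫ a'') :
    (((α_ A T X).hom ≫ (𝟙 A ⊗ₘ a)) ⊗ₘ ((α_ B T' Y).hom ≫ (𝟙 B ⊗ₘ a'))) ≫
        (tensorμ A P B P' ≫ (𝟙 _ ⊗ₘ μ)) ≫ (𝟙 (A ⊗ B) ⊗ₘ e) =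
      tensorμ (A ⊗ T) X (B ⊗ T') Y ≫ ((tensorμ A T B T' ≫ (𝟙 _ ⊗ₘ ν)) ⊗ₘ m) ≫
        ((α_ (A ⊗ B) M Z).hom ≫ (𝟙 _ ⊗ₘ a'')) := by
  let W := objects [A, T, X, B, T', Y, P, P', R, N, M, Z]
  have := isDiagram_box (X := W) a (tens (wire 1) (wire 2)) (wire 6) rfl rfl
  have := isDiagram_box (X := W) a' (tens (wire 4) (wire 5)) (wire 7) rfl rfl
  have := isDiagram_box (X := W) μ (tens (wire 6) (wire 7)) (wire 8) rfl rfl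
  have := isDiagram_box (X := W) e (wire 8) (wire 9) rfl rfl
  have := isDiagram_box (X := W) ν (tens (wire 1) (wire 4)) (wire 10) rfl rfl
  have := isDiagram_box (X := W) m (tens (wire 2) (wire 5)) (wire 11) rfl rfl
  have := isDiagram_box (X := W) a'' (tens (wire 10) (wire 11)) (wire 9) rfl rfl
  let s := tens (tens (tens (wire 0) (wire 1)) (wire 2)) (tens (tens (wire 3) (wire 4)) (wire 5))
  calc _ = ((α_ A T X).hom ⊗ₘ (α_ B T' Y).hom) ≫ tensorμ A (T ⊗ X) B (T' ⊗ Y) ≫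
        (A ⊗ B) ◁ ((a ⊗ₘ a') ≫ μ ≫ e) := by
        exact eq_of_diagram W s rfl rfl rfl rfl
    _ = _ := by
        rw [H]
        exact eq_of_diagram W s rfl rfl rfl rfl

theorem append_mul_zero {X Y Z : C} (m : X ⊗ Y ⟶ Z) :
    (((λ_ X).hom ≫ (ρ_ X).inv) ⊗ₘ ((λ_ Y).hom ≫ (ρ_ Y).inv)) ≫
        (tensorμ X (𝟙_ C) Y (𝟙_ C) ≫ (𝟙 _ ⊗ₘ (λ_ (𝟙_ C)).hom)) ≫ (m ⊗ₘ 𝟙 (𝟙_ C)) =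
      tensorμ (𝟙_ C) X (𝟙_ C) Y ≫ ((λ_ (𝟙_ C)).hom ⊗ₘ m) ≫ (λ_ Z).hom ≫ (ρ_ Z).inv := by
  let W := objects [X, Y, Z]
  have := isDiagram_box (X := W) m (tens (wire 0) (wire 1)) (wire 2) rfl rfl
  exact eq_of_diagram W (tens (tens unit (wire 0)) (tens unit (wire 1))) rfl rfl rfl rfl

theorem appendIso_mul {n : ℕ} (U V : Fin n → C) {X Y Z : C} (m : X ⊗ Y ⟶ Z) :
    ((appendIso U X).hom ⊗ₘ (appendIso V Y).hom) ≫ (mulIso _ _).hom ≫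
      bigTensorMap (appendMul U V m) =
    tensorμ (bigTensor U) X (bigTensor V) Y ≫ ((mulIso U V).hom ⊗ₘ m) ≫ (appendIso _ Z).hom := by
  induction n with
  | zero => exact append_mul_zero m
  | succ n ih =>
    exact append_mul_step _ _ _ _ _ _ _ _ _ (ih (fun k => U k.succ) fun k => V k.succ)

end Append

section AppendFrame

variable {C : Type u} [Category.{v} C] [MonoidalCategory C] {n : ℕ}

namespace Frame

/-- The tensor product of a framed object and an object in an additional last place. -/
abbrev extend (A : Frame C n) (X : C) : Frame C (n + 1) where
  obj := A.obj ⊗ X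
  fam := append A.fam X
  iso := whiskerRightIso A.iso X ≪≫ appendIso A.fam X

/-- The same object, with the unit object in an additional last place. -/
abbrev lift (A : Frame C n) : Frame C (n + 1) where
  obj := A.obj
  fam := append A.fam (𝟙_ C)
  iso := (ρ_ A.obj).symm ≪≫ whiskerRightIso A.iso (𝟙_ C) ≪≫ appendIso A.fam (𝟙_ C)

theorem Graded.extend {A B : Frame C n} {f : A.obj ⟶ B.obj} (hf : Graded A B f) (X : C) :
    Graded (A.extend X) (B.extend X) (f ▷ X) := by
  obtain ⟨g, hg⟩ := hf
  refine ⟨appendMap g (𝟙 X), ?_⟩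
  simp only [Frame.extend, Iso.trans_hom, whiskerRightIso_hom, Category.assoc]
  rw [← appendIso_natural, MonoidalCategory.tensorHom_id, ← comp_whiskerRight_assoc,
    ← comp_whiskerRight_assoc, hg]

theorem Graded.lift {A B : Frame C n} {f : A.obj ⟶ B.obj} (hf : Graded A B f) :
    Graded A.lift B.lift f := by
  obtain ⟨g, hg⟩ := hf.extend (𝟙_ C)
  refine ⟨g, ?_⟩
  simp only [Frame.extend, Iso.trans_hom, whiskerRightIso_hom, Category.assoc, Frame.lift,
    Iso.symm_hom] at hg ⊢
  rw [rightUnitor_inv_naturality_assoc, hg]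

theorem graded_lift_one : Graded (one C n).lift (one C (n + 1)) (𝟙 (𝟙_ C)) := by
  refine ⟨appendUnit C, ?_⟩
  simp only [Frame.lift, Iso.trans_hom, whiskerRightIso_hom, Category.assoc, Iso.symm_hom]
  rw [appendIso_unit]
  simp

theorem graded_lift_single (X : C) (i : Fin n) :
    Graded (single X i).lift (single X i.castSucc) (𝟙 X) := by
  refine ⟨appendPlace X i, ?_⟩
  simp only [Frame.lift, Iso.trans_hom, whiskerRightIso_hom, Category.assoc, Iso.symm_hom]
  rw [appendIso_place]
  simp

theorem graded_extend_one (X : C) :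
    Graded ((one C n).extend X) (single X (Fin.last n)) (λ_ X).hom := by
  refine ⟨appendLast X, ?_⟩
  simp only [Frame.extend, Iso.trans_hom, whiskerRightIso_hom, Category.assoc]
  rw [appendIso_last]

variable [SymmetricCategory C]

theorem graded_lift_tensor (A B : Frame C n) :
    Graded (A.lift.tensor B.lift) (A.tensor B).lift (𝟙 (A.obj ⊗ B.obj)) := by
  refine ⟨appendMul _ _ (λ_ (𝟙_ C)).hom, ?_⟩
  have h := appendIso_mul A.fam B.fam (λ_ (𝟙_ C)).hom
  -- the identity for arbitrary objects in place of the iterated tensor products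
  have h₁ : ∀ {A B A' B' D P Q R M : C} (f : A ⟶ A') (g : B ⟶ B') (ν : A' ⊗ B' ⟶ D)
      (a : A' ⊗ 𝟙_ C ⟶ P) (a' : B' ⊗ 𝟙_ C ⟶ Q) (μ : P ⊗ Q ⟶ R) (e : R ⟶ M) (a'' : D ⊗ 𝟙_ C ⟶ M),
      (a ⊗ₘ a') ≫ μ ≫ e = tensorμ A' (𝟙_ C) B' (𝟙_ C) ≫ (ν ⊗ₘ (λ_ (𝟙_ C)).hom) ≫ a'' →
      𝟙 _ ≫ (ρ_ _).inv ≫ ((f ⊗ₘ g) ≫ ν) ▷ 𝟙_ C ≫ a'' =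
        (((ρ_ _).inv ≫ f ▷ 𝟙_ C ≫ a ⊗ₘ (ρ_ _).inv ≫ g ▷ 𝟙_ C ≫ a') ≫ μ) ≫ e := by
    intro A B A' B' D P Q R M f g ν a a' μ e a'' H
    let W := objects [A, B, A', B', D, M]
    have := isDiagram_box (X := W) f (wire 0) (wire 2) rfl rfl
    have := isDiagram_box (X := W) g (wire 1) (wire 3) rfl rfl
    have := isDiagram_box (X := W) ν (tens (wire 2) (wire 3)) (wire 4) rfl rfl
    have := isDiagram_box (X := W) a'' (tens (wire 4) unit) (wire 5) rfl rfl
    trans ((ρ_ _).inv ≫ f ▷ 𝟙_ C ⊗ₘ (ρ_ _).inv ≫ g ▷ 𝟙_ C) ≫ tensorμ A' (𝟙_ C) B' (𝟙_ C) ≫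
      (ν ⊗ₘ (λ_ (𝟙_ C)).hom) ≫ a''
    · exact eq_of_diagram W (tens (wire 0) (wire 1)) rfl rfl rfl rfl
    · rw [← H]
      simp
  exact h₁ _ _ _ _ _ _ _ _ h

theorem graded_lift_tensor_extend (A : Frame C n) (X : C) :
    Graded (A.lift.tensor ((one C n).extend X)) (A.extend X) (A.obj ◁ (λ_ X).hom) := by
  refine ⟨fun k => appendMul _ _ (λ_ X).hom k ≫ appendMap (fun k => (ρ_ (A.fam k)).hom) (𝟙 X) k, ?_⟩
  have h := appendIso_mul A.fam (fun _ : Fin n => 𝟙_ C) (λ_ X).hom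
  have h' := appendIso_natural (fun k => (ρ_ (A.fam k)).hom) (𝟙 X)
  have h'' := mulIso_unit_right A.fam
  -- the identity for arbitrary objects in place of the iterated tensor products
  have h₁ : ∀ {A A' J D P Q R M N : C} (f : A ⟶ A') (u : 𝟙_ C ⟶ J) (u' : J ⟶ 𝟙_ C)
      (_ : u ≫ u' = 𝟙 _)
      (ν : A' ⊗ J ⟶ D) (a : A' ⊗ 𝟙_ C ⟶ P) (a' : J ⊗ X ⟶ Q) (μ : P ⊗ Q ⟶ R) (e : R ⟶ M)
      (a'' : D ⊗ X ⟶ M) (t : D ⟶ A') (e' : M ⟶ N) (b : A' ⊗ X ⟶ N),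
      (a ⊗ₘ a') ≫ μ ≫ e = tensorμ A' (𝟙_ C) J X ≫ (ν ⊗ₘ (λ_ X).hom) ≫ a'' →
      (t ⊗ₘ 𝟙 X) ≫ b = a'' ≫ e' → ν ≫ t = A' ◁ u' ≫ (ρ_ _).hom →
      A ◁ (λ_ X).hom ≫ f ▷ X ≫ b =
        (((ρ_ _).inv ≫ f ▷ 𝟙_ C ≫ a ⊗ₘ u ▷ X ≫ a') ≫ μ) ≫ e ≫ e' := by
    intro A A' J D P Q R M N f u u' hu ν a a' μ e a'' t e' b H H' H''
    trans ((ρ_ _).inv ≫ f ▷ 𝟙_ C ⊗ₘ u ▷ X) ≫ tensorμ A' (𝟙_ C) J X ≫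
      (ν ⊗ₘ (λ_ X).hom) ≫ a'' ≫ e'
    · let W := objects [A, A', J, X]
      have := isDiagram_box (X := W) f (wire 0) (wire 1) rfl rfl
      have := isDiagram_box (X := W) u unit (wire 2) rfl rfl
      have := isDiagram_box (X := W) u' (wire 2) unit rfl rfl
      have h₂ : ((ρ_ _).inv ≫ f ▷ 𝟙_ C ⊗ₘ u ▷ X) ≫ tensorμ A' (𝟙_ C) J X ≫
          ((A' ◁ u' ≫ (ρ_ _).hom) ⊗ₘ (λ_ X).hom) = (f ⊗ₘ ((u ≫ u') ▷ X ≫ (λ_ X).hom)) := by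
        exact eq_of_diagram W (tens (wire 0) (tens unit (wire 3))) rfl rfl rfl rfl
      rw [hu] at h₂
      rw [← H', MonoidalCategory.tensorHom_comp_tensorHom_assoc, H'', Category.comp_id,
        reassoc_of% h₂, MonoidalCategory.id_whiskerRight, Category.id_comp,
        MonoidalCategory.tensorHom_def', Category.assoc]
    · rw [← reassoc_of% H]
      simp
  rw [bigTensorMap_comp]
  exact h₁ _ _ _ (unitIso n).hom_inv_id _ _ _ _ _ _ _ _ _ h h' h''

end Frame

end AppendFrame

/-! ### Restriction to fewer generators -/

section UnitTrace

variable {C : Type u} [Category.{v} C] [MonoidalCategory C] [SymmetricCategory C]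

theorem DualPair.trace_unit {D : C} (p : DualPair (𝟙_ C) D) : p.trace (𝟙 (𝟙_ C)) = 𝟙 (𝟙_ C) := by
  let W := objects [D]
  have := isDiagram_box (X := W) p.coev unit (tens unit (wire 0)) rfl rfl
  have := isDiagram_box (X := W) p.ev (tens unit (wire 0)) unit rfl rfl
  refine Eq.trans ?_ p.zigzag_left
  rw [DualPair.trace, MonoidalCategory.whiskerLeft_id]
  unfold DualPair.swap
  exact eq_of_diagram W unit rfl rfl rfl rfl

end UnitTrace

section Restrict

variable {K : Type w} [Field K] {C : Type u} [Category.{v} C] [Preadditive C] [Linear K C]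
  [MonoidalCategory C] [MonoidalPreadditive C] [MonoidalLinear K C] [SymmetricCategory C] {n : ℕ}

open Functionals

namespace Functionals

/-- Balanced functionals are invariant under graded isomorphisms. -/
theorem apply_iso {T : C} (F : Functionals K n T) {A B : Frame C n} (e : A.obj ≅ B.obj)
    (he : Frame.Graded A B e.hom) (ψ : B.obj ⟶ B.obj ⊗ T) :
    F.1 B ψ = F.1 A (e.hom ≫ ψ ≫ e.inv ▷ T) := by
  have h := balanced F he (ψ ≫ e.inv ▷ T)
  refine Eq.trans ?_ h.symm
  congr 1
  simp [← comp_whiskerRight]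

/-- The restriction of balanced functionals to framed objects which have the unit object in the
last place. -/
def restrict (T : C) : Functionals K (n + 1) T →ₗ[K] Functionals K n T where
  toFun F := ⟨fun A => F.1 A.lift, fun A B _ hf ψ => F.2 A.lift B.lift _ hf.lift ψ⟩
  map_add' _ _ := rfl
  map_smul' _ _ := rfl

theorem restrict_map {T T' : C} (f : T ⟶ T') (F : Functionals K (n + 1) T') :
    restrict T (map f F) = map f (restrict T' F) := rfl

end Functionals

theorem restrict_gen (i : Fin n) (X Z : C) (F : Functionals K (n + 1) (X ⊗ Z)) :
    restrict (X ⊗ Z) (gen i.castSucc X Z F) = gen i X Z (restrict (X ⊗ Z) F) := by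
  refine Functionals.ext fun D ψ => ?_
  have h₁ := apply_iso F (A := D.lift.tensor (Frame.single X i).lift)
    (B := (D.tensor (Frame.single X i)).lift) (Iso.refl _) (Frame.graded_lift_tensor _ _)
    (graft ψ (slot (𝟙 (X ⊗ X)) Z))
  have h₂ := apply_iso F (A := D.lift.tensor (Frame.single X i).lift)
    (B := D.lift.tensor (Frame.single X i.castSucc)) (Iso.refl _)
    (by
      have h := (Frame.graded_lift_single X i).whiskerLeft D.lift
      rwa [MonoidalCategory.whiskerLeft_id] at h)
    (graft ψ (slot (𝟙 (X ⊗ X)) Z))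
  exact h₂.trans h₁.symm

variable [LeftRigidCategory C]

theorem restrict_point (g : FreeGroup (Fin n)) (X Z : C) (F : Functionals K (n + 1) (X ⊗ Z)) :
    restrict (X ⊗ Z) ((point K C (n + 1) (FreeGroup.map Fin.castSucc g)).1 X Z F) =
      (point K C n g).1 X Z (restrict (X ⊗ Z) F) := by
  induction g using FreeGroup.induction_on generalizing F with
  | C1 => rw [_root_.map_one, _root_.map_one, _root_.map_one]; rfl
  | of i => rw [FreeGroup.map.of, point_of, point_of, restrict_gen]
  | inv_of i ih =>
    rw [_root_.map_inv, _root_.map_inv, _root_.map_inv,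
      ← inv_mul_apply (point K C n (FreeGroup.of i)) X Z (restrict _ _), ← ih, mul_inv_apply]
  | mul x y hx hy =>
    rw [_root_.map_mul, _root_.map_mul, _root_.map_mul, Units.val_mul, Units.val_mul, mul_apply,
      mul_apply, hx, hy]

end Restrict

section RestrictTrace

variable {K : Type w} [Field K] {C : Type u} [Category.{v} C] [Abelian C] [Linear K C]
  [MonoidalCategory C] [MonoidalPreadditive C] [MonoidalLinear K C] [SymmetricCategory C]
  [LeftRigidCategory C] [Stable C] (S : Semisimple K C) {n : ℕ}

open Functionals

theorem restrict_relOp (g : FreeGroup (Fin n)) (Z : C) (F : Functionals K (n + 1) Z) :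
    restrict Z (relOp K C S (FreeGroup.map Fin.castSucc g) Z F) =
      relOp K C S g Z (restrict Z F) := by
  rw [relOp, relOp, delta_apply, delta_apply, _root_.map_sum]
  refine Finset.sum_congr rfl fun b _ => ?_
  rw [_root_.map_smul, opTrace_apply, opTrace_apply, restrict_map, restrict_point, restrict_map]

/-- The closure of the open morphism `f(b, 1)` is the identity. -/
theorem closeUp_id (b : C) : closeUp b (𝟙 (b ⊗ b)) = 𝟙 b := by
  let W := objects [b, ᘁb, b]
  have := isDiagram_box (X := W) (coform b) unit (tens (wire 1) (wire 2)) rfl rfl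
  have := isDiagram_box (X := W) (form b) (tens (wire 0) (wire 1)) unit rfl rfl
  rw [← (dualPair b).zigzag_left]
  unfold closeUp dualPair
  rw [dualForm_eq]
  exact eq_of_diagram W (wire 0) rfl rfl rfl rfl

theorem opTrace_gen (b : C) (i : Fin n) (Z : C) :
    opTrace (dualPair b) (gen i) Z = loop (K := K) (Frame.single b i) (𝟙 b) Z := by
  unfold opTrace loop gen op
  rw [tube_comp_map, map_comp_tube, closeUp_diagram, closeUp_id]

namespace Semisimple

theorem contract_whiskerRight {A B T T' P P' X : C} (ε : 𝟙_ C ⟶ A) (φ : A ⊗ T ⟶ B ⊗ T')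
    (ω : B ⟶ 𝟙_ C) (a : P ⟶ T ⊗ X) (a' : T' ⊗ X ⟶ P') :
    contract ε ((𝟙 A ⊗ₘ a) ≫ (α_ A T X).inv ≫ φ ▷ X ≫ (α_ B T' X).hom ≫ (𝟙 B ⊗ₘ a')) ω =
      a ≫ contract ε φ ω ▷ X ≫ a' := by
  have h := contract_comp_right ε ((α_ A T X).inv ≫ φ ▷ X ≫ (α_ B T' X).hom) (𝟙 B) a' ω
  rw [Category.assoc, Category.assoc, Category.id_comp] at h
  rw [contract_comp_left, Category.comp_id, h]
  congr 2
  unfold contract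
  monoidal

theorem contract_zero (S : Semisimple K C) {X : C} (ε : 𝟙_ C ⟶ X) (φ : 𝟙_ C ⟶ 𝟙_ C) (ω : X ⟶ 𝟙_ C)
    (h : ε ≫ ω = 𝟙 _) :
    contract ε (((ρ_ X).hom ≫ (λ_ X).inv) ≫ φ ▷ X ≫ (λ_ X).hom ≫ (ρ_ X).inv) ω = φ := by
  have h₁ : (λ_ X).inv ≫ φ ▷ X ≫ (λ_ X).hom = S.scalar φ • 𝟙 X := by
    conv_lhs => rw [S.scalar_spec φ]
    simp
  have h₂ : contract ε (((ρ_ X).hom ≫ (λ_ X).inv) ≫ φ ▷ X ≫ (λ_ X).hom ≫ (ρ_ X).inv) ω =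
      (ρ_ _).inv ≫ (ε ≫ ((λ_ X).inv ≫ φ ▷ X ≫ (λ_ X).hom) ≫ ω) ▷ (𝟙_ C) ≫ (ρ_ _).hom := by
    unfold contract
    rw [unitors_equal, unitors_inv_equal]
    monoidal
  rw [h₂, h₁]
  conv_rhs => rw [S.scalar_spec φ]
  simp [h]

/-- The full partial trace of a morphism that is the identity in the last place. -/
theorem fullTrace_append {n : ℕ} {U : Fin n → C} (φ : bigTensor U ⟶ bigTensor U) (X : C) :
    S.fullTrace ((appendIso U X).inv ≫ φ ▷ X ≫ (appendIso U X).hom) =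
      S.fullTrace φ * (S.dualBases S.unit_mem X).size := by
  induction n with
  | zero =>
    refine (S.fullTrace_succ _).trans ?_
    rw [mul_comm, ← nsmul_eq_mul, ← Fintype.card_fin (S.dualBases S.unit_mem X).size,
      ← Finset.card_univ, ← Finset.sum_const]
    refine Finset.sum_congr rfl fun i _ => ?_
    refine (S.fullTrace_zero _).trans (Eq.trans ?_ (S.fullTrace_zero φ).symm)
    exact congrArg S.scalar (S.contract_zero _ φ _
      (((S.dualBases S.unit_mem X).comp_eq i i).trans (if_pos rfl)))
  | succ n ih =>
    refine (S.fullTrace_succ _).trans ?_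
    rw [S.fullTrace_succ φ, Finset.sum_mul]
    refine Finset.sum_congr rfl fun i _ => ?_
    rw [← ih]
    refine congrArg (S.fullTrace (U := append (fun k => U k.succ) X)) ?_
    refine Eq.trans ?_ (contract_whiskerRight _ φ _ _ _)
    congr 1
    exact Category.assoc _ _ _

theorem dim_unit : S.dim (𝟙_ C) = 1 := by
  refine S.scalar_eq ?_
  rw [one_smul, ← trace_dualPair, DualPair.trace_unit]

/-- Only the unit object contributes, because there are no morphisms from it to the other simple
objects. -/
theorem sum_dim_mul_size :
    ∑ b : S.simples, S.dim b.1 * ((S.dualBases S.unit_mem b.1).size : K) = 1 := by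
  rw [Finset.sum_eq_single ⟨𝟙_ C, S.unit_mem⟩]
  · obtain ⟨e⟩ := S.hom_self _ S.unit_mem
    have h := Module.finrank_eq_card_basis (S.dualBases S.unit_mem (𝟙_ C)).basis
    rw [e.finrank_eq, Module.finrank_self, Fintype.card_fin] at h
    rw [← h, S.dim_unit]
    simp
  · intro b _ hb
    have h : (S.dualBases S.unit_mem b.1).size = 0 := by
      by_contra h
      exact (S.dualBases S.unit_mem b.1).basis.ne_zero ⟨0, Nat.pos_of_ne_zero h⟩
        (S.hom_eq_zero _ S.unit_mem b.1 b.2 (fun h' => hb (Subtype.ext h'.symm)) _)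
    rw [h]
    simp
  · exact fun h => absurd (Finset.mem_univ _) h

end Semisimple

/-- The object `b` in the last place contributes the trace of the identity of `Hom(𝟙, b)`. -/
theorem loop_last_traceFunctional (b : C) :
    restrict (𝟙_ C) (loop (Frame.single b (Fin.last n)) (𝟙 b) (𝟙_ C)
      (S.traceFunctional (n + 1))) =
    ((S.dualBases S.unit_mem b).size : K) • S.traceFunctional n := by
  refine Functionals.ext fun A ψ => ?_
  let F := S.traceFunctional (n + 1)
  have h₁ := apply_iso F (A := A.lift.tensor ((Frame.one C n).extend b)) (B := A.extend b)
    (whiskerLeftIso A.obj (λ_ b)) (Frame.graded_lift_tensor_extend A b)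
    (graft ψ ((β_ (𝟙_ C) b).hom ≫ 𝟙 b ▷ 𝟙_ C))
  have h₂ := apply_iso F (A := A.lift.tensor ((Frame.one C n).extend b))
    (B := A.lift.tensor (Frame.single b (Fin.last n))) (whiskerLeftIso A.obj (λ_ b))
    ((Frame.graded_extend_one b).whiskerLeft A.lift)
    (graft ψ ((β_ (𝟙_ C) b).hom ≫ 𝟙 b ▷ 𝟙_ C))
  have h₃ := S.fullTrace_append (A.iso.inv ≫ ψ ≫ (ρ_ _).hom ≫ A.iso.hom) b
  refine (h₂.trans h₁.symm).trans (Eq.trans ?_ (h₃.trans (mul_comm _ _)))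
  change S.fullTrace (((appendIso A.fam b).inv ≫ A.iso.inv ▷ b) ≫
    graft ψ ((β_ (𝟙_ C) b).hom ≫ 𝟙 b ▷ 𝟙_ C) ≫ (ρ_ _).hom ≫ (A.iso.hom ▷ b ≫ _)) = _
  have h₄ : graft ψ ((β_ (𝟙_ C) b).hom ≫ 𝟙 b ▷ 𝟙_ C) ≫ (ρ_ _).hom = (ψ ≫ (ρ_ _).hom) ▷ b := by
    let W := objects [A.obj, b, A.obj]
    have := isDiagram_box (X := W) ψ (wire 0) (tens (wire 2) unit) rfl rfl
    unfold graft
    exact eq_of_diagram W (tens (wire 0) (wire 1)) rfl rfl rfl rfl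
  rw [reassoc_of% h₄]
  simp

/-- The operator of the relator `y` cancels the generator `y`: the sum over the simple objects `b`
of the rank of `b`, times the dimension of `Hom(𝟙, b)`, is one. -/
theorem restrict_relOp_last :
    restrict (𝟙_ C) (relOp K C S (FreeGroup.of (Fin.last n)) (𝟙_ C)
      (S.traceFunctional (n + 1))) = S.traceFunctional n := by
  rw [relOp, delta_apply, _root_.map_sum]
  simp only [_root_.map_smul, point_of, opTrace_gen, loop_last_traceFunctional, smul_smul,
    ← Finset.sum_smul, S.sum_dim_mul_size, one_smul]

theorem atUnit_restrict (F : Functionals K (n + 1) (𝟙_ C)) :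
    atUnit (restrict (𝟙_ C) F) = atUnit F := by
  have h := apply_iso F (A := (Frame.one C n).lift) (B := Frame.one C (n + 1)) (Iso.refl _)
    Frame.graded_lift_one (ρ_ (𝟙_ C)).inv
  refine Eq.trans ?_ h.symm
  refine congrArg (F.1 (Frame.one C n).lift) ?_
  simp

theorem restrict_prod {m : ℕ} (R : Fin m → FreeGroup (Fin n))
    (F : Functionals K (n + 1) (𝟙_ C)) : restrict (𝟙_ C) ((List.ofFn fun j =>
      relOp K C S (FreeGroup.map Fin.castSucc (R j)) (𝟙_ C)).prod F) =
        (List.ofFn fun j => relOp K C S (R j) (𝟙_ C)).prod (restrict (𝟙_ C) F) := by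
  induction m with
  | zero => rfl
  | succ m ih =>
    rw [List.ofFn_succ, List.prod_cons, List.ofFn_succ, List.prod_cons, Module.End.mul_apply,
      Module.End.mul_apply, restrict_relOp, ih fun j => R j.succ]

end RestrictTrace

/-! ### Invariance under the Andrews–Curtis moves -/

section Moves

/-- The product over a family does not change if a member `R i` is replaced with `R i * R s`,
provided that `f (g * h)` and `f g` always have the same product with `f h`. -/
theorem prod_update_mul {ι G M : Type*} [Fintype ι] [DecidableEq ι] [Mul G] [CommMonoid M]
    (f : G → M) (hf : ∀ g h, f (g * h) * f h = f g * f h) (R : ι → G) {i s : ι} (his : i ≠ s) :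
    ∏ j, f (Function.update R i (R i * R s) j) = ∏ j, f (R j) := by
  have hs : s ∈ Finset.univ.erase i := Finset.mem_erase.2 ⟨his.symm, Finset.mem_univ s⟩
  rw [← Finset.mul_prod_erase Finset.univ _ (Finset.mem_univ i), ← Finset.mul_prod_erase _ _ hs,
    ← Finset.mul_prod_erase Finset.univ (fun j => f (R j)) (Finset.mem_univ i),
    ← Finset.mul_prod_erase _ (fun j => f (R j)) hs, ← mul_assoc, ← mul_assoc,
    Function.update_self, Function.update_of_ne his.symm, hf]
  congr 1
  refine Finset.prod_congr rfl fun j hj => ?_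
  rw [Function.update_of_ne (Finset.ne_of_mem_erase (Finset.mem_of_mem_erase hj))]

theorem prod_update_congr {ι G M : Type*} [Fintype ι] [DecidableEq ι] [CommMonoid M] (f : G → M)
    (R : ι → G) (i : ι) {x : G} (hx : f x = f (R i)) :
    ∏ j, f (Function.update R i x j) = ∏ j, f (R j) := by
  refine Finset.prod_congr rfl fun j _ => ?_
  by_cases h : j = i
  · subst h
    rw [Function.update_self, hx]
  · rw [Function.update_of_ne h]

variable {K : Type w} [Field K] {C : Type u} [Category.{v} C] [Abelian C] [Linear K C]
  [MonoidalCategory C] [MonoidalPreadditive C] [MonoidalLinear K C] [SymmetricCategory C]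
  [LeftRigidCategory C] [Stable C] (S : Semisimple K C) (n : ℕ)

open Functionals
open scoped IsMulCommutative

/-- The monoid of operators that is generated by the operators of the relators. -/
abbrev relMonoid : Submonoid (Module.End K (Functionals K n (𝟙_ C))) :=
  Submonoid.closure (Set.range fun g => relOp K C S g (𝟙_ C))

instance : IsMulCommutative (relMonoid S n) :=
  Submonoid.isMulCommutative_closure _ (by
    rintro _ ⟨g, rfl⟩ _ ⟨g', rfl⟩
    exact relOp_commute S g g' (𝟙_ C))

/-- The operator of a relator, as an element of the commutative monoid of these operators. -/
def relElement (g : FreeGroup (Fin n)) : relMonoid S n :=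
  ⟨relOp K C S g (𝟙_ C), Submonoid.subset_closure ⟨g, rfl⟩⟩

variable {n}

theorem prod_relElement {m : ℕ} (R : Fin m → FreeGroup (Fin n)) :
    (∏ j, relElement S n (R j)).1 = (List.ofFn fun j => relOp K C S (R j) (𝟙_ C)).prod := by
  rw [← List.prod_ofFn]
  refine ((relMonoid S n).subtype.map_list_prod _).trans ?_
  rw [List.map_ofFn]
  rfl

/-- The invariant of a presentation whose relators are elements of the free group, in terms of the
operators of the relators. -/
def presQ (P : Presentation) : K := atUnit ((List.ofFn fun j =>
  relOp K C S (P.rel j) (𝟙_ C)).prod (S.traceFunctional P.numGens))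

/-- The operators commute, so that their product may be taken over an unordered family. -/
theorem presQ_eq {m : ℕ} (R : Fin m → FreeGroup (Fin n)) :
    presQ S ⟨n, m, R⟩ = atUnit ((∏ j, relElement S n (R j)).1 (S.traceFunctional n)) := by
  rw [prod_relElement]
  rfl

theorem presQ_stabilize {m : ℕ} (R : Fin m → FreeGroup (Fin n)) :
    presQ S ⟨n + 1, m + 1, Fin.snoc (α := fun _ => FreeGroup (Fin (n + 1)))
      (fun j => FreeGroup.map Fin.castSucc (R j)) (FreeGroup.of (Fin.last n))⟩ =
      presQ S ⟨n, m, R⟩ := by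
  rw [presQ, presQ, List.ofFn_succ', List.concat_eq_append, List.prod_append, List.prod_singleton,
    Module.End.mul_apply, ← atUnit_restrict]
  simp only [Fin.snoc_castSucc, Fin.snoc_last]
  rw [restrict_prod, restrict_relOp_last]

theorem presQ_move {P P' : Presentation} (h : ACMove P P') : presQ S P' = presQ S P := by
  cases h with
  | interchange R i s =>
    rw [presQ_eq, presQ_eq, Equiv.prod_comp (Equiv.swap i s) fun j => relElement S _ (R j)]
  | conjugate R i g =>
    rw [presQ_eq, presQ_eq, prod_update_congr _ _ _ (Subtype.ext (relOp_conj S _ _ _))]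
  | invert R i =>
    rw [presQ_eq, presQ_eq, prod_update_congr _ _ _ (Subtype.ext (relOp_inv S _ _))]
  | multiply R i s his =>
    rw [presQ_eq, presQ_eq, prod_update_mul _
      (fun _ _ => Subtype.ext (relOp_mul_relOp S _ _ _)) _ his]
  | stabilize R => exact presQ_stabilize S R
  | destabilize R => exact (presQ_stabilize S R).symm

end Moves
end QuinnInvariant
end

theorem mainTheorem1 {K : Type w} [Field K] {C : Type u} [CategoryTheory.Category.{v} C]
    [CategoryTheory.Abelian C] [CategoryTheory.Linear K C]
    [CategoryTheory.MonoidalCategory C] [CategoryTheory.MonoidalPreadditive C]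
    [CategoryTheory.MonoidalLinear K C] [CategoryTheory.SymmetricCategory C]
    [CategoryTheory.LeftRigidCategory C] [QuinnInvariant.Stable C]
    (S : QuinnInvariant.Semisimple K C) (P P' : QuinnInvariant.WordPresentation)
    (h : QuinnInvariant.ACMove P.toPresentation P'.toPresentation) :
    QuinnInvariant.Q S P' = QuinnInvariant.Q S P := by
  rw [QuinnInvariant.Q_eq, QuinnInvariant.Q_eq]
  exact QuinnInvariant.presQ_move S h
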